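/- Let $d\ge 2$, let $\Omega\subset\mathbb R^d$ be a bounded Lipschitz domain, $\nu>0$, and let $s\in(0,\infty)$, $r\in(0,\infty]$ satisfy $\frac2s+\frac dr\le 1$ (with $d/\infty=0$). Let $L^2_\sigma(\Omega)$ and $H^1_{0,\sigma}(\Omega)$ be the closures of the smooth compactly supported divergence-free vector fields $C^\infty_{c,\sigma}(\Omega;\mathbb R^d)$ in $L^2$ and in $H^1$. Then there is a constant $c>0$, depending only on $d,\Omega,\nu,s,r$, such that the following holds. Let $T>0$, $v_0\in L^2_\sigma(\Omega)$, $f=f_1+f_2$ with $f_1\in L^2(0,T;H^{-1}(\Omega))$ and $f_2\in L^1(0,T;L^2(\Omega))$, where $H^{-1}(\Omega)=(H^1_0(\Omega;\mathbb R^d))^*$. Let $v\in \mathbb X=L^\infty(0,T;L^2_\sigma(\Omega))\cap L^2(0,T;H^1_{0,\sigma}(\Omega))$ be a weak solution of the Navier–Stokes equations, that is, $$-\int_0^T\!\!\int_\Omega v\cdot\partial_t\varphi\,dx\,dt+\int_0^T\!\!\int_\Omega\big(\nu\nabla v:\nabla\varphi+(v\cdot\nabla)v\cdot\varphi\big)dx\,dt=\int_0^T\langle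 f,\varphi\rangle\,dt+\int_\Omega v_0\cdot\varphi(0)\,dx$$ for all $\varphi\in C^1_c([0,T);C^\infty_{c,\sigma}(\Omega;\mathbb R^d))$, which satisfies the energy inequality $$\tfrac12\|v(t)\|_{L^2}^2+\nu\int_0^t\|\nabla v\|_{L^2}^2\,d\tau\le\tfrac12\|v_0\|_{L^2}^2+\int_0^t\langle f,v\rangle\,d\tau\qquad\text{for a.e. }t\in(0,T).$$ Then $v$ is a dissipative solution: for a.e. $t\in(0,T)$ and for all $\tilde v\in C^1([0,T];H^2(\Omega;\mathbb R^d)\cap H^1_{0,\sigma}(\Omega))$ with $\int_0^t\mathcal K(\tilde v)\,d\tau<\infty$ (otherwise the right-hand side below is read as $+\infty$), the integrals below exist and $$\mathcal R(v(t)|\tilde v(t))+\int_0^t\Big(\mathcal W(v|\tilde v)+\langle\mathcal A(\tilde v),v-\tilde v\rangle\Big)e^{\int_\tau^t\mathcal K(\tilde v)}\,d\tau\le\mathcal R(v_0|\tilde v(0))\,e^{\int_0^t\mathcal K(\tilde v)},$$ where $\mathcal R(u|w)=\frac12\|u-w\|_{L^2(\Omega)}^2$, $\mathcal W(u|w)=\frac\nu2\|\nabla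 u-\nabla w\|_{L^2(\Omega)}^2$, $\mathcal K(\tilde v)=c\,\|\tilde v\|_{L^r(\Omega)}^s\in[0,\infty]$, and $\mathcal A(\tilde v)=\partial_t\tilde v+(\tilde v\cdot\nabla)\tilde v-\nu\Delta\tilde v-f+\nabla\tilde p$ is understood weakly in space, i.e. for $w\in H^1_{0,\sigma}(\Omega)$ $$\langle\mathcal A(\tilde v),w\rangle=\int_\Omega\big(\partial_t\tilde v\cdot w+(\tilde v\cdot\nabla)\tilde v\cdot w+\nu\nabla\tilde v:\nabla w\big)dx-\langle f,w\rangle .$$ -/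

import Mathlib

open MeasureTheory Set Topology TopologicalSpace
open scoped ENNReal

noncomputable section

namespace NavierStokes

/-! ### Lebesgue spaces, Lipschitz domains -/

/-- Points and velocity vectors in `ℝ^d`. -/
abbrev Vec (d : ℕ) := EuclideanSpace ℝ (Fin d)

/-- Matrices with the Frobenius norm; the entry `(i, j)` of a gradient is `∂ᵢ uⱼ`. -/
abbrev Mat (d : ℕ) := EuclideanSpace ℝ (Fin d × Fin d)

/-- Third order tensors; the entry `(i, j, k)` of a second gradient is `∂ᵢ ∂ⱼ uₖ`. -/
abbrev Ten (d : ℕ) := EuclideanSpace ℝ (Fin d × Fin d × Fin d)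

/-- The `i`-th standard unit vector. -/
abbrev unitVec {d : ℕ} (i : Fin d) : Vec d := EuclideanSpace.single i 1

/-- `L²(Ω; F)`. -/
abbrev L2 {d : ℕ} (Ω : Opens (Vec d)) (F : Type) [NormedAddCommGroup F] :=
  Lp F 2 (volume.restrict (Ω : Set (Vec d)))

/-- A bounded Lipschitz domain: a nonempty, connected, bounded open set which, in a ball around
each of its boundary points, is the strict supergraph of a Lipschitz function `g` in the direction
of some unit vector `n`. Here `g` is evaluated at the projection of `x` to the hyperplane
orthogonal to `n`, so it is a Lipschitz function of `d - 1` variables. -/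
structure IsLipschitzDomain {d : ℕ} (Ω : Opens (Vec d)) : Prop where
  connected : IsConnected (Ω : Set (Vec d))
  bounded : Bornology.IsBounded (Ω : Set (Vec d))
  graph : ∀ x₀ ∈ frontier (Ω : Set (Vec d)), ∃ (n : Vec d) (g : Vec d → ℝ) (L : NNReal) (ρ : ℝ),
    ‖n‖ = 1 ∧ LipschitzWith L g ∧ 0 < ρ ∧
      ∀ x ∈ Metric.ball x₀ ρ, x ∈ Ω ↔ g (x - inner ℝ n x • n) < inner ℝ n x

variable {d : ℕ} {Ω : Opens (Vec d)}

/-! ### Test fields and the spaces `H¹₀`, `H⁻¹`, `L²_σ`, `H¹_{0,σ}` -/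

/-- The classical gradient of a vector field, with entries `∂ᵢ uⱼ`. -/
def gradField (u : Vec d → Vec d) (x : Vec d) : Mat d :=
  WithLp.toLp 2 fun p => fderiv ℝ u x (unitVec p.1) p.2

/-- The classical divergence of a vector field. -/
def divField (u : Vec d → Vec d) (x : Vec d) : ℝ :=
  ∑ i, fderiv ℝ u x (unitVec i) i

/-- Smooth compactly supported vector fields `C_c^∞(Ω; ℝ^d)`, with the canonical LF topology. -/
abbrev TestField (Ω : Opens (Vec d)) := TestFunction Ω (Vec d) ⊤

/-- `φ` is solenoidal, that is, `φ ∈ C_{c,σ}^∞(Ω; ℝ^d)`. -/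
def IsSolenoidal (φ : TestField Ω) : Prop := ∀ x, divField φ x = 0

theorem memLp_testField (φ : TestField Ω) :
    MemLp (φ : Vec d → Vec d) 2 (volume.restrict (Ω : Set (Vec d))) :=
  (φ.continuous.memLp_of_hasCompactSupport φ.hasCompactSupport).restrict _

theorem memLp_gradField (φ : TestField Ω) :
    MemLp (gradField φ) 2 (volume.restrict (Ω : Set (Vec d))) := by
  have hc : Continuous (fderiv ℝ (φ : Vec d → Vec d)) :=
    φ.contDiff.continuous_fderiv (by simp)
  have h1 : Continuous (gradField (φ : Vec d → Vec d)) := by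
    unfold gradField
    fun_prop
  have h2 : HasCompactSupport (gradField (φ : Vec d → Vec d)) := by
    refine (φ.hasCompactSupport.fderiv (𝕜 := ℝ)).mono fun x hx => ?_
    contrapose! hx
    have hx' : fderiv ℝ (φ : Vec d → Vec d) x = 0 := by simpa using hx
    simp only [Function.mem_support, not_not]
    ext p
    simp [gradField, hx']
  exact (h1.memLp_of_hasCompactSupport h2).restrict _

/-- Pairs `(u, G)` of an `L²` vector field and an `L²` matrix field, with the Hilbert norm
`(‖u‖² + ‖G‖²)^(1/2)`. A function `u ∈ H¹(Ω; ℝ^d)` is represented by the pair `(u, ∇u)`, whose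
norm is the `H¹` norm of `u`. -/
abbrev GradPair (Ω : Opens (Vec d)) := WithLp 2 (L2 Ω (Vec d) × L2 Ω (Mat d))

/-- A test field as an element of `L²`. -/
def testL2 (φ : TestField Ω) : L2 Ω (Vec d) := (memLp_testField φ).toLp φ

/-- A test field together with its gradient. -/
def testPair (φ : TestField Ω) : GradPair Ω :=
  WithLp.toLp 2 (testL2 φ, (memLp_gradField φ).toLp (gradField φ))

/-- `H¹₀(Ω; ℝ^d)`: the closure of `C_c^∞(Ω; ℝ^d)` in the `H¹` norm. -/
def H10 (Ω : Opens (Vec d)) : Submodule ℝ (GradPair Ω) :=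
  (Submodule.span ℝ (range (testPair (Ω := Ω)))).topologicalClosure

/-- `H⁻¹(Ω)`, the dual space of `H¹₀(Ω; ℝ^d)`. -/
abbrev HNeg1 (Ω : Opens (Vec d)) := StrongDual ℝ (H10 Ω)

/-- `L²_σ(Ω)`: the closure of `C_{c,σ}^∞(Ω; ℝ^d)` in the `L²` norm. -/
def L2sol (Ω : Opens (Vec d)) : Submodule ℝ (L2 Ω (Vec d)) :=
  (Submodule.span ℝ (testL2 '' {φ : TestField Ω | IsSolenoidal φ})).topologicalClosure

/-- `H¹_{0,σ}(Ω)`: the closure of `C_{c,σ}^∞(Ω; ℝ^d)` in the `H¹` norm. -/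
def H10sol (Ω : Opens (Vec d)) : Submodule ℝ (GradPair Ω) :=
  (Submodule.span ℝ (testPair '' {φ : TestField Ω | IsSolenoidal φ})).topologicalClosure

theorem H10sol_le_H10 (Ω : Opens (Vec d)) : H10sol Ω ≤ H10 Ω :=
  Submodule.topologicalClosure_mono (Submodule.span_mono (image_subset_range _ _))

/-- A solenoidal test field as an element of `H¹_{0,σ}(Ω)`. -/
def testSol (φ : TestField Ω) (hφ : IsSolenoidal φ) : H10sol Ω :=
  ⟨testPair φ, Submodule.le_topologicalClosure _ (Submodule.subset_span ⟨φ, hφ, rfl⟩)⟩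

/-- The field `u` itself, for `u ∈ H¹_{0,σ}(Ω)`. -/
def val (u : H10sol Ω) : L2 Ω (Vec d) := (u : GradPair Ω).fst

/-- The gradient `∇u`, for `u ∈ H¹_{0,σ}(Ω)`. -/
def grad (u : H10sol Ω) : L2 Ω (Mat d) := (u : GradPair Ω).snd

/-! ### The space `H² ∩ H¹_{0,σ}` of the test functions -/

/-- `D` is the weak gradient of the matrix field `G` in `Ω`, that is, `D_{ijk} = ∂ᵢ G_{jk}`. -/
def IsWeakGrad (G : L2 Ω (Mat d)) (D : L2 Ω (Ten d)) : Prop :=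
  ∀ (η : TestFunction Ω ℝ ⊤) (i j k : Fin d),
    ∫ x in (Ω : Set (Vec d)), G x (j, k) * fderiv ℝ η x (unitVec i) =
      -∫ x in (Ω : Set (Vec d)), D x (i, j, k) * η x

theorem integrable_coord_mul {ι : Type} [Fintype ι] (G : L2 Ω (EuclideanSpace ℝ ι)) (i : ι)
    {h : Vec d → ℝ} (hc : Continuous h) (hs : HasCompactSupport h) :
    Integrable (fun x => G x i * h x) (volume.restrict (Ω : Set (Vec d))) := by
  have h1 : MemLp (fun x => G x i) 2 (volume.restrict (Ω : Set (Vec d))) :=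
    (EuclideanSpace.proj (𝕜 := ℝ) i).comp_memLp' (Lp.memLp G)
  have h2 : MemLp h 2 (volume.restrict (Ω : Set (Vec d))) :=
    (hc.memLp_of_hasCompactSupport hs).restrict _
  exact h1.integrable_mul h2

theorem integral_coord_add {ι : Type} [Fintype ι] (G G' : L2 Ω (EuclideanSpace ℝ ι)) (i : ι)
    {h : Vec d → ℝ} (hc : Continuous h) (hs : HasCompactSupport h) :
    ∫ x in (Ω : Set (Vec d)), (G + G') x i * h x =
      (∫ x in (Ω : Set (Vec d)), G x i * h x) + ∫ x in (Ω : Set (Vec d)), G' x i * h x := by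
  rw [← integral_add (integrable_coord_mul G i hc hs) (integrable_coord_mul G' i hc hs)]
  refine integral_congr_ae ?_
  filter_upwards [Lp.coeFn_add G G'] with x hx
  rw [hx]
  simp [add_mul]

theorem integral_coord_smul {ι : Type} [Fintype ι] (a : ℝ) (G : L2 Ω (EuclideanSpace ℝ ι)) (i : ι)
    (h : Vec d → ℝ) :
    ∫ x in (Ω : Set (Vec d)), (a • G) x i * h x =
      a * ∫ x in (Ω : Set (Vec d)), G x i * h x := by
  rw [← integral_const_mul]
  refine integral_congr_ae ?_
  filter_upwards [Lp.coeFn_smul a G] with x hx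
  rw [hx]
  simp [mul_assoc]

theorem continuous_fderiv_test (η : TestFunction Ω ℝ ⊤) (i : Fin d) :
    Continuous fun x => fderiv ℝ (η : Vec d → ℝ) x (unitVec i) := by
  have hc : Continuous (fderiv ℝ (η : Vec d → ℝ)) := η.contDiff.continuous_fderiv (by simp)
  fun_prop

theorem hasCompactSupport_fderiv_test (η : TestFunction Ω ℝ ⊤) (i : Fin d) :
    HasCompactSupport fun x => fderiv ℝ (η : Vec d → ℝ) x (unitVec i) :=
  η.hasCompactSupport.fderiv_apply (𝕜 := ℝ) _

/-- `H²(Ω; ℝ^d) ∩ H¹_{0,σ}(Ω)`: the pairs `(u, D)` of `u ∈ H¹_{0,σ}(Ω)` and the weak second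
gradient `D = ∇²u ∈ L²`. The norm is the `H²` norm of `u`. -/
def H2sol (Ω : Opens (Vec d)) : Submodule ℝ (WithLp 2 (H10sol Ω × L2 Ω (Ten d))) where
  carrier := {y | IsWeakGrad (grad y.fst) y.snd}
  zero_mem' := by
    intro η i j k
    have h1 := integral_coord_smul (Ω := Ω) 0 (0 : L2 Ω (Mat d)) (j, k)
      fun x => fderiv ℝ (η : Vec d → ℝ) x (unitVec i)
    have h2 := integral_coord_smul (Ω := Ω) 0 (0 : L2 Ω (Ten d)) (i, j, k) (η : Vec d → ℝ)
    rw [zero_smul, zero_mul] at h1 h2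
    change ∫ x in (Ω : Set (Vec d)), (0 : L2 Ω (Mat d)) x (j, k) * _ =
      -∫ x in (Ω : Set (Vec d)), (0 : L2 Ω (Ten d)) x (i, j, k) * _
    rw [h1, h2, neg_zero]
  add_mem' := by
    intro y z hy hz η i j k
    change ∫ x in (Ω : Set (Vec d)), (grad y.fst + grad z.fst) x (j, k) * _ =
      -∫ x in (Ω : Set (Vec d)), (y.snd + z.snd) x (i, j, k) * _
    rw [integral_coord_add _ _ _ (continuous_fderiv_test η i) (hasCompactSupport_fderiv_test η i),
      integral_coord_add _ _ _ η.continuous η.hasCompactSupport, hy η i j k, hz η i j k]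
    ring
  smul_mem' := by
    intro a y hy η i j k
    change ∫ x in (Ω : Set (Vec d)), (a • grad y.fst) x (j, k) * _ =
      -∫ x in (Ω : Set (Vec d)), (a • y.snd) x (i, j, k) * _
    rw [integral_coord_smul, integral_coord_smul, hy η i j k]
    ring

/-- The inclusion of `H² ∩ H¹_{0,σ}` into `H¹_{0,σ}`. -/
def toH10sol (y : H2sol Ω) : H10sol Ω := (y : WithLp 2 (H10sol Ω × L2 Ω (Ten d))).fst

/-! ### The terms of the equation -/

/-- The integrand `((u · ∇) b) · w` of the convective term, where `G = ∇b`. -/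
def convIntegrand (u : L2 Ω (Vec d)) (G : L2 Ω (Mat d)) (w : L2 Ω (Vec d)) (x : Vec d) : ℝ :=
  ∑ i, ∑ j, u x i * G x (i, j) * w x j

/-- The convective term `∫_Ω ((u · ∇) b) · w dx`, where `G = ∇b`. -/
def conv (u : L2 Ω (Vec d)) (G : L2 Ω (Mat d)) (w : L2 Ω (Vec d)) : ℝ :=
  ∫ x in (Ω : Set (Vec d)), convIntegrand u G w x

/-- The pairing `⟨f, w⟩` of a force `f = f₁ + f₂`, with `f₁ ∈ H⁻¹(Ω)` and `f₂ ∈ L²(Ω; ℝ^d)`,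
with `w ∈ H¹_{0,σ}(Ω)`. -/
def pairing (f₁ : HNeg1 Ω) (f₂ : L2 Ω (Vec d)) (w : H10sol Ω) : ℝ :=
  f₁ (Submodule.inclusion (H10sol_le_H10 Ω) w) + inner ℝ f₂ (val w)

/-- The time interval `(0, T)` with Lebesgue measure. -/
def timeMeasure (T : ℝ) : Measure ℝ := volume.restrict (Ioo 0 T)

/-- The space `L^∞(0,T; L²_σ(Ω)) ∩ L²(0,T; H¹_{0,σ}(Ω))`. -/
def IsStateX (T : ℝ) (v : ℝ → H10sol Ω) : Prop :=
  MemLp v 2 (timeMeasure T) ∧ MemLp (fun t => val (v t)) ∞ (timeMeasure T)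

/-- `φ ∈ C¹_c([0,T); C_{c,σ}^∞(Ω; ℝ^d))` with time derivative `φ'`, the limit
of the difference quotients in the topology of `C_c^∞`. -/
structure IsTestPath (T : ℝ) (φ φ' : ℝ → TestField Ω) : Prop where
  solenoidal : ∀ t, IsSolenoidal (φ t)
  hasDeriv : ∀ t ∈ Icc 0 T,
    Filter.Tendsto (fun τ => (τ - t)⁻¹ • (φ τ - φ t)) (𝓝[Icc 0 T \ {t}] t) (𝓝 (φ' t))
  continuous_deriv : ContinuousOn φ' (Icc 0 T)
  compact_support : ∃ T' < T, ∀ t ∈ Icc T' T, φ t = 0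

/-- `v` is a weak solution of the Navier–Stokes equations on `Ω × (0,T)` with viscosity `ν`, force
`f₁ + f₂`, initial value `v₀`, and homogeneous Dirichlet boundary values. -/
structure IsWeakSolution (ν T : ℝ) (f₁ : ℝ → HNeg1 Ω) (f₂ : ℝ → L2 Ω (Vec d)) (v₀ : L2sol Ω)
    (v : ℝ → H10sol Ω) : Prop where
  state : IsStateX T v
  weak_form : ∀ (φ φ' : ℝ → TestField Ω) (hφ : IsTestPath T φ φ'),
    -(∫ t in Ioo 0 T, inner ℝ (val (v t)) (testL2 (φ' t))) +
      ∫ t in Ioo 0 T,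
        (ν * inner ℝ (grad (v t)) (grad (testSol (φ t) (hφ.solenoidal t))) +
          conv (val (v t)) (grad (v t)) (testL2 (φ t))) =
      (∫ t in Ioo 0 T, pairing (f₁ t) (f₂ t) (testSol (φ t) (hφ.solenoidal t))) +
        inner ℝ (v₀ : L2 Ω (Vec d)) (testL2 (φ 0))

/-- The energy inequality, for almost every `t ∈ (0,T)`. -/
def EnergyInequality (ν T : ℝ) (f₁ : ℝ → HNeg1 Ω) (f₂ : ℝ → L2 Ω (Vec d)) (v₀ : L2sol Ω)
    (v : ℝ → H10sol Ω) : Prop :=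
  ∀ᵐ t ∂timeMeasure T,
    1 / 2 * ‖val (v t)‖ ^ 2 + ν * ∫ τ in Ioo 0 t, ‖grad (v τ)‖ ^ 2 ≤
      1 / 2 * ‖(v₀ : L2 Ω (Vec d))‖ ^ 2 + ∫ τ in Ioo 0 t, pairing (f₁ τ) (f₂ τ) (v τ)

/-! ### Dissipative solutions -/

/-- The relative energy `R(u | w) = ½ ‖u - w‖²_{L²}`. -/
def relEnergy (u w : L2 Ω (Vec d)) : ℝ := 1 / 2 * ‖u - w‖ ^ 2

/-- The relative dissipation `W(u | w) = (ν/2) ‖∇u - ∇w‖²_{L²}`. -/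
def relDissipation (ν : ℝ) (u w : H10sol Ω) : ℝ := ν / 2 * ‖grad u - grad w‖ ^ 2

/-- The regularity measure `K(u) = c ‖u‖_{L^r}^s`, with value `∞` if `u ∉ L^r`. -/
def regMeasure (c s : ℝ) (r : ℝ≥0∞) (u : L2 Ω (Vec d)) : ℝ≥0∞ :=
  ENNReal.ofReal c * eLpNorm u r (volume.restrict (Ω : Set (Vec d))) ^ s

/-- `∫_a^b K(ṽ(τ)) dτ`. -/
def regIntegral (c s : ℝ) (r : ℝ≥0∞) (vt : ℝ → H2sol Ω) (a b : ℝ) : ℝ≥0∞ :=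
  ∫⁻ τ in Ioo a b, regMeasure c s r (val (toH10sol (vt τ)))

/-- `⟨A(ṽ)(t), w⟩`, with the solution operator
`A(ṽ) = ∂ₜṽ + (ṽ · ∇)ṽ - ν Δṽ + ∇p̃ - f` in the weak sense in space. The term
`⟨∇p̃, w⟩` vanishes since `w` is solenoidal with zero boundary values. -/
def solOperator (ν T : ℝ) (f₁ : ℝ → HNeg1 Ω) (f₂ : ℝ → L2 Ω (Vec d)) (vt : ℝ → H2sol Ω)
    (t : ℝ) (w : H10sol Ω) : ℝ :=
  inner ℝ (val (toH10sol (derivWithin vt (Icc 0 T) t))) (val w) +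
    conv (val (toH10sol (vt t))) (grad (toH10sol (vt t))) (val w) +
    ν * inner ℝ (grad (toH10sol (vt t))) (grad w) -
    pairing (f₁ t) (f₂ t) w

/-- The integrand `(W(v | ṽ) + ⟨A(ṽ), v - ṽ⟩) exp(∫_τ^t K(ṽ))` of the relative energy
inequality at time `t`. -/
def relIntegrand (c s : ℝ) (r : ℝ≥0∞) (ν T : ℝ) (f₁ : ℝ → HNeg1 Ω) (f₂ : ℝ → L2 Ω (Vec d))
    (v : ℝ → H10sol Ω) (vt : ℝ → H2sol Ω) (t τ : ℝ) : ℝ :=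
  (relDissipation ν (v τ) (toH10sol (vt τ)) +
      solOperator ν T f₁ f₂ vt τ (v τ - toH10sol (vt τ))) *
    Real.exp (regIntegral c s r vt τ t).toReal

/-- `v` is a dissipative solution: for almost every `t ∈ (0,T)` the relative energy inequality holds
for all `ṽ ∈ C¹([0,T]; H² ∩ H¹_{0,σ})`. The integrals on its left-hand side exist. If
`∫_0^t K(ṽ)` is infinite, then the right-hand side is infinite and nothing is required. -/
def IsDissipativeSolution (c s : ℝ) (r : ℝ≥0∞) (ν T : ℝ) (f₁ : ℝ → HNeg1 Ω)
    (f₂ : ℝ → L2 Ω (Vec d)) (v₀ : L2sol Ω) (v : ℝ → H10sol Ω) : Prop :=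
  IsStateX T v ∧
    ∀ᵐ t ∂timeMeasure T, ∀ vt : ℝ → H2sol Ω, ContDiffOn ℝ 1 vt (Icc 0 T) →
      regIntegral c s r vt 0 t < ∞ →
      (∀ᵐ τ ∂volume.restrict (Ioo 0 t),
        Integrable (convIntegrand (val (toH10sol (vt τ))) (grad (toH10sol (vt τ)))
          (val (v τ - toH10sol (vt τ)))) (volume.restrict (Ω : Set (Vec d)))) ∧
      IntegrableOn (relIntegrand c s r ν T f₁ f₂ v vt t) (Ioo 0 t) ∧
      relEnergy (val (v t)) (val (toH10sol (vt t))) +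
          ∫ τ in Ioo 0 t, relIntegrand c s r ν T f₁ f₂ v vt t τ ≤
        relEnergy (v₀ : L2 Ω (Vec d)) (val (toH10sol (vt 0))) *
          Real.exp (regIntegral c s r vt 0 t).toReal

end NavierStokes

end

open MeasureTheory Set Topology TopologicalSpace
open scoped ENNReal ContDiff
noncomputable section
namespace NavierStokes
variable {d : ℕ} {Ω : Opens (Vec d)}


/-! The proof is the relative energy method. Let `w` be the comparison path and `u = v - w`. In
`R(v|w) = ½‖v‖² - (v,w) + ½‖w‖²` the first term is controlled by the energy inequality, the last one
by the fundamental theorem of calculus, and the mixed one by testing the equation with `w`. In the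
sum, the convective terms of the equation and of `A(w)` collapse to the single term `∫ (u·∇)u·w`
(`IsProductConst.conv_add_conv_sub_eq`), because `∫ (a·∇)b·c` is antisymmetric in `b` and `c` for
solenoidal `a`. The viscous terms leave `ν‖∇u‖²`; one half of it is `W(v|w)`, the other half absorbs
the convective term. Indeed Hölder, Gagliardo-Nirenberg and Poincaré give `‖|u||w|‖₂ ≤ C ‖w‖_r
‖u‖₂^(2/s) ‖∇u‖₂^(1-2/s)`, and Young's inequality turns this into `|∫ (u·∇)u·w| ≤ (ν/2)‖∇u‖² + K(w)
R(v|w)` (`IsProductConst.abs_conv_grad_le`). This is where the constant `c` is fixed. The integral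
form of Gronwall's inequality (`gronwall_integral`) then yields the exponential weight.

The difficulty is that `w` is not an admissible test function: it only takes values in `H¹_{0,σ}`,
with `‖w‖_r^s` integrable in time. It has to be approximated by solenoidal test fields with bounds
in `H¹` and in `L^r` at the same time, so the density that defines `H¹_{0,σ}` does not suffice. The
Lipschitz boundary provides a smooth field `h` such that `x ↦ x + ε h(x)` moves the closure of `Ω`
into `Ω` with a margin `ε`. The field `(I + ε Dh) w` is averaged with the kernel `ε^{-d} η((y - x)/ε
- h(x))`; the factor `I + ε Dh` is exactly what keeps the average divergence free. These operators
are linear, map into test fields, are bounded uniformly in `ε` in every `L^p` and in `H¹`, and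
converge strongly in `H¹_{0,σ}` (`IsLipschitzDomain.nonempty_solenoidalMollifier`).

In time, `v` has no derivative to work with. Testing with products `θ(t) φ` shows that `(v(t), φ)`
is almost everywhere a primitive; by separability one null set of times serves all mollified fields
`φ`, and Fubini's theorem extends the identity to `C¹` paths (`integral_path_eq`). The mollification
is then removed by dominated convergence, with a majorant from the product estimate
(`IsProductConst.weakForm_limit`). The exceptional set of times never depends on the path, as the
order of quantifiers in the conclusion demands. -/

/-! ### A smooth vector field pointing uniformly into a Lipschitz domain -/

/-- The directions `z` that point uniformly into `Ω` from all points of `closure Ω` near `x`. -/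
def inwardDirections (Ω : Opens (Vec d)) (x : Vec d) : Set (Vec d) :=
  {z | ∃ U ∈ 𝓝 x, ∃ δ > 0, ∀ y ∈ U, y ∈ closure (Ω : Set (Vec d)) → ∀ ε : ℝ, 0 < ε → ε ≤ δ →
    ∀ e : Vec d, ‖e‖ ≤ δ → y + ε • (z + e) ∈ Ω}

/-- A step along `a z₁ + b z₂` is made in two stages: `ε a (z₁ + e)` leads from the closure into
`Ω`, and `ε b (z₂ + e)` continues from there, since `e = a e + b e`. The second summand in the
choice of the tolerance keeps the intermediate point in the neighbourhood belonging to `z₂`.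
Convexity is what allows gluing with a partition of unity. -/
theorem convex_inwardDirections (x : Vec d) : Convex ℝ (inwardDirections Ω x) := by
  rw [convex_iff_forall_pos]
  rintro z₁ ⟨U₁, hU₁, δ₁, hδ₁, h₁⟩ z₂ ⟨U₂, hU₂, δ₂, hδ₂, h₂⟩ a b ha hb hab
  obtain ⟨η, hη, hηU⟩ := Metric.mem_nhds_iff.1 hU₂
  have hN : 0 < ‖z₁‖ + δ₁ := by positivity
  refine ⟨U₁ ∩ Metric.ball x (η / 2), Filter.inter_mem hU₁ (Metric.ball_mem_nhds _ (by positivity)),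
    min (min δ₁ δ₂) (η / 2 / (‖z₁‖ + δ₁) / 2), by positivity, ?_⟩
  rintro y ⟨hy₁, hy₂⟩ hy ε hε hεδ e he
  have e1 : ε ≤ δ₁ := hεδ.trans ((min_le_left _ _).trans (min_le_left _ _))
  have e2 : ε ≤ δ₂ := hεδ.trans ((min_le_left _ _).trans (min_le_right _ _))
  have e3 : ε ≤ η / 2 / (‖z₁‖ + δ₁) / 2 := hεδ.trans (min_le_right _ _)
  have f1 : ‖e‖ ≤ δ₁ := he.trans ((min_le_left _ _).trans (min_le_left _ _))
  have f2 : ‖e‖ ≤ δ₂ := he.trans ((min_le_left _ _).trans (min_le_right _ _))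
  have a1 : a ≤ 1 := by linarith
  have b1 : b ≤ 1 := by linarith
  have key : y + (ε * a) • (z₁ + e) ∈ Ω :=
    h₁ y hy₁ hy (ε * a) (by positivity) (by nlinarith) e f1
  have : y + ε • (a • z₁ + b • z₂ + e) =
      (y + (ε * a) • (z₁ + e)) + (ε * b) • (z₂ + e) := by
    have : e = (a + b) • e := by rw [hab, one_smul]
    conv_lhs => rw [this]
    simp only [smul_add, add_smul, mul_smul]
    abel
  rw [this]
  refine h₂ _ (hηU ?_) (subset_closure key) _ (by positivity) (by nlinarith) e f2
  rw [Metric.mem_ball] at hy₂ ⊢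
  have : ‖(ε * a) • (z₁ + e)‖ < η / 2 := by
    rw [norm_smul, Real.norm_of_nonneg (by positivity)]
    have : ‖z₁ + e‖ ≤ ‖z₁‖ + δ₁ := (norm_add_le _ _).trans (by linarith)
    calc ε * a * ‖z₁ + e‖ ≤ (η / 2 / (‖z₁‖ + δ₁) / 2) * 1 * (‖z₁‖ + δ₁) := by gcongr
      _ = η / 2 / 2 := by field_simp
      _ < η / 2 := by linarith
  calc dist (y + (ε * a) • (z₁ + e)) x ≤ dist (y + (ε * a) • (z₁ + e)) y + dist y x :=
        dist_triangle _ _ _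
    _ < η / 2 + η / 2 := by
        refine add_lt_add ?_ hy₂
        rwa [dist_eq_norm, add_sub_cancel_left]
    _ = η := by ring

theorem eventually_mem_inwardDirections {x z : Vec d} (hz : z ∈ inwardDirections Ω x) :
    ∀ᶠ y in 𝓝 x, z ∈ inwardDirections Ω y := by
  obtain ⟨U, hU, h⟩ := hz
  filter_upwards [eventually_mem_nhds_iff.2 hU] with y hy using ⟨U, hy, h⟩

/-- Away from the boundary the direction `0` works. At a boundary point the direction is `n`: a step
`ε (n + e)` gains height at least `ε (1 - ‖e‖)`, while its horizontal part has length at most `2 ε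
‖e‖` and raises the graph by at most `2 L ε ‖e‖`. The net gain is positive as soon as `(2 L + 1) ‖e‖
≤ 1/2`. -/
theorem IsLipschitzDomain.nonempty_inwardDirections (hΩ : IsLipschitzDomain Ω) (x : Vec d) :
    (inwardDirections Ω x).Nonempty := by
  by_cases hc : x ∈ closure (Ω : Set (Vec d))
  swap
  · exact ⟨0, (closure (Ω : Set (Vec d)))ᶜ, isClosed_closure.isOpen_compl.mem_nhds hc, 1, one_pos,
      fun y hy hy' => absurd hy' hy⟩
  by_cases hx : x ∈ (Ω : Set (Vec d))
  · obtain ⟨η, hη, hηU⟩ := Metric.mem_nhds_iff.1 (Ω.isOpen.mem_nhds hx)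
    refine ⟨0, Metric.ball x (η / 2), Metric.ball_mem_nhds _ (by positivity), min 1 (η / 4),
      by positivity, fun y hy _ ε hε hεδ e he => hηU ?_⟩
    rw [Metric.mem_ball] at hy ⊢
    have : ‖ε • (0 + e)‖ ≤ 1 * (η / 4) := by
      rw [norm_smul, Real.norm_of_nonneg hε.le, zero_add]
      exact mul_le_mul (hεδ.trans (min_le_left _ _)) (he.trans (min_le_right _ _))
        (norm_nonneg _) zero_le_one
    calc dist (y + ε • (0 + e)) x ≤ dist (y + ε • (0 + e)) y + dist y x := dist_triangle _ _ _
      _ < η / 2 + η / 2 := by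
          refine add_lt_add ?_ hy
          rw [dist_eq_norm, add_sub_cancel_left]
          linarith
      _ = η := by ring
  obtain ⟨n, g, L, ρ, hn, hg, hρ, h⟩ := hΩ.graph x
    (by rw [frontier, Ω.isOpen.interior_eq]; exact ⟨hc, hx⟩)
  have hL : (0 : ℝ) ≤ L := L.2
  have hcl : ∀ y ∈ Metric.ball x ρ, y ∈ closure (Ω : Set (Vec d)) →
      g (y - inner ℝ n y • n) ≤ inner ℝ n y := by
    intro y hy hyc
    have hcont : Continuous fun y : Vec d => g (y - inner ℝ n y • n) :=
      hg.continuous.comp (by fun_prop)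
    have hcont' : Continuous fun y : Vec d => inner ℝ n y := by fun_prop
    have hcl : y ∈ closure ((Ω : Set (Vec d)) ∩ Metric.ball x ρ) :=
      by
      rw [inter_comm]; exact Metric.isOpen_ball.inter_closure ⟨hy, hyc⟩
    refine closure_minimal (t := {y | g (y - inner ℝ n y • n) ≤ inner ℝ n y}) ?_
      (isClosed_le hcont hcont') hcl
    rintro z ⟨hz, hzb⟩
    exact ((h z hzb).1 hz).le
  refine ⟨n, Metric.ball x (ρ / 2), Metric.ball_mem_nhds _ (by positivity),
    min (1 / (2 * (2 * L + 1))) (ρ / 8), by positivity, ?_⟩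
  intro y hy hyc ε hε hεδ e he
  have he1 : ‖e‖ ≤ 1 / (2 * (2 * L + 1)) := he.trans (min_le_left _ _)
  have hε1 : ε ≤ ρ / 8 := hεδ.trans (min_le_right _ _)
  have hq : 1 / (2 * (2 * (L : ℝ) + 1)) ≤ 1 / 2 := by
    rw [div_le_div_iff₀ (by positivity) (by positivity)]; linarith
  rw [Metric.mem_ball] at hy
  have hyb : y ∈ Metric.ball x ρ := by rw [Metric.mem_ball]; linarith
  have hzb : y + ε • (n + e) ∈ Metric.ball x ρ := by
    rw [Metric.mem_ball]
    have : ‖ε • (n + e)‖ ≤ ρ / 8 * 2 := by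
      rw [norm_smul, Real.norm_of_nonneg hε.le]
      have : ‖n + e‖ ≤ 2 := (norm_add_le _ _).trans (by rw [hn]; linarith)
      gcongr
    calc dist (y + ε • (n + e)) x ≤ dist (y + ε • (n + e)) y + dist y x := dist_triangle _ _ _
      _ < ρ / 8 * 2 + ρ / 2 := by
          refine add_lt_add_of_le_of_lt ?_ hy
          rwa [dist_eq_norm, add_sub_cancel_left]
      _ ≤ ρ := by linarith
  refine (h _ hzb).2 ?_
  have hin : inner ℝ n (y + ε • (n + e)) = inner ℝ n y + ε * (1 + inner ℝ n e) := by
    rw [inner_add_right, inner_smul_right, inner_add_right, real_inner_self_eq_norm_sq, hn]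
    ring
  have hne : |inner ℝ n e| ≤ ‖e‖ := by
    simpa [hn] using abs_real_inner_le_norm n e
  have hproj : (y + ε • (n + e)) - inner ℝ n (y + ε • (n + e)) • n =
      (y - inner ℝ n y • n) + ε • (e - inner ℝ n e • n) := by
    rw [hin]
    simp only [smul_add, smul_sub, add_smul, mul_smul, one_smul, mul_add]
    abel
  have hpn : ‖ε • (e - inner ℝ n e • n)‖ ≤ ε * (2 * ‖e‖) := by
    rw [norm_smul, Real.norm_of_nonneg hε.le]
    gcongr
    refine (norm_sub_le _ _).trans ?_
    rw [norm_smul, hn, Real.norm_eq_abs]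
    linarith
  have hgl := hg.dist_le_mul ((y - inner ℝ n y • n) + ε • (e - inner ℝ n e • n))
    (y - inner ℝ n y • n)
  rw [dist_eq_norm, dist_eq_norm, add_sub_cancel_left] at hgl
  rw [hproj, hin]
  have h0 := hcl y hyb hyc
  have h1 : g ((y - inner ℝ n y • n) + ε • (e - inner ℝ n e • n)) - g (y - inner ℝ n y • n) ≤
      L * (ε * (2 * ‖e‖)) :=
    (le_abs_self _).trans (hgl.trans (by gcongr))
  have h2 : (2 * L + 1) * ‖e‖ ≤ 1 / 2 := by
    calc (2 * (L : ℝ) + 1) * ‖e‖ ≤ (2 * L + 1) * (1 / (2 * (2 * L + 1))) := by gcongr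
      _ = 1 / 2 := by field_simp
  have h3 := neg_le_of_abs_le hne
  have : ε * ((2 * L + 1) * ‖e‖) ≤ ε * (1 / 2) := by gcongr
  nlinarith

/-- A smooth compactly supported vector field `h` such that `x ↦ x + ε h(x)` moves the closure of a
Lipschitz domain a distance `ε` into the domain. -/
theorem IsLipschitzDomain.exists_inward_field (hΩ : IsLipschitzDomain Ω) :
    ∃ h : Vec d → Vec d, ContDiff ℝ ∞ h ∧ HasCompactSupport h ∧ ∃ ε₀ > 0, ∀ ε : ℝ, 0 < ε → ε ≤ ε₀ →
      ∀ x ∈ closure (Ω : Set (Vec d)), Metric.closedBall (x + ε • h x) ε ⊆ Ω := by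
  -- Locally constant inward directions are glued by a smooth partition of unity; the values stay
  -- inward by convexity.
  obtain ⟨h₀, hh₀⟩ := exists_contMDiffMap_forall_mem_convex_of_local_const (n := ⊤)
    (modelWithCornersSelf ℝ (Vec d)) (M := Vec d)
    (t := inwardDirections Ω) convex_inwardDirections
    fun x => (hΩ.nonempty_inwardDirections x).imp fun _ hz => eventually_mem_inwardDirections hz
  have hsm : ContDiff ℝ ∞ h₀ := h₀.contMDiff.contDiff
  have hK : IsCompact (closure (Ω : Set (Vec d))) := hΩ.bounded.isCompact_closure
  have hunif : ∃ δ > 0, ∀ y ∈ closure (Ω : Set (Vec d)), ∀ ε : ℝ, 0 < ε → ε ≤ δ →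
      ∀ e : Vec d, ‖e‖ ≤ δ → y + ε • (h₀ y + e) ∈ Ω := by
    have hloc : ∀ x : Vec d, ∃ δ > 0, ∀ᶠ y in 𝓝 x, y ∈ closure (Ω : Set (Vec d)) → ∀ ε : ℝ,
        0 < ε → ε ≤ δ → ∀ e : Vec d, ‖e‖ ≤ δ → y + ε • (h₀ y + e) ∈ Ω := by
      intro x
      obtain ⟨U, hU, δ, hδ, hUδ⟩ := hh₀ x
      refine ⟨δ / 2, by positivity, ?_⟩
      have hc : ∀ᶠ y in 𝓝 x, ‖h₀ y - h₀ x‖ ≤ δ / 2 := by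
        have : Filter.Tendsto (fun y => ‖h₀ y - h₀ x‖) (𝓝 x) (𝓝 0) := by
          have h1 : Continuous fun y => ‖h₀ y - h₀ x‖ := (hsm.continuous.sub continuous_const).norm
          simpa using h1.tendsto x
        exact this.eventually (ge_mem_nhds (by positivity))
      filter_upwards [hU, hc] with y hyU hyc hy ε hε hεδ e he
      -- The tolerance `e` in the definition of an inward direction absorbs the variation of `h₀`
      -- near `x`.
      have := hUδ y hyU hy ε hε (by linarith) (h₀ y - h₀ x + e)
        ((norm_add_le _ _).trans (by linarith))
      rwa [show h₀ x + (h₀ y - h₀ x + e) = h₀ y + e by abel] at this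
    refine hK.induction_on (p := fun s => ∃ δ > 0, ∀ y ∈ s, y ∈ closure (Ω : Set (Vec d)) →
      ∀ ε : ℝ, 0 < ε → ε ≤ δ → ∀ e : Vec d, ‖e‖ ≤ δ → y + ε • (h₀ y + e) ∈ Ω)
      ⟨1, one_pos, by simp⟩ ?_ ?_ ?_ |>.imp fun δ hδ => ⟨hδ.1, fun y hy => hδ.2 y hy hy⟩
    · rintro s t hst ⟨δ, hδ, h⟩
      exact ⟨δ, hδ, fun y hy => h y (hst hy)⟩
    · rintro s t ⟨δ, hδ, h⟩ ⟨δ', hδ', h'⟩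
      refine ⟨min δ δ', by positivity, ?_⟩
      rintro y (hy | hy) hyc ε hε hεδ e he
      · exact h y hy hyc ε hε (hεδ.trans (min_le_left _ _)) e (he.trans (min_le_left _ _))
      · exact h' y hy hyc ε hε (hεδ.trans (min_le_right _ _)) e (he.trans (min_le_right _ _))
    · intro x hx
      obtain ⟨δ, hδ, h⟩ := hloc x
      exact ⟨_, mem_nhdsWithin_of_mem_nhds h, δ, hδ, fun y hy => hy⟩
  obtain ⟨δ, hδ, hunif⟩ := hunif
  obtain ⟨χ, hχ, hχc, hχ1⟩ : ∃ χ : Vec d → ℝ, ContDiff ℝ ∞ χ ∧ HasCompactSupport χ ∧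
      ∀ x ∈ closure (Ω : Set (Vec d)), χ x = 1 := by
    obtain ⟨r, hr, hr'⟩ := hK.isBounded.subset_closedBall_lt 0 0
    let b : ContDiffBump (0 : Vec d) := ⟨r, r + 1, hr, by linarith⟩
    exact ⟨b, b.contDiff, b.hasCompactSupport, fun x hx => b.one_of_mem_closedBall (hr' hx)⟩
  -- After division by `δ`, the parameter `ε` corresponds to a step of length parameter `ε/δ` along
  -- `h₀`, and the tolerance `δ` there becomes a ball of radius `(ε/δ) δ = ε`. The requirement `ε/δ
  -- ≤ δ` explains the bound `δ * δ`. The cutoff `χ` only serves to make the field compactly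
  -- supported.
  refine ⟨fun x => χ x • δ⁻¹ • h₀ x, hχ.smul (hsm.const_smul δ⁻¹), hχc.smul_right,
    δ * δ, by positivity, ?_⟩
  intro ε hε hε₀ x hx z hz
  have hz' : ‖z - (x + ε • χ x • δ⁻¹ • h₀ x)‖ ≤ ε := by
    rwa [Metric.mem_closedBall, dist_eq_norm] at hz
  rw [hχ1 x hx, one_smul, smul_smul] at hz'
  have hε' : ε * δ⁻¹ ≤ δ := by
    rw [← div_eq_mul_inv, div_le_iff₀ hδ]; exact hε₀
  have := hunif x hx (ε * δ⁻¹) (by positivity) hε'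
    ((ε * δ⁻¹)⁻¹ • (z - (x + (ε * δ⁻¹) • h₀ x))) (by
      rw [norm_smul, norm_inv, Real.norm_of_nonneg (by positivity)]
      calc (ε * δ⁻¹)⁻¹ * ‖z - (x + (ε * δ⁻¹) • h₀ x)‖ ≤ (ε * δ⁻¹)⁻¹ * ε := by gcongr
        _ = δ := by field_simp)
  rw [smul_add, smul_smul, mul_inv_cancel₀ (by positivity), one_smul] at this
  rwa [show x + ((ε * δ⁻¹) • h₀ x + (z - (x + (ε * δ⁻¹) • h₀ x))) = z by abel] at this


/-! ### Averaging operators along an inward field -/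

/-- A smooth function supported in the unit ball. -/
structure IsProfile (η : Vec d → ℝ) : Prop where
  contDiff : ContDiff ℝ ∞ η
  eq_zero : ∀ x, 1 < ‖x‖ → η x = 0

namespace IsProfile

variable {η : Vec d → ℝ}

theorem hasCompactSupport (hη : IsProfile η) : HasCompactSupport η :=
  HasCompactSupport.intro (isCompact_closedBall (0 : Vec d) 1) fun x hx =>
    hη.eq_zero x (by simpa using hx)

theorem exists_bound (hη : IsProfile η) : ∃ M, 0 ≤ M ∧ ∀ x, |η x| ≤ M := by
  obtain ⟨M, hM⟩ := hη.hasCompactSupport.exists_bound_of_continuous hη.contDiff.continuous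
  exact ⟨M, (norm_nonneg _).trans (hM 0), hM⟩

theorem differentiable (hη : IsProfile η) : Differentiable ℝ η :=
  hη.contDiff.differentiable (by simp)

theorem fderiv_apply (hη : IsProfile η) (e : Vec d) : IsProfile fun x => fderiv ℝ η x e where
  contDiff := (hη.contDiff.fderiv_right (m := ∞) le_rfl).clm_apply contDiff_const
  eq_zero x hx := by
    have : η =ᶠ[𝓝 x] fun _ => 0 := by
      have : ∀ᶠ y in 𝓝 x, 1 < ‖y‖ := continuous_norm.tendsto x |>.eventually (lt_mem_nhds hx)
      filter_upwards [this] with y hy using hη.eq_zero y hy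
    rw [this.fderiv_eq]
    simp

theorem exists_bound_fderiv (hη : IsProfile η) : ∃ M, 0 ≤ M ∧ ∀ x, ‖fderiv ℝ η x‖ ≤ M := by
  obtain ⟨M, hM⟩ := (hη.hasCompactSupport.fderiv (𝕜 := ℝ)).exists_bound_of_continuous
    (hη.contDiff.continuous_fderiv (by simp))
  exact ⟨M, (norm_nonneg _).trans (hM 0), hM⟩

theorem exists_lipschitz (hη : IsProfile η) : ∃ M, 0 ≤ M ∧ ∀ x y, |η x - η y| ≤ M * ‖x - y‖ := by
  obtain ⟨M, hM0, hM⟩ := hη.exists_bound_fderiv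
  refine ⟨M, hM0, fun x y => ?_⟩
  exact convex_univ.norm_image_sub_le_of_norm_fderiv_le (𝕜 := ℝ)
    (fun z _ => hη.differentiable z) (fun z _ => hM z) (mem_univ y) (mem_univ x)

end IsProfile

variable {F : Type*} [NormedAddCommGroup F] [NormedSpace ℝ F]

/-- The kernel `ε^{-d} η((y - x) / ε - h(x))`. -/
def avgKernel (h : Vec d → Vec d) (η : Vec d → ℝ) (ε : ℝ) (y x : Vec d) : ℝ :=
  (ε ^ d)⁻¹ * η (ε⁻¹ • (y - x) - h x)

/-- The weighted average of `g` with the kernel `avgKernel`. -/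
def fieldAvg (Ω : Opens (Vec d)) (h : Vec d → Vec d) (η : Vec d → ℝ) (ε : ℝ) (g : Vec d → F)
    (y : Vec d) : F :=
  ∫ x in (Ω : Set (Vec d)), avgKernel h η ε y x • g x

section bounds

variable {h : Vec d → Vec d} {H : ℝ} {η : Vec d → ℝ} {ε : ℝ}

theorem avgKernel_eq_zero (hH : ∀ x, ‖h x‖ ≤ H) (hη : ∀ x, 1 < ‖x‖ → η x = 0) (hε : 0 < ε)
    {x y : Vec d} (hxy : ε * (1 + H) < dist x y) : avgKernel h η ε y x = 0 := by
  rw [avgKernel, hη, mul_zero]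
  have h1 : ε⁻¹ * dist x y ≤ ‖ε⁻¹ • (y - x) - h x‖ + H := by
    have : ε⁻¹ • (y - x) = (ε⁻¹ • (y - x) - h x) + h x := by abel
    calc ε⁻¹ * dist x y = ‖ε⁻¹ • (y - x)‖ := by
          rw [norm_smul, Real.norm_of_nonneg (by positivity), dist_comm, dist_eq_norm]
      _ ≤ ‖ε⁻¹ • (y - x) - h x‖ + ‖h x‖ := by
          conv_lhs => rw [this]
          exact norm_add_le _ _
      _ ≤ _ := by gcongr; exact hH x
  have h2 : 1 + H < ε⁻¹ * dist x y := by
    rw [← div_eq_inv_mul, lt_div_iff₀ hε]; linarith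
  linarith

theorem abs_avgKernel_le {M : ℝ} (hM : ∀ x, |η x| ≤ M) (hε : 0 < ε) (x y : Vec d) :
    |avgKernel h η ε y x| ≤ (ε ^ d)⁻¹ * M := by
  rw [avgKernel, abs_mul, abs_of_nonneg (by positivity : 0 ≤ (ε ^ d)⁻¹)]
  gcongr
  exact hM _

theorem continuous_avgKernel (hc : Continuous h) (hη : Continuous η) (y : Vec d) :
    Continuous (avgKernel h η ε y) := by
  unfold avgKernel
  fun_prop

/-- Since the shift `h x` varies with `x`, the kernel is not of convolution type. It is dominated
instead by `ε^{-d} M` times the indicator of `|x - y| ≤ ε (1 + H)`, and the `L^p` bounds follow from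
those for ball averages. -/
theorem enorm_fieldAvg_le (hH : ∀ x, ‖h x‖ ≤ H) (hη : ∀ x, 1 < ‖x‖ → η x = 0) {M : ℝ}
    (hM : ∀ x, |η x| ≤ M) (hε : 0 < ε) (g : Vec d → F) (y : Vec d) :
    ‖fieldAvg Ω h η ε g y‖ₑ ≤ ENNReal.ofReal ((ε ^ d)⁻¹ * M) *
      ∫⁻ x in Metric.closedBall y (ε * (1 + H)), ‖g x‖ₑ ∂(volume.restrict (Ω : Set (Vec d))) := by
  refine (enorm_integral_le_lintegral_enorm _).trans ?_
  rw [← lintegral_indicator Metric.isClosed_closedBall.measurableSet,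
    ← lintegral_const_mul' _ _ ENNReal.ofReal_ne_top]
  refine lintegral_mono fun x => ?_
  by_cases hx : x ∈ Metric.closedBall y (ε * (1 + H))
  · rw [indicator_of_mem hx, enorm_smul]
    gcongr
    rw [Real.enorm_eq_ofReal_abs]
    exact ENNReal.ofReal_le_ofReal (abs_avgKernel_le hM hε x y)
  · rw [avgKernel_eq_zero hH hη hε (by simpa using hx)]
    simp

theorem norm_fieldAvg_le {M : ℝ} (hM : ∀ x, |η x| ≤ M) (hε : 0 < ε) {g : Vec d → F}
    (hg : Integrable g (volume.restrict (Ω : Set (Vec d)))) (y : Vec d) :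
    ‖fieldAvg Ω h η ε g y‖ ≤ (ε ^ d)⁻¹ * M * ∫ x in (Ω : Set (Vec d)), ‖g x‖ := by
  rw [← integral_const_mul]
  refine norm_integral_le_of_norm_le (hg.norm.const_mul _) (Filter.Eventually.of_forall fun x => ?_)
  rw [norm_smul]
  gcongr
  exact abs_avgKernel_le hM hε x y

theorem integrable_avgKernel_smul (hc : Continuous h) (hη : Continuous η) {M : ℝ}
    (hM : ∀ x, |η x| ≤ M) (hε : 0 < ε) {g : Vec d → F}
    (hg : Integrable g (volume.restrict (Ω : Set (Vec d)))) (y : Vec d) :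
    Integrable (fun x => avgKernel h η ε y x • g x) (volume.restrict (Ω : Set (Vec d))) :=
  hg.bdd_smul ((ε ^ d)⁻¹ * M) (continuous_avgKernel hc hη y).aestronglyMeasurable
    (Filter.Eventually.of_forall fun x => abs_avgKernel_le hM hε x y)

end bounds

/-- Local averages over balls are bounded in every Lebesgue space. -/
theorem eLpNorm_le_of_le_ball_lintegral {F₁ F₂ : Type*} [NormedAddCommGroup F₁]
    [NormedAddCommGroup F₂] {f : Vec d → F₁}
    {g : Vec d → F₂} {c : ℝ≥0∞} {R : ℝ}
    (hg : AEStronglyMeasurable g (volume.restrict (Ω : Set (Vec d))))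
    (hfg : ∀ y, ‖f y‖ₑ ≤ c *
      ∫⁻ x in Metric.closedBall y R, ‖g x‖ₑ ∂(volume.restrict (Ω : Set (Vec d))))
    {p : ℝ≥0∞} (hp : 1 ≤ p) :
    eLpNorm f p (volume.restrict (Ω : Set (Vec d))) ≤
      c * volume (Metric.closedBall (0 : Vec d) R) *
        eLpNorm g p (volume.restrict (Ω : Set (Vec d))) := by
  set μ := volume.restrict (Ω : Set (Vec d)) with hμ
  have hvol : ∀ y, μ (Metric.closedBall y R) ≤ volume (Metric.closedBall (0 : Vec d) R) := by
    intro y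
    rw [← Measure.addHaar_closedBall_center volume y R]
    exact Measure.restrict_le_self _
  set V := volume (Metric.closedBall (0 : Vec d) R) with hV
  have hVtop : V ≠ ⊤ := (isCompact_closedBall _ _).measure_lt_top.ne
  by_cases hptop : p = ⊤
  · subst hptop
    rw [eLpNorm_exponent_top, eLpNorm_exponent_top, eLpNormEssSup, eLpNormEssSup]
    refine essSup_le_of_ae_le _ (Filter.Eventually.of_forall fun y => ?_)
    change ‖f y‖ₑ ≤ c * V * essSup (fun x => ‖g x‖ₑ) μ
    refine (hfg y).trans ?_
    rw [mul_assoc c]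
    gcongr
    calc ∫⁻ x in Metric.closedBall y R, ‖g x‖ₑ ∂μ
        ≤ ∫⁻ x in Metric.closedBall y R, essSup (fun x => ‖g x‖ₑ) μ ∂μ :=
          lintegral_mono_ae (ae_restrict_of_ae (ENNReal.ae_le_essSup _))
      _ = essSup (fun x => ‖g x‖ₑ) μ * μ (Metric.closedBall y R) := by
          rw [setLIntegral_const]
      _ ≤ V * essSup (fun x => ‖g x‖ₑ) μ := by
          rw [mul_comm]; gcongr; exact hvol y
  have hp0 : p ≠ 0 := (one_pos.trans_le hp).ne'
  have hq : 1 ≤ p.toReal := by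
    rw [← ENNReal.toReal_one]; exact ENNReal.toReal_mono hptop hp
  have hq0 : 0 < p.toReal := by linarith
  set q := p.toReal with hqdef
  -- Jensen's inequality on the ball, in the form of Hölder's inequality against the constant
  -- function; Fubini's theorem then exchanges the centre and the integration point.
  have hpow : ∀ y, ‖f y‖ₑ ^ q ≤ c ^ q * (V ^ (q - 1) *
      ∫⁻ x in Metric.closedBall y R, ‖g x‖ₑ ^ q ∂μ) := by
    intro y
    have hH : ∫⁻ x in Metric.closedBall y R, ‖g x‖ₑ ∂μ ≤
        (∫⁻ x in Metric.closedBall y R, ‖g x‖ₑ ^ q ∂μ) ^ (1 / q) * V ^ (1 - 1 / q) := by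
      have := eLpNorm_le_eLpNorm_mul_rpow_measure_univ (μ := μ.restrict (Metric.closedBall y R))
        hp hg.restrict
      rw [eLpNorm_one_eq_lintegral_enorm, eLpNorm_eq_lintegral_rpow_enorm_toReal hp0 hptop,
        Measure.restrict_apply_univ, ENNReal.toReal_one, div_one] at this
      refine this.trans ?_
      gcongr
      · rw [sub_nonneg, div_le_one hq0]; exact hq
      · exact hvol y
    calc ‖f y‖ₑ ^ q ≤ (c * ((∫⁻ x in Metric.closedBall y R, ‖g x‖ₑ ^ q ∂μ) ^ (1 / q) *
          V ^ (1 - 1 / q))) ^ q := by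
          gcongr
          exact (hfg y).trans (by gcongr)
      _ = _ := by
          rw [ENNReal.mul_rpow_of_nonneg _ _ hq0.le, ENNReal.mul_rpow_of_nonneg _ _ hq0.le,
            ← ENNReal.rpow_mul, ← ENNReal.rpow_mul, one_div, inv_mul_cancel₀ hq0.ne',
            ENNReal.rpow_one, mul_comm (lintegral _ _), sub_mul, inv_mul_cancel₀ hq0.ne', one_mul]
  have hgq : AEMeasurable (fun x => ‖g x‖ₑ ^ q) μ := hg.enorm.pow_const _
  have hfub : ∫⁻ y, ∫⁻ x in Metric.closedBall y R, ‖g x‖ₑ ^ q ∂μ ∂μ ≤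
      V * ∫⁻ x, ‖g x‖ₑ ^ q ∂μ := by
    have hS : MeasurableSet {z : Vec d × Vec d | dist z.2 z.1 ≤ R} :=
      (isClosed_le (by fun_prop) continuous_const).measurableSet
    have e1 : ∀ y, ∫⁻ x in Metric.closedBall y R, ‖g x‖ₑ ^ q ∂μ =
        ∫⁻ x, {z : Vec d × Vec d | dist z.2 z.1 ≤ R}.indicator
          (fun z => ‖g z.2‖ₑ ^ q) (y, x) ∂μ := by
      intro y
      rw [← lintegral_indicator Metric.isClosed_closedBall.measurableSet]
      rfl
    simp_rw [e1]
    rw [lintegral_lintegral_swap]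
    · rw [← lintegral_const_mul'' _ hgq]
      refine lintegral_mono fun x => ?_
      calc ∫⁻ y, {z : Vec d × Vec d | dist z.2 z.1 ≤ R}.indicator
            (fun z => ‖g z.2‖ₑ ^ q) (y, x) ∂μ
          = ∫⁻ y, (Metric.closedBall x R).indicator (fun _ => ‖g x‖ₑ ^ q) y ∂μ := by
            refine lintegral_congr fun y => ?_
            simp only [indicator, mem_ofPred_eq, Metric.mem_closedBall, dist_comm x y]
        _ = ‖g x‖ₑ ^ q * μ (Metric.closedBall x R) := by
            rw [lintegral_indicator_const Metric.isClosed_closedBall.measurableSet]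
        _ ≤ V * ‖g x‖ₑ ^ q := by
            rw [mul_comm]; gcongr; exact hvol x
    · exact (hgq.comp_quasiMeasurePreserving Measure.quasiMeasurePreserving_snd).indicator hS
  rw [eLpNorm_eq_lintegral_rpow_enorm_toReal hp0 hptop,
    eLpNorm_eq_lintegral_rpow_enorm_toReal hp0 hptop, ← hqdef]
  calc (∫⁻ y, ‖f y‖ₑ ^ q ∂μ) ^ (1 / q)
      ≤ (∫⁻ y, c ^ q * (V ^ (q - 1) *
        ∫⁻ x in Metric.closedBall y R, ‖g x‖ₑ ^ q ∂μ) ∂μ) ^ (1 / q) := by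
        gcongr with y
        exact hpow y
    _ ≤ (c ^ q * (V ^ (q - 1) * (V * ∫⁻ x, ‖g x‖ₑ ^ q ∂μ))) ^ (1 / q) := by
        gcongr
        -- The constant `c ^ q` can be taken out of the integral only if it is finite. If `c` is
        -- infinite, either the right-hand side is infinite or all the integrands vanish.
        by_cases hc : c = ⊤
        · by_cases h0 : V ^ (q - 1) * (V * ∫⁻ x, ‖g x‖ₑ ^ q ∂μ) = 0
          · have hz : ∀ y, V ^ (q - 1) *
                ∫⁻ x in Metric.closedBall y R, ‖g x‖ₑ ^ q ∂μ = 0 := by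
              intro y
              rcases mul_eq_zero.1 h0 with h0 | h0
              · rw [h0, zero_mul]
              rcases mul_eq_zero.1 h0 with h0 | h0
              · rw [Measure.restrict_eq_zero.2 (le_antisymm ((hvol y).trans h0.le) zero_le)]
                simp
              · rw [le_antisymm ((setLIntegral_le_lintegral _ _).trans h0.le) zero_le, mul_zero]
            simp [hz]
          · rw [hc, ENNReal.top_rpow_of_pos hq0, ENNReal.top_mul h0]
            exact le_top
        rw [lintegral_const_mul' _ _ (ENNReal.rpow_ne_top_of_nonneg hq0.le hc),
          lintegral_const_mul' _ _ (ENNReal.rpow_ne_top_of_nonneg (by linarith) hVtop)]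
        gcongr
    _ = c * V * (∫⁻ x, ‖g x‖ₑ ^ q ∂μ) ^ (1 / q) := by
        have hVq : V ^ (q - 1) * V = V ^ q := by
          conv_lhs => rw [← ENNReal.rpow_one V, ← ENNReal.rpow_mul]
          rw [← ENNReal.rpow_add_of_nonneg _ _ (by linarith) zero_le_one]
          congr 1; ring
        rw [← mul_assoc (V ^ (q - 1)), hVq, ← mul_assoc,
          ENNReal.mul_rpow_of_nonneg _ _ (by positivity),
          ENNReal.mul_rpow_of_nonneg _ _ (by positivity), ← ENNReal.rpow_mul, ← ENNReal.rpow_mul,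
          mul_one_div_cancel hq0.ne', ENNReal.rpow_one, ENNReal.rpow_one]

section bounds

variable {h : Vec d → Vec d} {H : ℝ} {η : Vec d → ℝ} {ε : ℝ}

/-- The averaging operators are bounded in `L^p` uniformly in `ε`. -/
theorem exists_eLpNorm_fieldAvg_le (hH : ∀ x, ‖h x‖ ≤ H) (hη : IsProfile η) :
    ∃ C : ℝ, 0 ≤ C ∧ ∀ ε : ℝ, 0 < ε → ∀ g : Vec d → F,
      AEStronglyMeasurable g (volume.restrict (Ω : Set (Vec d))) → ∀ p : ℝ≥0∞, 1 ≤ p →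
      eLpNorm (fieldAvg Ω h η ε g) p (volume.restrict (Ω : Set (Vec d))) ≤
        ENNReal.ofReal C * eLpNorm g p (volume.restrict (Ω : Set (Vec d))) := by
  obtain ⟨M, hM0, hM⟩ := hη.exists_bound
  have hH0 : 0 ≤ H := (norm_nonneg _).trans (hH 0)
  have hVtop : volume (Metric.closedBall (0 : Vec d) (1 + H)) ≠ ⊤ :=
    (isCompact_closedBall _ _).measure_lt_top.ne
  refine ⟨M * (volume (Metric.closedBall (0 : Vec d) (1 + H))).toReal, by positivity, ?_⟩
  intro ε hε g hg p hp
  refine (eLpNorm_le_of_le_ball_lintegral hg (enorm_fieldAvg_le hH hη.eq_zero hM hε g) hp).trans ?_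
  gcongr
  -- The volume of the ball of radius `ε (1 + H)` contributes `ε ^ d`, which cancels the
  -- normalisation of the kernel; hence the bound is uniform in `ε`.
  rw [Measure.addHaar_closedBall_mul _ _ hε.le (by linarith), ← mul_assoc,
    ← ENNReal.ofReal_mul (by positivity), ENNReal.ofReal_mul hM0, ENNReal.ofReal_toReal hVtop]
  gcongr
  refine le_of_eq ?_
  simp only [finrank_euclideanSpace, Fintype.card_fin]
  field_simp

end bounds

variable {F : Type*} [NormedAddCommGroup F] [NormedSpace ℝ F]

section calculus

variable {h : Vec d → Vec d} {H : ℝ} {η : Vec d → ℝ} {ε : ℝ}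

theorem hasFDerivAt_avgKernel_left (hη : Differentiable ℝ η) (x y : Vec d) :
    HasFDerivAt (fun y => avgKernel h η ε y x)
      ((ε ^ d)⁻¹ • ε⁻¹ • fderiv ℝ η (ε⁻¹ • (y - x) - h x)) y := by
  have h1 : HasFDerivAt (fun y : Vec d => ε⁻¹ • (y - x) - h x)
      (ε⁻¹ • ContinuousLinearMap.id ℝ (Vec d)) y :=
    (((hasFDerivAt_id y).sub_const x).const_smul ε⁻¹).sub_const (h x)
  have h2 := ((hη _).hasFDerivAt.comp y h1).const_mul (ε ^ d)⁻¹
  refine h2.congr_fderiv ?_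
  ext e
  simp

theorem hasFDerivAt_avgKernel_right (hh : Differentiable ℝ h) (hη : Differentiable ℝ η)
    (x y : Vec d) :
    HasFDerivAt (avgKernel h η ε y)
      (-((ε ^ d)⁻¹ • (fderiv ℝ η (ε⁻¹ • (y - x) - h x)).comp
        (ε⁻¹ • ContinuousLinearMap.id ℝ (Vec d) + fderiv ℝ h x))) x := by
  have h1 : HasFDerivAt (fun x : Vec d => ε⁻¹ • (y - x) - h x)
      (ε⁻¹ • (-ContinuousLinearMap.id ℝ (Vec d)) - fderiv ℝ h x) x :=
    (((hasFDerivAt_id x).const_sub y).const_smul ε⁻¹).sub (hh x).hasFDerivAt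
  have h2 := ((hη _).hasFDerivAt.comp x h1).const_mul (ε ^ d)⁻¹
  refine h2.congr_fderiv ?_
  ext e
  simp
  ring

theorem hasFDerivAt_fieldAvg (hc : Continuous h) (hη : IsProfile η) (hε : 0 < ε) {g : Vec d → F}
    (hg : Integrable g (volume.restrict (Ω : Set (Vec d)))) (y : Vec d) :
    HasFDerivAt (fieldAvg Ω h η ε g)
      (∫ x in (Ω : Set (Vec d)),
        ((ε ^ d)⁻¹ • ε⁻¹ • fderiv ℝ η (ε⁻¹ • (y - x) - h x)).smulRight (g x)) y := by
  obtain ⟨M, hM0, hM⟩ := hη.exists_bound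
  obtain ⟨M', hM'0, hM'⟩ := hη.exists_bound_fderiv
  have hηc : Continuous (fderiv ℝ η) := hη.contDiff.continuous_fderiv (by simp)
  refine hasFDerivAt_integral_of_dominated_of_fderiv_le (s := univ)
    (F' := fun y x => ((ε ^ d)⁻¹ • ε⁻¹ • fderiv ℝ η (ε⁻¹ • (y - x) - h x)).smulRight (g x))
    (bound := fun x => ((ε ^ d)⁻¹ * (ε⁻¹ * M')) * ‖g x‖) Filter.univ_mem ?_ ?_ ?_ ?_ ?_ ?_
  · exact Filter.Eventually.of_forall fun y =>
      (integrable_avgKernel_smul hc hη.contDiff.continuous hM hε hg y).aestronglyMeasurable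
  · exact integrable_avgKernel_smul hc hη.contDiff.continuous hM hε hg y
  · have h1 : AEStronglyMeasurable
        (fun x => (ε ^ d)⁻¹ • ε⁻¹ • fderiv ℝ η (ε⁻¹ • (y - x) - h x))
        (volume.restrict (Ω : Set (Vec d))) := by
      refine Continuous.aestronglyMeasurable ?_
      fun_prop
    exact ((ContinuousLinearMap.smulRightL ℝ (Vec d) F).aestronglyMeasurable_comp₂ h1
      hg.aestronglyMeasurable)
  · refine Filter.Eventually.of_forall fun x y _ => ?_
    rw [ContinuousLinearMap.norm_smulRight_apply, norm_smul, norm_smul,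
      Real.norm_of_nonneg (by positivity), Real.norm_of_nonneg (by positivity)]
    gcongr
    exact hM' _
  · exact hg.norm.const_mul _
  · refine Filter.Eventually.of_forall fun x y _ => ?_
    exact (hasFDerivAt_avgKernel_left hη.differentiable x y).smul_const (g x)

/-- A derivative in `y` falls on the profile alone and reproduces an average with profile `∂ₑ η`, at
the price of `ε⁻¹`. So averages are closed under differentiation, and smoothness follows by an
induction over all profiles at once. -/
theorem fderiv_fieldAvg_apply (hc : Continuous h) (hη : IsProfile η) (hε : 0 < ε) {g : Vec d → F}
    (hg : Integrable g (volume.restrict (Ω : Set (Vec d)))) (y e : Vec d) :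
    fderiv ℝ (fieldAvg Ω h η ε g) y e =
      ε⁻¹ • fieldAvg Ω h (fun z => fderiv ℝ η z e) ε g y := by
  obtain ⟨M', hM'0, hM'⟩ := hη.exists_bound_fderiv
  have hηc : Continuous (fderiv ℝ η) := hη.contDiff.continuous_fderiv (by simp)
  rw [(hasFDerivAt_fieldAvg hc hη hε hg y).fderiv, ContinuousLinearMap.integral_apply, fieldAvg,
    ← integral_smul]
  · refine integral_congr_ae (Filter.Eventually.of_forall fun x => ?_)
    simp only [ContinuousLinearMap.smulRight_apply, smul_apply, avgKernel,
      smul_smul, smul_eq_mul]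
    congr 1
    ring
  · have h1 : AEStronglyMeasurable
        (fun x => (ε ^ d)⁻¹ • ε⁻¹ • fderiv ℝ η (ε⁻¹ • (y - x) - h x))
        (volume.restrict (Ω : Set (Vec d))) := by
      refine Continuous.aestronglyMeasurable ?_
      fun_prop
    refine (hg.norm.const_mul ((ε ^ d)⁻¹ * (ε⁻¹ * M'))).mono'
      ((ContinuousLinearMap.smulRightL ℝ (Vec d) F).aestronglyMeasurable_comp₂ h1
        hg.aestronglyMeasurable) (Filter.Eventually.of_forall fun x => ?_)
    rw [ContinuousLinearMap.norm_smulRight_apply, norm_smul, norm_smul,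
      Real.norm_of_nonneg (by positivity), Real.norm_of_nonneg (by positivity)]
    gcongr
    exact hM' _

theorem contDiff_fieldAvg (hc : Continuous h) (hη : IsProfile η) (hε : 0 < ε) {g : Vec d → F}
    (hg : Integrable g (volume.restrict (Ω : Set (Vec d)))) :
    ContDiff ℝ ∞ (fieldAvg Ω h η ε g) := by
  rw [contDiff_infty]
  intro n
  induction n generalizing η with
  | zero =>
    have : Differentiable ℝ (fieldAvg Ω h η ε g) := fun y =>
      (hasFDerivAt_fieldAvg hc hη hε hg y).differentiableAt
    exact contDiff_zero.2 this.continuous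
  | succ n ih =>
    push_cast
    rw [contDiff_succ_iff_fderiv_apply]
    refine ⟨fun y => (hasFDerivAt_fieldAvg hc hη hε hg y).differentiableAt, by simp, fun e => ?_⟩
    simp_rw [fderiv_fieldAvg_apply hc hη hε hg]
    exact (ih (hη.fderiv_apply e)).const_smul _

theorem support_fieldAvg_subset (hη : ∀ x, 1 < ‖x‖ → η x = 0) (hε : 0 < ε) (g : Vec d → F) :
    Function.support (fieldAvg Ω h η ε g) ⊆
      {y | ∃ x ∈ (Ω : Set (Vec d)), y ∈ Metric.closedBall (x + ε • h x) ε} := by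
  intro y hy
  by_contra hcon
  refine hy ?_
  rw [fieldAvg, setIntegral_eq_zero_of_forall_eq_zero]
  intro x hx
  have : y ∉ Metric.closedBall (x + ε • h x) ε := fun h => hcon ⟨x, hx, h⟩
  rw [Metric.mem_closedBall, not_le, dist_eq_norm] at this
  rw [avgKernel, hη, mul_zero, zero_smul]
  have e1 : ε⁻¹ • (y - x) - h x = ε⁻¹ • (y - (x + ε • h x)) := by
    rw [← sub_sub, smul_sub ε⁻¹ (y - x), smul_smul, inv_mul_cancel₀ hε.ne', one_smul]
  rw [e1, norm_smul, norm_inv, Real.norm_of_nonneg hε.le, ← div_eq_inv_mul, lt_div_iff₀ hε]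
  linarith

/-- Integration by parts: the derivative of an average is the average of the derivative, up to
averages without derivatives. -/
theorem fieldAvg_fderiv_eq (hh : ContDiff ℝ ∞ h) (hη : IsProfile η) {g : Vec d → F}
    (hg : ContDiff ℝ ∞ g) (hgc : HasCompactSupport g) (hgΩ : tsupport g ⊆ (Ω : Set (Vec d)))
    (y e : Vec d) :
    ε⁻¹ • fieldAvg Ω h (fun z => fderiv ℝ η z e) ε g y =
      fieldAvg Ω h η ε (fun x => fderiv ℝ g x e) y -
        ∑ m, fieldAvg Ω h (fun z => fderiv ℝ η z (unitVec m)) ε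
          (fun x => (fderiv ℝ h x e m) • g x) y := by
  have hηc : Continuous (fderiv ℝ η) := hη.contDiff.continuous_fderiv (by simp)
  have hhc : Continuous (fderiv ℝ h) := hh.continuous_fderiv (by simp)
  have hgc' : Continuous (fderiv ℝ g) := hg.continuous_fderiv (by simp)
  have hc := hh.continuous
  have hc' := hg.continuous
  have hηc' := hη.contDiff.continuous
  have hzero : ∀ x, x ∉ (Ω : Set (Vec d)) → g x = 0 := fun x hx =>
    image_eq_zero_of_notMem_tsupport fun h => hx (hgΩ h)
  have hzero' : ∀ x, x ∉ (Ω : Set (Vec d)) → fderiv ℝ g x = 0 := fun x hx =>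
    image_eq_zero_of_notMem_tsupport fun h => hx (hgΩ (tsupport_fderiv_subset ℝ h))
  have hK : Continuous (avgKernel h η ε y) := continuous_avgKernel hc hηc' y
  have hKd : Differentiable ℝ (avgKernel h η ε y) := fun x =>
    (hasFDerivAt_avgKernel_right (hh.differentiable (by simp)) hη.differentiable x
      y).differentiableAt
  -- The derivative of the kernel in `x` has two parts. The part with `ε⁻¹ e` is minus the
  -- derivative in `y`; the part with `Dh(x) e` carries no `ε⁻¹` and, expanded in coordinates,
  -- produces the sum over `m`.
  have hDK : ∀ x, fderiv ℝ (avgKernel h η ε y) x e =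
      -((ε ^ d)⁻¹ * fderiv ℝ η (ε⁻¹ • (y - x) - h x) (ε⁻¹ • e + fderiv ℝ h x e)) := by
    intro x
    rw [(hasFDerivAt_avgKernel_right (hh.differentiable (by simp)) hη.differentiable x y).fderiv]
    simp
    ring
  have hDKc : Continuous fun x => fderiv ℝ (avgKernel h η ε y) x e := by
    simp_rw [hDK]
    fun_prop
  have i1 : Integrable (fun x => fderiv ℝ (avgKernel h η ε y) x e • g x) :=
    (hDKc.smul hc').integrable_of_hasCompactSupport hgc.smul_left
  have i2 : Integrable (fun x => avgKernel h η ε y x • fderiv ℝ g x e) :=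
    (hK.smul (by fun_prop)).integrable_of_hasCompactSupport
      (hgc.fderiv_apply (𝕜 := ℝ) e).smul_left
  have i3 : Integrable (fun x => avgKernel h η ε y x • g x) :=
    (hK.smul hc').integrable_of_hasCompactSupport hgc.smul_left
  -- Since `g` is supported in `Ω`, the integrals extend to the whole space and there is no boundary
  -- term.
  have hibp := integral_smul_fderiv_eq_neg_fderiv_smul_of_integrable (v := e) i1 i2 i3
    (fun x _ => hKd x) (fun x _ => hg.differentiable (by simp) x)
  have e1 : fieldAvg Ω h η ε (fun x => fderiv ℝ g x e) y =
      ∫ x, avgKernel h η ε y x • fderiv ℝ g x e :=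
    setIntegral_eq_integral_of_forall_compl_eq_zero fun x hx => by simp [hzero' x hx]
  have j : ∀ (k : Vec d → ℝ) (_ : Continuous k) (v : Vec d), Integrable (fun x =>
      avgKernel h (fun z => fderiv ℝ η z v) ε y x • k x • g x) := by
    intro k hk v
    refine (Continuous.smul (continuous_avgKernel hc (by fun_prop) y)
      (hk.smul hc')).integrable_of_hasCompactSupport ?_
    exact HasCompactSupport.smul_left (f := avgKernel h (fun z => fderiv ℝ η z v) ε y)
      (HasCompactSupport.smul_left (f := k) hgc)
  have e2 : ∀ (k : Vec d → ℝ) (v : Vec d), fieldAvg Ω h (fun z => fderiv ℝ η z v) ε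
      (fun x => k x • g x) y = ∫ x, avgKernel h (fun z => fderiv ℝ η z v) ε y x • k x • g x :=
    fun k v => setIntegral_eq_integral_of_forall_compl_eq_zero fun x hx => by simp [hzero x hx]
  have e3 := e2 (fun _ => 1) e
  simp only [one_smul] at e3
  have j3 := j (fun _ => 1) continuous_const e
  simp only [one_smul] at j3
  rw [e1, hibp, e3]
  simp_rw [e2]
  rw [← integral_finsetSum _ fun m _ => j _ (by fun_prop) _, ← integral_neg]
  refine Eq.trans ?_ (integral_sub i1.neg
    (integrable_finsetSum _ fun m _ => j (fun x => fderiv ℝ h x e m) (by fun_prop) (unitVec m)))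
  rw [← integral_smul]
  refine integral_congr_ae (Filter.Eventually.of_forall fun x => ?_)
  simp only [hDK, avgKernel, smul_smul, ← Finset.sum_smul, ← neg_smul, ← sub_smul]
  congr 1
  have hsum : fderiv ℝ h x e = ∑ m, (fderiv ℝ h x e m) • (unitVec m : Vec d) := by
    ext i
    simp [unitVec, Finset.sum_apply, Pi.single_apply]
  have hs : fderiv ℝ η (ε⁻¹ • (y - x) - h x) (fderiv ℝ h x e) =
      ∑ m, fderiv ℝ h x e m * fderiv ℝ η (ε⁻¹ • (y - x) - h x) (unitVec m) := by
    conv_lhs => rw [hsum]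
    simp only [map_sum, map_smul, smul_eq_mul]
  rw [map_add, map_smul, hs, neg_neg, smul_eq_mul, mul_add, Finset.mul_sum, add_sub_assoc,
    ← Finset.sum_sub_distrib, Finset.sum_eq_zero fun m _ => by ring]
  ring

end calculus

/-! ### Test fields as elements of the closed spaces -/

theorem fderiv_testField_add (φ ψ : TestField Ω) (x : Vec d) :
    fderiv ℝ (⇑φ + ⇑ψ) x = fderiv ℝ φ x + fderiv ℝ ψ x :=
  fderiv_add (φ.contDiff.differentiable (by simp) x) (ψ.contDiff.differentiable (by simp) x)

theorem fderiv_testField_smul (a : ℝ) (φ : TestField Ω) (x : Vec d) :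
    fderiv ℝ (a • ⇑φ) x = a • fderiv ℝ φ x :=
  fderiv_const_smul (φ.contDiff.differentiable (by simp) x) a

/-- `testL2` as a linear map. -/
def testL2Hom (Ω : Opens (Vec d)) : TestField Ω →ₗ[ℝ] L2 Ω (Vec d) where
  toFun := testL2
  map_add' φ ψ := MemLp.toLp_add (memLp_testField φ) (memLp_testField ψ)
  map_smul' a φ := MemLp.toLp_const_smul a (memLp_testField φ)

/-- `testPair` as a linear map. -/
def testPairHom (Ω : Opens (Vec d)) : TestField Ω →ₗ[ℝ] GradPair Ω where
  toFun := testPair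
  map_add' φ ψ := by
    have h : (memLp_gradField (φ + ψ)).toLp (gradField (φ + ψ : TestField Ω)) =
        (memLp_gradField φ).toLp (gradField φ) + (memLp_gradField ψ).toLp (gradField ψ) := by
      rw [← MemLp.toLp_add]
      congr 1
      ext x p
      simp [gradField, fderiv_testField_add]
    rw [testPair, h]
    exact congrArg _ (Prod.ext ((testL2Hom Ω).map_add φ ψ) rfl)
  map_smul' a φ := by
    have h : (memLp_gradField (a • φ)).toLp (gradField (a • φ : TestField Ω)) =
        a • (memLp_gradField φ).toLp (gradField φ) := by
      rw [← MemLp.toLp_const_smul]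
      congr 1
      ext x p
      simp [gradField, fderiv_testField_smul]
    rw [testPair, h]
    exact congrArg _ (Prod.ext ((testL2Hom Ω).map_smul a φ) rfl)

/-- The solenoidal test fields. -/
def solenoidalTest (Ω : Opens (Vec d)) : Submodule ℝ (TestField Ω) where
  carrier := {φ | IsSolenoidal φ}
  zero_mem' x := by
    have : ((0 : TestField Ω) : Vec d → Vec d) = fun _ => 0 := rfl
    simp [divField, this]
  add_mem' {φ ψ} hφ hψ x := by
    have h1 := hφ x
    have h2 := hψ x
    simp only [divField] at h1 h2 ⊢
    simp [fderiv_testField_add, Finset.sum_add_distrib, h1, h2]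
  smul_mem' a φ hφ x := by
    have h1 := hφ x
    simp only [divField] at h1 ⊢
    simp [fderiv_testField_smul, ← Finset.mul_sum, h1]

/-- Solenoidal test fields form a subspace on which `testPair` is linear, so the span in the
definition of `H10sol` adds nothing and the approximants can be taken to be test fields themselves.
-/
theorem exists_seq_tendsto_of_mem_H10sol {u : GradPair Ω} (hu : u ∈ H10sol Ω) :
    ∃ φ : ℕ → TestField Ω, (∀ n, IsSolenoidal (φ n)) ∧
      Filter.Tendsto (fun n => testPair (φ n)) Filter.atTop (𝓝 u) := by
  have h : Submodule.span ℝ (testPair '' {φ : TestField Ω | IsSolenoidal φ}) =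
      (solenoidalTest Ω).map (testPairHom Ω) := by
    rw [← Submodule.span_eq ((solenoidalTest Ω).map (testPairHom Ω))]
    rfl
  rw [H10sol, h, ← SetLike.mem_coe, Submodule.topologicalClosure_coe,
    mem_closure_iff_seq_limit] at hu
  obtain ⟨x, hx, hlim⟩ := hu
  choose φ hφ hφx using hx
  refine ⟨φ, hφ, ?_⟩
  convert! hlim using 2 with n
  exact hφx n

theorem exists_seq_tendsto_of_mem_L2sol {u : L2 Ω (Vec d)} (hu : u ∈ L2sol Ω) :
    ∃ φ : ℕ → TestField Ω, (∀ n, IsSolenoidal (φ n)) ∧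
      Filter.Tendsto (fun n => testL2 (φ n)) Filter.atTop (𝓝 u) := by
  have h : Submodule.span ℝ (testL2 '' {φ : TestField Ω | IsSolenoidal φ}) =
      (solenoidalTest Ω).map (testL2Hom Ω) := by
    rw [← Submodule.span_eq ((solenoidalTest Ω).map (testL2Hom Ω))]
    rfl
  rw [L2sol, h, ← SetLike.mem_coe, Submodule.topologicalClosure_coe,
    mem_closure_iff_seq_limit] at hu
  obtain ⟨x, hx, hlim⟩ := hu
  choose φ hφ hφx using hx
  refine ⟨φ, hφ, ?_⟩
  convert! hlim using 2 with n
  exact hφx n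

/-- `val` as a continuous linear map. -/
def valCLM (Ω : Opens (Vec d)) : H10sol Ω →L[ℝ] L2 Ω (Vec d) :=
  (WithLp.fstL 2 ℝ (L2 Ω (Vec d)) (L2 Ω (Mat d))).comp (H10sol Ω).subtypeL

/-- `grad` as a continuous linear map. -/
def gradCLM (Ω : Opens (Vec d)) : H10sol Ω →L[ℝ] L2 Ω (Mat d) :=
  (WithLp.sndL 2 ℝ (L2 Ω (Vec d)) (L2 Ω (Mat d))).comp (H10sol Ω).subtypeL

theorem norm_sq_eq_val_add_grad (u : H10sol Ω) : ‖u‖ ^ 2 = ‖val u‖ ^ 2 + ‖grad u‖ ^ 2 := by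
  have := WithLp.prod_norm_sq_eq_of_L2 (u : GradPair Ω)
  simpa [val, grad] using this

theorem norm_val_le (u : H10sol Ω) : ‖val u‖ ≤ ‖u‖ := by
  have := norm_sq_eq_val_add_grad u
  exact le_of_sq_le_sq (by nlinarith [sq_nonneg ‖grad u‖]) (norm_nonneg _)

theorem norm_grad_le (u : H10sol Ω) : ‖grad u‖ ≤ ‖u‖ := by
  have := norm_sq_eq_val_add_grad u
  exact le_of_sq_le_sq (by nlinarith [sq_nonneg ‖val u‖]) (norm_nonneg _)

theorem val_mem_L2sol (u : H10sol Ω) : val u ∈ L2sol Ω := by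
  obtain ⟨φ, hφ, hlim⟩ := exists_seq_tendsto_of_mem_H10sol u.2
  have h1 : Filter.Tendsto (fun n => testL2 (φ n)) Filter.atTop (𝓝 (val u)) :=
    ((WithLp.fstL 2 ℝ (L2 Ω (Vec d)) (L2 Ω (Mat d))).continuous.tendsto _).comp hlim
  exact (Submodule.isClosed_topologicalClosure _).mem_of_tendsto h1
    (Filter.Eventually.of_forall fun n => Submodule.le_topologicalClosure _
      (Submodule.subset_span ⟨φ n, hφ n, rfl⟩))

theorem norm_gradField_le (u : Vec d → Vec d) (x : Vec d) :
    ‖gradField u x‖ ≤ ∑ k, ‖fderiv ℝ u x (unitVec k)‖ := by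
  refine le_of_sq_le_sq ?_ (by positivity)
  rw [EuclideanSpace.norm_sq_eq, Fintype.sum_prod_type]
  refine le_trans (le_of_eq ?_)
    (Finset.sum_sq_le_sq_sum_of_nonneg (s := Finset.univ)
      (f := fun k => ‖fderiv ℝ u x (unitVec k)‖) fun _ _ => norm_nonneg _)
  refine Finset.sum_congr rfl fun k _ => ?_
  rw [EuclideanSpace.norm_sq_eq]
  rfl

theorem norm_fderiv_unitVec_le (u : Vec d → Vec d) (x : Vec d) (k : Fin d) :
    ‖fderiv ℝ u x (unitVec k)‖ ≤ ‖gradField u x‖ := by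
  refine le_of_sq_le_sq ?_ (by positivity)
  rw [EuclideanSpace.norm_sq_eq, EuclideanSpace.norm_sq_eq, Fintype.sum_prod_type]
  exact Finset.single_le_sum (f := fun k => ∑ j, ‖gradField u x (k, j)‖ ^ 2)
    (fun _ _ => by positivity) (Finset.mem_univ k)

theorem norm_sq_testPair (φ : TestField Ω) : ‖testPair φ‖ ^ 2 =
    ‖testL2 φ‖ ^ 2 + ‖(memLp_gradField φ).toLp (gradField φ)‖ ^ 2 :=
  WithLp.prod_norm_sq_eq_of_L2 _

theorem ofReal_norm_testPair_le (φ : TestField Ω) :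
    ENNReal.ofReal ‖testPair φ‖ ≤ eLpNorm φ 2 (volume.restrict (Ω : Set (Vec d))) +
      ∑ k, eLpNorm (fun x => fderiv ℝ φ x (unitVec k)) 2 (volume.restrict (Ω : Set (Vec d))) := by
  have hm : ∀ k : Fin d, AEStronglyMeasurable (fun x => ‖fderiv ℝ φ x (unitVec k)‖)
      (volume.restrict (Ω : Set (Vec d))) := by
    intro k
    have : Continuous (fderiv ℝ φ) := φ.contDiff.continuous_fderiv (by simp)
    exact Continuous.aestronglyMeasurable (by fun_prop)
  have h1 : ‖testPair φ‖ ≤ ‖testL2 φ‖ + ‖(memLp_gradField φ).toLp (gradField φ)‖ := by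
    refine le_of_sq_le_sq ?_ (by positivity)
    rw [norm_sq_testPair]
    nlinarith [norm_nonneg (testL2 φ), norm_nonneg ((memLp_gradField φ).toLp (gradField φ))]
  refine (ENNReal.ofReal_le_ofReal h1).trans ?_
  rw [ENNReal.ofReal_add (norm_nonneg _) (norm_nonneg _), testL2, Lp.norm_toLp, Lp.norm_toLp,
    ENNReal.ofReal_toReal (memLp_testField φ).2.ne, ENNReal.ofReal_toReal (memLp_gradField φ).2.ne]
  gcongr
  calc eLpNorm (gradField φ) 2 (volume.restrict (Ω : Set (Vec d)))
      ≤ eLpNorm (∑ k, fun x => ‖fderiv ℝ φ x (unitVec k)‖) 2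
        (volume.restrict (Ω : Set (Vec d))) := by
        refine eLpNorm_mono_real fun x => ?_
        simpa using norm_gradField_le φ x
    _ ≤ ∑ k, eLpNorm (fun x => ‖fderiv ℝ φ x (unitVec k)‖) 2
        (volume.restrict (Ω : Set (Vec d))) :=
        eLpNorm_sum_le (fun k _ => hm k) (by norm_num)
    _ = _ := by simp_rw [eLpNorm_norm]

theorem eLpNorm_testField_le (φ : TestField Ω) :
    eLpNorm φ 2 (volume.restrict (Ω : Set (Vec d))) ≤ ENNReal.ofReal ‖testPair φ‖ := by
  rw [← ENNReal.ofReal_toReal (memLp_testField φ).2.ne, ← Lp.norm_toLp φ (memLp_testField φ)]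
  refine ENNReal.ofReal_le_ofReal (le_of_sq_le_sq ?_ (norm_nonneg _))
  rw [norm_sq_testPair, testL2]
  nlinarith [sq_nonneg ‖(memLp_gradField φ).toLp (gradField φ)‖]

theorem eLpNorm_fderiv_testField_le (φ : TestField Ω) (k : Fin d) :
    eLpNorm (fun x => fderiv ℝ φ x (unitVec k)) 2 (volume.restrict (Ω : Set (Vec d))) ≤
      ENNReal.ofReal ‖testPair φ‖ := by
  have h1 : eLpNorm (fun x => fderiv ℝ φ x (unitVec k)) 2 (volume.restrict (Ω : Set (Vec d))) ≤
      eLpNorm (gradField φ) 2 (volume.restrict (Ω : Set (Vec d))) :=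
    eLpNorm_mono fun x => norm_fderiv_unitVec_le φ x k
  refine h1.trans ?_
  rw [← ENNReal.ofReal_toReal (memLp_gradField φ).2.ne, ← Lp.norm_toLp _ (memLp_gradField φ)]
  refine ENNReal.ofReal_le_ofReal (le_of_sq_le_sq ?_ (norm_nonneg _))
  rw [norm_sq_testPair]
  nlinarith [sq_nonneg ‖testL2 φ‖]

/-! ### Mollification along an inward field -/

theorem memLp_of_continuous_of_isBounded {F : Type*} [NormedAddCommGroup F]
    (hb : Bornology.IsBounded (Ω : Set (Vec d))) {f : Vec d → F} (hf : Continuous f) (p : ℝ≥0∞) :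
    MemLp f p (volume.restrict (Ω : Set (Vec d))) := by
  have : IsFiniteMeasure (volume.restrict (Ω : Set (Vec d))) :=
    isFiniteMeasure_restrict.2 hb.measure_lt_top.ne
  obtain ⟨C, hC⟩ := hb.isCompact_closure.exists_bound_of_continuousOn hf.continuousOn
  have h1 : MemLp f ⊤ (volume.restrict (Ω : Set (Vec d))) :=
    memLp_top_of_bound hf.aestronglyMeasurable C
      (ae_restrict_of_forall_mem Ω.isOpen.measurableSet fun x hx => hC x (subset_closure hx))
  exact h1.mono_exponent le_top

theorem integrable_of_L2 {F : Type} [NormedAddCommGroup F]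
    (hb : Bornology.IsBounded (Ω : Set (Vec d))) (w : L2 Ω F) :
    Integrable w (volume.restrict (Ω : Set (Vec d))) := by
  have : IsFiniteMeasure (volume.restrict (Ω : Set (Vec d))) :=
    isFiniteMeasure_restrict.2 hb.measure_lt_top.ne
  exact (Lp.memLp w).integrable (by norm_num)

theorem integral_fderiv_apply_eq_zero_of_isSolenoidal {K : Vec d → ℝ} (hK : ContDiff ℝ ∞ K)
    {φ : TestField Ω} (hφ : IsSolenoidal φ) : ∫ x, fderiv ℝ K x (φ x) = 0 := by
  have hKc : Continuous (fderiv ℝ K) := hK.continuous_fderiv (by simp)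
  have hφd : Differentiable ℝ φ := φ.contDiff.differentiable (by simp)
  have hφc : Continuous (fderiv ℝ φ) := φ.contDiff.continuous_fderiv (by simp)
  have hφ0 := φ.continuous
  have hK0 := hK.continuous
  have hsum : ∀ x, fderiv ℝ K x (φ x) = ∑ i, fderiv ℝ K x (unitVec i) * φ x i := by
    intro x
    have : φ x = ∑ i, (φ x i) • (unitVec i : Vec d) := by
      ext i
      simp [unitVec, Finset.sum_apply, Pi.single_apply]
    conv_lhs => rw [this]
    simp [mul_comm]
  have hcs : ∀ i, HasCompactSupport fun x => φ x i := fun i =>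
    φ.hasCompactSupport.comp_left (g := fun v : Vec d => v i) rfl
  have hd : ∀ i x, fderiv ℝ (fun x => φ x i) x (unitVec i) = fderiv ℝ φ x (unitVec i) i := by
    intro i x
    have := ((EuclideanSpace.proj i : Vec d →L[ℝ] ℝ).hasFDerivAt (x := φ x).comp x
      (hφd x).hasFDerivAt).fderiv
    have h2 : ((EuclideanSpace.proj i : Vec d →L[ℝ] ℝ) ∘ φ) =
      fun x => φ x i := rfl
    rw [h2] at this
    rw [this]
    rfl
  have hdc : ∀ i, HasCompactSupport fun x => fderiv ℝ φ x (unitVec i) i := fun i =>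
    (φ.hasCompactSupport.fderiv_apply (𝕜 := ℝ) (unitVec i)).comp_left
      (g := fun v : Vec d => v i) rfl
  have i1 : ∀ i, Integrable fun x => fderiv ℝ K x (unitVec i) * φ x i := fun i =>
    Continuous.integrable_of_hasCompactSupport (by fun_prop) (hcs i).mul_left
  have i2 : ∀ i, Integrable fun x => K x * fderiv ℝ (fun x => φ x i) x (unitVec i) := fun i => by
    simp_rw [hd]
    exact Continuous.integrable_of_hasCompactSupport (by fun_prop) (hdc i).mul_left
  have i3 : ∀ i, Integrable fun x => K x * φ x i := fun i =>
    Continuous.integrable_of_hasCompactSupport (by fun_prop) (hcs i).mul_left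
  have hibp : ∀ i, ∫ x, fderiv ℝ K x (unitVec i) * φ x i =
      -∫ x, K x * fderiv ℝ φ x (unitVec i) i := by
    intro i
    have := integral_mul_fderiv_eq_neg_fderiv_mul_of_integrable (i1 i) (i2 i) (i3 i)
      (fun x _ => hK.differentiable (by simp) x) (fun x _ => by fun_prop)
    simp_rw [hd] at this
    rw [this, neg_neg]
  simp_rw [hsum]
  rw [integral_finsetSum _ fun i _ => i1 i]
  simp_rw [hibp]
  rw [Finset.sum_neg_distrib, ← integral_finsetSum]
  · simp_rw [← Finset.mul_sum]
    have : ∀ x, ∑ i, fderiv ℝ φ x (unitVec i) i = 0 := hφ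
    simp [this]
  · intro i _
    simpa only [hd] using i2 i

/-- For a test field this is integration by parts. On the bounded set `Ω` the gradient of `K` is in
`L²`, so the functional is an `L²` inner product and passes to the closure. As `K` need not vanish
near the boundary, the identity also encodes the vanishing normal trace; it gives both the
solenoidality of mollified fields and the antisymmetry of the convective term. -/
theorem setIntegral_fderiv_apply_eq_zero (hb : Bornology.IsBounded (Ω : Set (Vec d)))
    {K : Vec d → ℝ} (hK : ContDiff ℝ ∞ K) {w : L2 Ω (Vec d)} (hw : w ∈ L2sol Ω) :
    ∫ x in (Ω : Set (Vec d)), fderiv ℝ K x (w x) = 0 := by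
  have hKc : Continuous (fderiv ℝ K) := hK.continuous_fderiv (by simp)
  set k : Vec d → Vec d := fun x => (InnerProductSpace.toDual ℝ (Vec d)).symm (fderiv ℝ K x)
    with hk
  have hkc : Continuous k := by fun_prop
  have hkm := memLp_of_continuous_of_isBounded hb hkc 2
  have key : ∀ u : L2 Ω (Vec d), inner ℝ (hkm.toLp k) u =
      ∫ x in (Ω : Set (Vec d)), fderiv ℝ K x (u x) := by
    intro u
    rw [L2.inner_def]
    refine integral_congr_ae ?_
    filter_upwards [hkm.coeFn_toLp] with x hx
    rw [hx, hk, InnerProductSpace.toDual_symm_apply]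
  obtain ⟨φ, hφ, hlim⟩ := exists_seq_tendsto_of_mem_L2sol hw
  have h1 : Filter.Tendsto (fun n => inner ℝ (hkm.toLp k) (testL2 (φ n))) Filter.atTop
      (𝓝 (inner ℝ (hkm.toLp k) w)) :=
    ((continuous_const.inner continuous_id).tendsto w).comp hlim
  have h2 : ∀ n, inner ℝ (hkm.toLp k) (testL2 (φ n)) = 0 := by
    intro n
    rw [key, ← integral_fderiv_apply_eq_zero_of_isSolenoidal hK (hφ n),
      ← setIntegral_eq_integral_of_forall_compl_eq_zero (s := (Ω : Set (Vec d)))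
        (f := fun x => fderiv ℝ K x (φ n x))]
    · refine integral_congr_ae ?_
      filter_upwards [(memLp_testField (φ n)).coeFn_toLp] with x hx
      rw [testL2, hx]
    · intro x hx
      rw [image_eq_zero_of_notMem_tsupport fun h => hx ((φ n).tsupport_subset h), map_zero]
  simp_rw [h2] at h1
  rw [← key]
  exact tendsto_nhds_unique h1 tendsto_const_nhds

section approximation

variable {F : Type*} [NormedAddCommGroup F] [NormedSpace ℝ F]
variable {h : Vec d → Vec d} {H : ℝ} {η : Vec d → ℝ} {ε : ℝ}

theorem integral_avgKernel_const (hη1 : ∫ x, η x = 1) (hε : 0 < ε) (a y : Vec d) :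
    ∫ x, avgKernel (fun _ => a) η ε y x = 1 := by
  simp only [avgKernel]
  rw [integral_const_mul, integral_sub_left_eq_self (fun z => η (ε⁻¹ • z - a)) volume y,
    Measure.integral_comp_smul volume (fun z => η (z - a)) ε⁻¹, integral_sub_right_eq_self, hη1]
  simp only [finrank_euclideanSpace, Fintype.card_fin, smul_eq_mul, mul_one]
  rw [abs_of_nonneg (by positivity), inv_pow, inv_inv, inv_mul_cancel₀ (by positivity)]

/-- The averages of a Lipschitz function converge uniformly with rate `ε`. -/
theorem exists_norm_fieldAvg_sub_le [CompleteSpace F] (hh : Continuous h) (hH : ∀ x, ‖h x‖ ≤ H)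
    {L : ℝ} (hL : ∀ x y, ‖h x - h y‖ ≤ L * ‖x - y‖) (hη : IsProfile η) (hη1 : ∫ x, η x = 1)
    {g : Vec d → F} (hg : Continuous g) (hgc : HasCompactSupport g)
    (hgΩ : tsupport g ⊆ (Ω : Set (Vec d)))
    {L' : ℝ} (hL' : ∀ x y, ‖g x - g y‖ ≤ L' * ‖x - y‖) :
    ∃ C : ℝ, 0 ≤ C ∧ ∀ ε : ℝ, 0 < ε → ∀ y, ‖fieldAvg Ω h η ε g y - g y‖ ≤ C * ε := by
  obtain ⟨M, hM0, hM⟩ := hη.exists_bound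
  obtain ⟨Lη, hLη0, hLη⟩ := hη.exists_lipschitz
  obtain ⟨G, hG⟩ := hgc.exists_bound_of_continuous hg
  have hG0 : 0 ≤ G := (norm_nonneg _).trans (hG 0)
  have hH0 : 0 ≤ H := (norm_nonneg _).trans (hH 0)
  set V := (volume : Measure (Vec d)).real (Metric.closedBall 0 (1 + H)) with hV
  refine ⟨|(M * L' + Lη * L * G)| * (1 + H) * V, by positivity, fun ε hε y => ?_⟩
  have hη0 := hη.contDiff.continuous
  have hzero : ∀ x, x ∉ (Ω : Set (Vec d)) → g x = 0 := fun x hx =>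
    image_eq_zero_of_notMem_tsupport fun h => hx (hgΩ h)
  have hK1 := continuous_avgKernel (ε := ε) hh hη0 y
  have hK2 := continuous_avgKernel (ε := ε) (h := fun _ => h y) continuous_const hη0 y
  have z1 : ∀ x, x ∉ Metric.closedBall y (ε * (1 + H)) → avgKernel h η ε y x = 0 := fun x hx =>
    avgKernel_eq_zero hH hη.eq_zero hε (by simpa using hx)
  have z2 : ∀ x, x ∉ Metric.closedBall y (ε * (1 + H)) → avgKernel (fun _ => h y) η ε y x = 0 :=
    fun x hx => avgKernel_eq_zero (fun _ => hH y) hη.eq_zero hε (by simpa using hx)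
  have e1 : fieldAvg Ω h η ε g y = ∫ x, avgKernel h η ε y x • g x :=
    setIntegral_eq_integral_of_forall_compl_eq_zero fun x hx => by rw [hzero x hx, smul_zero]
  -- With variable shift the kernel need not have mass one; with the shift frozen at `h y` it does.
  -- So `g y` is written with the frozen kernel, and the difference of the integrands is controlled
  -- by the Lipschitz constants of `g`, `h` and `η`: on the support `‖x - y‖` is of order `ε`.
  have e2 : g y = ∫ x, avgKernel (fun _ => h y) η ε y x • g y := by
    rw [integral_smul_const, integral_avgKernel_const hη1 hε, one_smul]
  have i1 : Integrable fun x => avgKernel h η ε y x • g x :=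
    (hK1.smul hg).integrable_of_hasCompactSupport hgc.smul_left
  have i2 : Integrable fun x => avgKernel (fun _ => h y) η ε y x • g y :=
    (hK2.smul continuous_const).integrable_of_hasCompactSupport
      (HasCompactSupport.intro (isCompact_closedBall y (ε * (1 + H))) fun x hx => by
        simp [z2 x hx])
  conv_lhs => rw [e1, e2, ← integral_sub i1 i2]
  rw [← setIntegral_eq_integral_of_forall_compl_eq_zero
    (s := Metric.closedBall y (ε * (1 + H))) fun x hx => by rw [z1 x hx, z2 x hx]; simp]
  refine (norm_setIntegral_le_of_norm_le_const
    (C := (ε ^ d)⁻¹ * (|(M * L' + Lη * L * G)| * (ε * (1 + H))))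
    (isCompact_closedBall _ _).measure_lt_top fun x hx => ?_).trans (le_of_eq ?_)
  · have hxy : ‖x - y‖ ≤ ε * (1 + H) := by rwa [Metric.mem_closedBall, dist_eq_norm] at hx
    have : avgKernel h η ε y x • g x - avgKernel (fun _ => h y) η ε y x • g y =
        (ε ^ d)⁻¹ • (η (ε⁻¹ • (y - x) - h x) • (g x - g y) +
          (η (ε⁻¹ • (y - x) - h x) - η (ε⁻¹ • (y - x) - h y)) • g y) := by
      simp only [avgKernel, mul_smul, ← smul_sub]
      congr 1
      rw [smul_sub (η _), sub_smul, sub_add_sub_cancel]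
    rw [this, norm_smul, Real.norm_of_nonneg (by positivity)]
    gcongr
    refine (norm_add_le _ _).trans ?_
    rw [norm_smul, norm_smul]
    have t1 : ‖η (ε⁻¹ • (y - x) - h x)‖ * ‖g x - g y‖ ≤ M * (L' * ‖x - y‖) := by
      gcongr
      · exact hM _
      · exact hL' _ _
    have t2 : ‖η (ε⁻¹ • (y - x) - h x) - η (ε⁻¹ • (y - x) - h y)‖ * ‖g y‖ ≤
        (Lη * (L * ‖x - y‖)) * G := by
      have hn := (norm_nonneg _).trans (hL x y)
      have : ‖η (ε⁻¹ • (y - x) - h x) - η (ε⁻¹ • (y - x) - h y)‖ ≤ Lη * (L * ‖x - y‖) := by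
        refine (hLη _ _).trans ?_
        gcongr
        rw [show ε⁻¹ • (y - x) - h x - (ε⁻¹ • (y - x) - h y) = h y - h x by abel, norm_sub_rev]
        exact hL _ _
      exact mul_le_mul this (hG _) (norm_nonneg _) (by positivity)
    calc _ ≤ M * (L' * ‖x - y‖) + (Lη * (L * ‖x - y‖)) * G := add_le_add t1 t2
      _ = (M * L' + Lη * L * G) * ‖x - y‖ := by ring
      _ ≤ |(M * L' + Lη * L * G)| * (ε * (1 + H)) := by
          gcongr
          exact le_abs_self _
  · rw [measureReal_def, Measure.addHaar_closedBall_mul _ _ hε.le (by linarith),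
      ENNReal.toReal_mul, ENNReal.toReal_ofReal (by positivity), hV, measureReal_def]
    simp only [finrank_euclideanSpace, Fintype.card_fin]
    field_simp

end approximation

/-- The data for mollification inside a bounded domain: an inward field and a profile. -/
structure MollifierData (Ω : Opens (Vec d)) where
  /-- the inward field -/
  h : Vec d → Vec d
  /-- the profile -/
  η : Vec d → ℝ
  /-- the largest admissible parameter -/
  ε₀ : ℝ
  contDiff_h : ContDiff ℝ ∞ h
  hasCompactSupport_h : HasCompactSupport h
  isProfile : IsProfile η
  integral_eq_one : ∫ x, η x = 1
  isBounded : Bornology.IsBounded (Ω : Set (Vec d))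
  pos : 0 < ε₀
  le_one : ε₀ ≤ 1
  closedBall_subset : ∀ ε : ℝ, 0 < ε → ε ≤ ε₀ → ∀ x ∈ closure (Ω : Set (Vec d)),
    Metric.closedBall (x + ε • h x) ε ⊆ Ω

theorem IsLipschitzDomain.nonempty_mollifierData (hΩ : IsLipschitzDomain Ω) :
    Nonempty (MollifierData Ω) := by
  obtain ⟨h, hh, hhc, ε₀, hε₀, hball⟩ := hΩ.exists_inward_field
  let b : ContDiffBump (0 : Vec d) := ⟨1 / 2, 1, by norm_num, by norm_num⟩
  exact ⟨{
    h := h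
    η := b.normed volume
    ε₀ := min ε₀ 1
    contDiff_h := hh
    hasCompactSupport_h := hhc
    isProfile := ⟨b.contDiff_normed, fun x hx => by
      by_contra hne
      have : x ∈ Function.support (b.normed volume) := hne
      rw [b.support_normed_eq] at this
      simp only [Metric.mem_ball, dist_zero_right] at this
      have hr : b.rOut = 1 := rfl
      linarith⟩
    integral_eq_one := b.integral_normed
    isBounded := hΩ.bounded
    pos := by positivity
    le_one := min_le_right _ _
    closedBall_subset := fun ε h0 h1 => hball ε h0 (h1.trans (min_le_left _ _)) }⟩

section linear

variable {F : Type*} [NormedAddCommGroup F] [NormedSpace ℝ F]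
variable {h : Vec d → Vec d} {η : Vec d → ℝ} {ε : ℝ}

theorem fieldAvg_congr_ae {f g : Vec d → F}
    (hfg : f =ᵐ[volume.restrict (Ω : Set (Vec d))] g) :
    fieldAvg Ω h η ε f = fieldAvg Ω h η ε g := by
  ext y
  refine integral_congr_ae ?_
  filter_upwards [hfg] with x hx
  rw [hx]

theorem fieldAvg_add (hc : Continuous h) (hη : IsProfile η) (hε : 0 < ε) {f g : Vec d → F}
    (hf : Integrable f (volume.restrict (Ω : Set (Vec d))))
    (hg : Integrable g (volume.restrict (Ω : Set (Vec d)))) (y : Vec d) :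
    fieldAvg Ω h η ε (fun x => f x + g x) y = fieldAvg Ω h η ε f y + fieldAvg Ω h η ε g y := by
  obtain ⟨M, hM0, hM⟩ := hη.exists_bound
  have hη0 := hη.contDiff.continuous
  rw [fieldAvg, fieldAvg, fieldAvg, ← integral_add (integrable_avgKernel_smul hc hη0 hM hε hf y)
    (integrable_avgKernel_smul hc hη0 hM hε hg y)]
  simp_rw [smul_add]

theorem fieldAvg_smul (a : ℝ) (f : Vec d → F) (y : Vec d) :
    fieldAvg Ω h η ε (fun x => a • f x) y = a • fieldAvg Ω h η ε f y := by
  rw [fieldAvg, fieldAvg, ← integral_smul]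
  simp_rw [smul_comm a]

end linear

/-- The push forward of a vector field under `x ↦ x + ε h(x)`, before the change of variables. -/
def pushField (h : Vec d → Vec d) (ε : ℝ) (w : Vec d → Vec d) (x : Vec d) : Vec d :=
  w x + ε • fderiv ℝ h x (w x)

namespace MollifierData

variable (D : MollifierData Ω)

theorem continuous_h : Continuous D.h := D.contDiff_h.continuous

theorem continuous_fderiv_h : Continuous (fderiv ℝ D.h) :=
  D.contDiff_h.continuous_fderiv (by simp)

theorem exists_bound_h : ∃ H, 0 ≤ H ∧ ∀ x, ‖D.h x‖ ≤ H := by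
  obtain ⟨H, hH⟩ := D.hasCompactSupport_h.exists_bound_of_continuous D.continuous_h
  exact ⟨H, (norm_nonneg _).trans (hH 0), hH⟩

theorem exists_bound_fderiv_h : ∃ H, 0 ≤ H ∧ ∀ x, ‖fderiv ℝ D.h x‖ ≤ H := by
  obtain ⟨H, hH⟩ := (D.hasCompactSupport_h.fderiv (𝕜 := ℝ)).exists_bound_of_continuous
    D.continuous_fderiv_h
  exact ⟨H, (norm_nonneg _).trans (hH 0), hH⟩

theorem integrable_fderiv_apply {w : Vec d → Vec d}
    (hw : Integrable w (volume.restrict (Ω : Set (Vec d)))) :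
    Integrable (fun x => fderiv ℝ D.h x (w x)) (volume.restrict (Ω : Set (Vec d))) := by
  obtain ⟨H, hH0, hH⟩ := D.exists_bound_fderiv_h
  have hm : AEStronglyMeasurable (fun x => fderiv ℝ D.h x (w x))
      (volume.restrict (Ω : Set (Vec d))) :=
    (ContinuousLinearMap.apply ℝ (Vec d)).flip.aestronglyMeasurable_comp₂
      D.continuous_fderiv_h.aestronglyMeasurable hw.aestronglyMeasurable
  refine (hw.norm.const_mul H).mono' hm (Filter.Eventually.of_forall fun x => ?_)
  exact ((fderiv ℝ D.h x).le_opNorm _).trans (by gcongr; exact hH x)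

theorem integrable_pushField (ε : ℝ) {w : Vec d → Vec d}
    (hw : Integrable w (volume.restrict (Ω : Set (Vec d)))) :
    Integrable (pushField D.h ε w) (volume.restrict (Ω : Set (Vec d))) :=
  hw.add ((D.integrable_fderiv_apply hw).smul ε)

/-- The points reached from `Ω` by the mollification. -/
theorem tsupport_fieldAvg_subset {F : Type*} [NormedAddCommGroup F] [NormedSpace ℝ F] {ε : ℝ}
    (h0 : 0 < ε) (h1 : ε ≤ D.ε₀) (g : Vec d → F) :
    HasCompactSupport (fieldAvg Ω D.h D.η ε g) ∧
      tsupport (fieldAvg Ω D.h D.η ε g) ⊆ (Ω : Set (Vec d)) := by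
  set K : Set (Vec d) := (fun z : Vec d × Vec d => z.1 + ε • D.h z.1 + z.2) ''
    (closure (Ω : Set (Vec d)) ×ˢ Metric.closedBall 0 ε) with hK
  have hc := D.continuous_h
  have hKc : IsCompact K :=
    (D.isBounded.isCompact_closure.prod (isCompact_closedBall _ _)).image (by fun_prop)
  have hKΩ : K ⊆ Ω := by
    rintro _ ⟨⟨x, z⟩, ⟨hx, hz⟩, rfl⟩
    refine D.closedBall_subset ε h0 h1 x hx ?_
    simpa using hz
  have hsupp : Function.support (fieldAvg Ω D.h D.η ε g) ⊆ K := by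
    refine (support_fieldAvg_subset D.isProfile.eq_zero h0 g).trans ?_
    rintro y ⟨x, hx, hy⟩
    refine ⟨(x, y - (x + ε • D.h x)), ⟨subset_closure hx, ?_⟩, by simp⟩
    simpa [dist_eq_norm] using hy
  have hts : tsupport (fieldAvg Ω D.h D.η ε g) ⊆ K := closure_minimal hsupp hKc.isClosed
  exact ⟨hKc.of_isClosed_subset (isClosed_tsupport _) hts, hts.trans hKΩ⟩

/-- Mollification of `L²` vector fields to test fields. -/
def mollify {ε : ℝ} (h0 : 0 < ε) (h1 : ε ≤ D.ε₀) : L2 Ω (Vec d) →ₗ[ℝ] TestField Ω where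
  toFun w :=
    { toFun := fieldAvg Ω D.h D.η ε (pushField D.h ε w)
      contDiff' := contDiff_fieldAvg D.continuous_h D.isProfile h0
        (D.integrable_pushField ε (integrable_of_L2 D.isBounded w))
      hasCompactSupport' := (D.tsupport_fieldAvg_subset h0 h1 _).1
      tsupport_subset' := (D.tsupport_fieldAvg_subset h0 h1 _).2 }
  map_add' w₁ w₂ := by
    ext1 y
    have e : pushField D.h ε (w₁ + w₂ : L2 Ω (Vec d)) =ᵐ[volume.restrict (Ω : Set (Vec d))]
        fun x => pushField D.h ε w₁ x + pushField D.h ε w₂ x := by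
      filter_upwards [Lp.coeFn_add w₁ w₂] with x hx
      simp only [pushField, hx, Pi.add_apply, map_add, smul_add]
      abel
    change fieldAvg Ω D.h D.η ε (pushField D.h ε (w₁ + w₂ : L2 Ω (Vec d))) y = _
    rw [fieldAvg_congr_ae e, fieldAvg_add D.continuous_h D.isProfile h0
      (D.integrable_pushField ε (integrable_of_L2 D.isBounded w₁))
      (D.integrable_pushField ε (integrable_of_L2 D.isBounded w₂))]
    rfl
  map_smul' a w := by
    ext1 y
    have e : pushField D.h ε (a • w : L2 Ω (Vec d)) =ᵐ[volume.restrict (Ω : Set (Vec d))]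
        fun x => a • pushField D.h ε w x := by
      filter_upwards [Lp.coeFn_smul a w] with x hx
      simp only [pushField, hx, Pi.smul_apply, map_smul, smul_add, smul_comm a]
    change fieldAvg Ω D.h D.η ε (pushField D.h ε (a • w : L2 Ω (Vec d))) y = _
    rw [fieldAvg_congr_ae e, fieldAvg_smul]
    rfl

section

variable {ε : ℝ} (h0 : 0 < ε) (h1 : ε ≤ D.ε₀)

theorem coe_mollify (w : L2 Ω (Vec d)) :
    (D.mollify h0 h1 w : Vec d → Vec d) = fieldAvg Ω D.h D.η ε (pushField D.h ε w) := rfl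

/-- If `k(y,x)` is the kernel, the chain rule gives `D_y k ∘ (I + ε Dh(x)) = -D_x k`. The divergence
of the average of `(I + ε Dh) w` is therefore `-∫ D_x k (w)`, which vanishes for `w ∈ L²_σ` because
`k(y, ·)` is smooth. This is the reason for the factor in `pushField`. -/
theorem isSolenoidal_mollify {w : L2 Ω (Vec d)} (hw : w ∈ L2sol Ω) :
    IsSolenoidal (D.mollify h0 h1 w) := by
  intro y
  have hi := D.integrable_pushField ε (integrable_of_L2 D.isBounded w)
  have hK : ContDiff ℝ ∞ (avgKernel D.h D.η ε y) := by
    have h1 := D.contDiff_h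
    have h2 := D.isProfile.contDiff
    unfold avgKernel
    have h3 : ContDiff ℝ ∞ fun x => ε⁻¹ • (y - x) - D.h x := by fun_prop
    exact contDiff_const.mul (h2.comp h3)
  have h2 := setIntegral_fderiv_apply_eq_zero D.isBounded hK hw
  have hDη : Continuous (fderiv ℝ D.η) := D.isProfile.contDiff.continuous_fderiv (by simp)
  have key : ∀ i, fderiv ℝ (fieldAvg Ω D.h D.η ε (pushField D.h ε w)) y (unitVec i) i =
      ∫ x in (Ω : Set (Vec d)), ε⁻¹ *
        (avgKernel D.h (fun z => fderiv ℝ D.η z (unitVec i)) ε y x * pushField D.h ε w x i) := by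
    intro i
    obtain ⟨M, hM0, hM⟩ := (D.isProfile.fderiv_apply (unitVec i)).exists_bound
    rw [fderiv_fieldAvg_apply D.continuous_h D.isProfile h0 hi, integral_const_mul]
    change ε⁻¹ * (EuclideanSpace.proj i : Vec d →L[ℝ] ℝ) (∫ x in (Ω : Set (Vec d)), _) = _
    rw [← ContinuousLinearMap.integral_comp_comm _ (integrable_avgKernel_smul D.continuous_h
      (by fun_prop) hM h0 hi y)]
    rfl
  have hint : ∀ i, Integrable (fun x => ε⁻¹ *
      (avgKernel D.h (fun z => fderiv ℝ D.η z (unitVec i)) ε y x * pushField D.h ε w x i))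
      (volume.restrict (Ω : Set (Vec d))) := by
    intro i
    obtain ⟨M, hM0, hM⟩ := (D.isProfile.fderiv_apply (unitVec i)).exists_bound
    exact ((EuclideanSpace.proj i : Vec d →L[ℝ] ℝ).integrable_comp
      (integrable_avgKernel_smul D.continuous_h (by fun_prop) hM h0 hi y)).const_mul _
  rw [coe_mollify, divField]
  simp_rw [key]
  rw [← integral_finsetSum _ fun i _ => hint i, ← neg_eq_zero, ← integral_neg, ← h2]
  refine integral_congr_ae (Filter.Eventually.of_forall fun x => ?_)
  simp only
  rw [(hasFDerivAt_avgKernel_right (D.contDiff_h.differentiable (by simp))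
    D.isProfile.differentiable x y).fderiv]
  simp only [avgKernel, ContinuousLinearMap.comp_apply, neg_apply, smul_apply, add_apply,
    ContinuousLinearMap.id_apply, smul_eq_mul]
  have hexp : ε⁻¹ • w x + fderiv ℝ D.h x (w x) = ε⁻¹ • ∑ i, (pushField D.h ε w x i) •
      (unitVec i : Vec d) := by
    have : ∑ i, (pushField D.h ε w x i) • (unitVec i : Vec d) = pushField D.h ε w x := by
      ext i
      simp [unitVec, Finset.sum_apply, Pi.single_apply]
    rw [this, pushField, smul_add, smul_smul, inv_mul_cancel₀ h0.ne', one_smul]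
  rw [hexp, map_smul, map_sum, smul_eq_mul]
  simp only [map_smul, smul_eq_mul, Finset.mul_sum]
  congr 1
  refine Finset.sum_congr rfl fun i _ => ?_
  ring

end

theorem eLpNorm_fderiv_apply_le {H : ℝ} (hH : ∀ x, ‖fderiv ℝ D.h x‖ ≤ H)
    (w : Vec d → Vec d) (p : ℝ≥0∞) :
    eLpNorm (fun x => fderiv ℝ D.h x (w x)) p (volume.restrict (Ω : Set (Vec d))) ≤
      ENNReal.ofReal H * eLpNorm w p (volume.restrict (Ω : Set (Vec d))) :=
  eLpNorm_le_mul_eLpNorm_of_ae_le_mul (Filter.Eventually.of_forall fun x =>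
    ((fderiv ℝ D.h x).le_opNorm _).trans (by gcongr; exact hH x)) p

theorem eLpNorm_pushField_le {H : ℝ} (hH0 : 0 ≤ H) (hH : ∀ x, ‖fderiv ℝ D.h x‖ ≤ H)
    {ε : ℝ} (h0 : 0 < ε) (h1 : ε ≤ D.ε₀) (w : Vec d → Vec d) (p : ℝ≥0∞) :
    eLpNorm (pushField D.h ε w) p (volume.restrict (Ω : Set (Vec d))) ≤
      ENNReal.ofReal (1 + H) * eLpNorm w p (volume.restrict (Ω : Set (Vec d))) := by
  refine eLpNorm_le_mul_eLpNorm_of_ae_le_mul (Filter.Eventually.of_forall fun x => ?_) p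
  have hε : ε ≤ 1 := h1.trans D.le_one
  refine (norm_add_le _ _).trans ?_
  rw [norm_smul, Real.norm_of_nonneg h0.le]
  have := ((fderiv ℝ D.h x).le_opNorm (w x)).trans (mul_le_mul_of_nonneg_right (hH x)
    (norm_nonneg _))
  have h2 : 0 ≤ H * ‖w x‖ := by positivity
  nlinarith [norm_nonneg (fderiv ℝ D.h x (w x))]

/-- Mollification is bounded in every Lebesgue space, uniformly in the parameter. -/
theorem exists_eLpNorm_mollify_le : ∃ C : ℝ, 0 ≤ C ∧
    ∀ (ε : ℝ) (h0 : 0 < ε) (h1 : ε ≤ D.ε₀) (w : L2 Ω (Vec d)) (p : ℝ≥0∞), 1 ≤ p →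
      eLpNorm (D.mollify h0 h1 w) p (volume.restrict (Ω : Set (Vec d))) ≤
        ENNReal.ofReal C * eLpNorm w p (volume.restrict (Ω : Set (Vec d))) := by
  obtain ⟨H, hH0, hH⟩ := D.exists_bound_h
  obtain ⟨H', hH'0, hH'⟩ := D.exists_bound_fderiv_h
  obtain ⟨C, hC0, hC⟩ := exists_eLpNorm_fieldAvg_le (Ω := Ω) (F := Vec d) hH D.isProfile
  refine ⟨C * (1 + H'), by positivity, fun ε h0 h1 w p hp => ?_⟩
  rw [coe_mollify, ENNReal.ofReal_mul hC0, mul_assoc]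
  refine (hC ε h0 _ (D.integrable_pushField ε
    (integrable_of_L2 D.isBounded w)).aestronglyMeasurable p hp).trans ?_
  gcongr
  exact D.eLpNorm_pushField_le hH'0 hH' h0 h1 w p

/-- The constant depends on `ε`. The bound is used only with a fixed parameter, to make the
convective term with mollified last argument continuous on the energy space. -/
theorem exists_norm_mollify_le {ε : ℝ} (h0 : 0 < ε) (h1 : ε ≤ D.ε₀) : ∃ B : ℝ, 0 ≤ B ∧
    ∀ (w : L2 Ω (Vec d)) (x : Vec d), ‖D.mollify h0 h1 w x‖ ≤ B * ‖w‖ := by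
  obtain ⟨H', hH'0, hH'⟩ := D.exists_bound_fderiv_h
  obtain ⟨M, hM0, hM⟩ := D.isProfile.exists_bound
  have hfin : IsFiniteMeasure (volume.restrict (Ω : Set (Vec d))) :=
    isFiniteMeasure_restrict.2 D.isBounded.measure_lt_top.ne
  set V := (volume.restrict (Ω : Set (Vec d)) univ) ^ (1 / 2 : ℝ) with hV
  have hVtop : V ≠ ⊤ := ENNReal.rpow_ne_top_of_nonneg (by norm_num) (measure_ne_top _ _)
  refine ⟨(ε ^ d)⁻¹ * M * ((1 + H') * V.toReal), by positivity, fun w x => ?_⟩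
  have hi := D.integrable_pushField ε (integrable_of_L2 D.isBounded w)
  rw [coe_mollify, mul_assoc]
  refine (norm_fieldAvg_le hM h0 hi x).trans ?_
  gcongr
  rw [integral_norm_eq_lintegral_enorm hi.aestronglyMeasurable,
    ← eLpNorm_one_eq_lintegral_enorm]
  have h2 := D.eLpNorm_pushField_le hH'0 hH' h0 h1 w 1
  have h3 := eLpNorm_le_eLpNorm_mul_rpow_measure_univ (μ := volume.restrict (Ω : Set (Vec d)))
    (p := 1) (q := 2) (f := w) (by norm_num) (Lp.aestronglyMeasurable w)
  have hexp : (1 / (1 : ℝ≥0∞).toReal - 1 / (2 : ℝ≥0∞).toReal) = (1 / 2 : ℝ) := by norm_num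
  rw [hexp, ← hV] at h3
  have h4 := h2.trans (mul_le_mul_right h3 (ENNReal.ofReal (1 + H')))
  refine (ENNReal.toReal_mono ?_ h4).trans (le_of_eq ?_)
  · exact ENNReal.mul_ne_top ENNReal.ofReal_ne_top (ENNReal.mul_ne_top (Lp.memLp w).2.ne hVtop)
  · rw [ENNReal.toReal_mul, ENNReal.toReal_mul, ENNReal.toReal_ofReal (by positivity),
      Lp.norm_def]
    ring

end MollifierData

namespace MollifierData

variable (D : MollifierData Ω)

section

variable {ε : ℝ} (h0 : 0 < ε) (h1 : ε ≤ D.ε₀)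

theorem mollify_apply (w : L2 Ω (Vec d)) (y : Vec d) :
    D.mollify h0 h1 w y = fieldAvg Ω D.h D.η ε w y +
      ε • fieldAvg Ω D.h D.η ε (fun x => fderiv ℝ D.h x (w x)) y := by
  have hw := integrable_of_L2 D.isBounded w
  rw [coe_mollify, ← fieldAvg_smul, ← fieldAvg_add D.continuous_h D.isProfile h0
    (g := fun x => ε • fderiv ℝ D.h x (w x)) hw ((D.integrable_fderiv_apply hw).smul ε)]
  rfl

theorem fderiv_mollify_apply (w : L2 Ω (Vec d)) (y e : Vec d) :
    fderiv ℝ (D.mollify h0 h1 w) y e =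
      ε⁻¹ • fieldAvg Ω D.h (fun z => fderiv ℝ D.η z e) ε w y +
        fieldAvg Ω D.h (fun z => fderiv ℝ D.η z e) ε (fun x => fderiv ℝ D.h x (w x)) y := by
  have hw := integrable_of_L2 D.isBounded w
  rw [coe_mollify, fderiv_fieldAvg_apply D.continuous_h D.isProfile h0
    (D.integrable_pushField ε hw)]
  have : fieldAvg Ω D.h (fun z => fderiv ℝ D.η z e) ε (pushField D.h ε w) y =
      fieldAvg Ω D.h (fun z => fderiv ℝ D.η z e) ε w y +
        ε • fieldAvg Ω D.h (fun z => fderiv ℝ D.η z e) ε (fun x => fderiv ℝ D.h x (w x)) y := by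
    rw [← fieldAvg_smul, ← fieldAvg_add D.continuous_h (D.isProfile.fderiv_apply e) h0
      (g := fun x => ε • fderiv ℝ D.h x (w x)) hw ((D.integrable_fderiv_apply hw).smul ε)]
    rfl
  rw [this, smul_add, smul_smul, inv_mul_cancel₀ h0.ne', one_smul]

/-- For a test field the factor `ε⁻¹` in the derivative disappears after integration by parts. What
remains are averages of `Dφ` and of products of `φ` with `Dh`, which are bounded in `L²` uniformly
in `ε`; this is the source of the uniform `H¹` bound. -/
theorem fderiv_mollify_test_apply (φ : TestField Ω) (y e : Vec d) :
    fderiv ℝ (D.mollify h0 h1 (testL2 φ)) y e =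
      fieldAvg Ω D.h D.η ε (fun x => fderiv ℝ φ x e) y -
        ∑ m, fieldAvg Ω D.h (fun z => fderiv ℝ D.η z (unitVec m)) ε
          (fun x => (fderiv ℝ D.h x e m) • φ x) y +
        fieldAvg Ω D.h (fun z => fderiv ℝ D.η z e) ε (fun x => fderiv ℝ D.h x (φ x)) y := by
  have hae : testL2 φ =ᵐ[volume.restrict (Ω : Set (Vec d))] φ :=
    (memLp_testField φ).coeFn_toLp
  rw [fderiv_mollify_apply, fieldAvg_congr_ae hae, fieldAvg_fderiv_eq D.contDiff_h D.isProfile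
    φ.contDiff φ.hasCompactSupport φ.tsupport_subset]
  congr 1
  rw [fieldAvg_congr_ae]
  filter_upwards [hae] with x hx
  rw [hx]

end

theorem continuous_fieldAvg {F : Type*} [NormedAddCommGroup F] [NormedSpace ℝ F] {η : Vec d → ℝ}
    (hη : IsProfile η) {ε : ℝ} (h0 : 0 < ε) {g : Vec d → F}
    (hg : Integrable g (volume.restrict (Ω : Set (Vec d)))) :
    Continuous (fieldAvg Ω D.h η ε g) :=
  (contDiff_fieldAvg D.continuous_h hη h0 hg).continuous

theorem exists_eLpNorm_two_fieldAvg_le {F : Type*} [NormedAddCommGroup F] [NormedSpace ℝ F]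
    {η : Vec d → ℝ} (hη : IsProfile η) : ∃ C : ℝ, 0 ≤ C ∧ ∀ ε : ℝ, 0 < ε → ∀ g : Vec d → F,
      AEStronglyMeasurable g (volume.restrict (Ω : Set (Vec d))) →
      eLpNorm (fieldAvg Ω D.h η ε g) 2 (volume.restrict (Ω : Set (Vec d))) ≤
        ENNReal.ofReal C * eLpNorm g 2 (volume.restrict (Ω : Set (Vec d))) := by
  obtain ⟨H, hH0, hH⟩ := D.exists_bound_h
  obtain ⟨C, hC0, hC⟩ := exists_eLpNorm_fieldAvg_le (Ω := Ω) (F := F) hH hη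
  exact ⟨C, hC0, fun ε h0 g hg => hC ε h0 g hg 2 (by norm_num)⟩

/-- The constant depends on `ε`. For a fixed parameter this continuity from `L²` to `H¹` carries the
uniform bound for test fields over to all of `H¹_{0,σ}`. -/
theorem exists_norm_testPair_mollify_le_of_L2 {ε : ℝ} (h0 : 0 < ε) (h1 : ε ≤ D.ε₀) :
    ∃ B : ℝ, 0 ≤ B ∧ ∀ w : L2 Ω (Vec d), ‖testPair (D.mollify h0 h1 w)‖ ≤ B * ‖w‖ := by
  obtain ⟨C, hC0, hC⟩ := D.exists_eLpNorm_mollify_le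
  obtain ⟨H', hH'0, hH'⟩ := D.exists_bound_fderiv_h
  choose C' hC'0 hC' using fun k : Fin d => D.exists_eLpNorm_two_fieldAvg_le (F := Vec d)
    (D.isProfile.fderiv_apply (unitVec k))
  have hpos : ∀ k, 0 ≤ ε⁻¹ * (C' k * (1 + H')) := fun k => by
    have := hC'0 k; positivity
  have hpos' : 0 ≤ C + ∑ k, ε⁻¹ * (C' k * (1 + H')) :=
    add_nonneg hC0 (Finset.sum_nonneg fun k _ => hpos k)
  refine ⟨C + ∑ k, ε⁻¹ * (C' k * (1 + H')), hpos', fun w => ?_⟩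
  have hw := integrable_of_L2 D.isBounded w
  rw [← ENNReal.ofReal_le_ofReal_iff (by positivity)]
  refine (ofReal_norm_testPair_le _).trans ?_
  rw [ENNReal.ofReal_mul hpos', ENNReal.ofReal_add hC0 (Finset.sum_nonneg fun k _ => hpos k),
    ENNReal.ofReal_sum_of_nonneg fun k _ => hpos k, add_mul, Finset.sum_mul,
    Lp.norm_def, ENNReal.ofReal_toReal (Lp.memLp w).2.ne]
  gcongr with k
  · exact hC ε h0 h1 w 2 (by norm_num)
  · have e : (fun y => fderiv ℝ (D.mollify h0 h1 w) y (unitVec k)) =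
        ε⁻¹ • fieldAvg Ω D.h (fun z => fderiv ℝ D.η z (unitVec k)) ε (pushField D.h ε w) := by
      ext1 y
      rw [coe_mollify, fderiv_fieldAvg_apply D.continuous_h D.isProfile h0
        (D.integrable_pushField ε hw)]
      rfl
    rw [e, eLpNorm_const_smul, ENNReal.ofReal_mul (by positivity), ENNReal.ofReal_mul (hC'0 k),
      mul_assoc, mul_assoc, Real.enorm_of_nonneg (by positivity)]
    gcongr
    refine (hC' k ε h0 _ (D.integrable_pushField ε hw).aestronglyMeasurable).trans ?_
    gcongr
    exact D.eLpNorm_pushField_le hH'0 hH' h0 h1 w 2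

/-- Mollification of test fields is bounded in `H¹`, uniformly in the parameter. -/
theorem exists_norm_testPair_mollify_test_le : ∃ C : ℝ, 0 ≤ C ∧
    ∀ (ε : ℝ) (h0 : 0 < ε) (h1 : ε ≤ D.ε₀) (φ : TestField Ω),
      ‖testPair (D.mollify h0 h1 (testL2 φ))‖ ≤ C * ‖testPair φ‖ := by
  obtain ⟨C, hC0, hC⟩ := D.exists_eLpNorm_mollify_le
  obtain ⟨C₁, hC₁0, hC₁⟩ := D.exists_eLpNorm_two_fieldAvg_le (F := Vec d) D.isProfile
  obtain ⟨H, hH0, hH⟩ := D.exists_bound_fderiv_h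
  choose C₂ hC₂0 hC₂ using fun k : Fin d => D.exists_eLpNorm_two_fieldAvg_le (F := Vec d)
    (D.isProfile.fderiv_apply (unitVec k))
  have hS : 0 ≤ ∑ m, C₂ m * H := Finset.sum_nonneg fun m _ => mul_nonneg (hC₂0 m) hH0
  have hk0 : ∀ k, 0 ≤ C₁ + ∑ m, C₂ m * H + C₂ k * H := fun k => by
    have := hC₂0 k; positivity
  have hpos' : 0 ≤ C + ∑ k, (C₁ + ∑ m, C₂ m * H + C₂ k * H) :=
    add_nonneg hC0 (Finset.sum_nonneg fun k _ => hk0 k)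
  refine ⟨_, hpos', fun ε h0 h1 φ => ?_⟩
  have hφc : Continuous (fderiv ℝ φ) := φ.contDiff.continuous_fderiv (by simp)
  have hφ0 := φ.continuous
  have hhc := D.continuous_fderiv_h
  have hint : ∀ {g : Vec d → Vec d}, Continuous g →
      Integrable g (volume.restrict (Ω : Set (Vec d))) := fun hg =>
    memLp_one_iff_integrable.1 (memLp_of_continuous_of_isBounded D.isBounded hg 1)
  rw [← ENNReal.ofReal_le_ofReal_iff (by positivity)]
  refine (ofReal_norm_testPair_le _).trans ?_
  rw [ENNReal.ofReal_mul hpos', ENNReal.ofReal_add hC0 (Finset.sum_nonneg fun k _ => hk0 k),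
    ENNReal.ofReal_sum_of_nonneg fun k _ => hk0 k, add_mul, Finset.sum_mul]
  have hφ2 := eLpNorm_testField_le φ
  gcongr with k
  · refine (hC ε h0 h1 _ 2 (by norm_num)).trans ?_
    gcongr
    rw [testL2, eLpNorm_congr_ae (memLp_testField φ).coeFn_toLp]
    exact hφ2
  · have hfun : (fun y => fderiv ℝ (D.mollify h0 h1 (testL2 φ)) y (unitVec k)) =
        fieldAvg Ω D.h D.η ε (fun x => fderiv ℝ φ x (unitVec k)) -
          ∑ m, fieldAvg Ω D.h (fun z => fderiv ℝ D.η z (unitVec m)) ε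
            (fun x => (fderiv ℝ D.h x (unitVec k) m) • φ x) +
          fieldAvg Ω D.h (fun z => fderiv ℝ D.η z (unitVec k)) ε
            (fun x => fderiv ℝ D.h x (φ x)) := by
      ext1 y
      rw [D.fderiv_mollify_test_apply h0 h1 φ y (unitVec k)]
      simp
    have m1 := (D.continuous_fieldAvg D.isProfile h0 (hint
      (g := fun x => fderiv ℝ φ x (unitVec k)) (by fun_prop))).aestronglyMeasurable
      (μ := volume.restrict (Ω : Set (Vec d)))
    have m2 : ∀ m, AEStronglyMeasurable (fieldAvg Ω D.h (fun z => fderiv ℝ D.η z (unitVec m)) ε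
        (fun x => (fderiv ℝ D.h x (unitVec k) m) • φ x)) (volume.restrict (Ω : Set (Vec d))) :=
      fun m => (D.continuous_fieldAvg (D.isProfile.fderiv_apply _) h0 (hint
        (g := fun x => (fderiv ℝ D.h x (unitVec k) m) • φ x) (by fun_prop))).aestronglyMeasurable
    have m3 := (D.continuous_fieldAvg (D.isProfile.fderiv_apply (unitVec k)) h0 (hint
      (g := fun x => fderiv ℝ D.h x (φ x)) (by fun_prop))).aestronglyMeasurable
      (μ := volume.restrict (Ω : Set (Vec d)))
    have hm2 : AEStronglyMeasurable (∑ m, fieldAvg Ω D.h (fun z => fderiv ℝ D.η z (unitVec m)) ε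
        (fun x => (fderiv ℝ D.h x (unitVec k) m) • φ x)) (volume.restrict (Ω : Set (Vec d))) :=
      Finset.aestronglyMeasurable_sum _ fun m _ => m2 m
    rw [hfun]
    refine (eLpNorm_add_le (m1.sub hm2) m3 (by norm_num)).trans ?_
    rw [ENNReal.ofReal_add (by positivity) (mul_nonneg (hC₂0 k) hH0),
      ENNReal.ofReal_add hC₁0 hS, add_mul, add_mul]
    refine add_le_add ((eLpNorm_sub_le m1 hm2 (by norm_num)).trans (add_le_add ?_ ?_)) ?_
    · refine (hC₁ ε h0 _ (Continuous.aestronglyMeasurable (by fun_prop))).trans ?_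
      gcongr
      exact eLpNorm_fderiv_testField_le φ k
    · refine (eLpNorm_sum_le (fun m _ => m2 m) (by norm_num)).trans ?_
      rw [ENNReal.ofReal_sum_of_nonneg fun m _ => mul_nonneg (hC₂0 m) hH0, Finset.sum_mul]
      refine Finset.sum_le_sum fun m _ => ?_
      refine (hC₂ m ε h0 _ (Continuous.aestronglyMeasurable (by fun_prop))).trans ?_
      rw [ENNReal.ofReal_mul (hC₂0 m), mul_assoc]
      gcongr
      refine (eLpNorm_le_mul_eLpNorm_of_ae_le_mul (c := H)
        (Filter.Eventually.of_forall fun x => ?_) 2).trans (by gcongr)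
      rw [norm_smul]
      gcongr
      refine (PiLp.norm_apply_le (fderiv ℝ D.h x (unitVec k)) m).trans ?_
      refine ((fderiv ℝ D.h x).le_opNorm _).trans ?_
      simpa using hH x
    · refine (hC₂ k ε h0 _ (Continuous.aestronglyMeasurable (by fun_prop))).trans ?_
      rw [ENNReal.ofReal_mul (hC₂0 k), mul_assoc]
      gcongr
      exact (D.eLpNorm_fderiv_apply_le hH _ 2).trans (by gcongr)

end MollifierData

/-! ### Convergence of the mollification and the approximating operators -/

/-- A family of fields of size `O(ε)` in `L²(Ω)`. -/
def VanishesLinearly (Ω : Opens (Vec d)) (f : ℝ → Vec d → Vec d) : Prop :=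
  ∃ C : ℝ, 0 ≤ C ∧ ∀ ε : ℝ, 0 < ε → ε ≤ 1 →
    AEStronglyMeasurable (f ε) (volume.restrict (Ω : Set (Vec d))) ∧
      eLpNorm (f ε) 2 (volume.restrict (Ω : Set (Vec d))) ≤ ENNReal.ofReal (C * ε)

namespace VanishesLinearly

variable {f g : ℝ → Vec d → Vec d}

theorem add (hf : VanishesLinearly Ω f) (hg : VanishesLinearly Ω g) :
    VanishesLinearly Ω fun ε => f ε + g ε := by
  obtain ⟨C, hC, hf⟩ := hf
  obtain ⟨C', hC', hg⟩ := hg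
  refine ⟨C + C', by positivity, fun ε h0 h1 => ⟨(hf ε h0 h1).1.add (hg ε h0 h1).1, ?_⟩⟩
  rw [add_mul, ENNReal.ofReal_add (by positivity) (by positivity)]
  exact (eLpNorm_add_le (hf ε h0 h1).1 (hg ε h0 h1).1 (by norm_num)).trans
    (add_le_add (hf ε h0 h1).2 (hg ε h0 h1).2)

theorem neg (hf : VanishesLinearly Ω f) : VanishesLinearly Ω fun ε => -f ε := by
  obtain ⟨C, hC, hf⟩ := hf
  refine ⟨C, hC, fun ε h0 h1 => ⟨(hf ε h0 h1).1.neg, ?_⟩⟩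
  rw [eLpNorm_neg]
  exact (hf ε h0 h1).2

theorem sub (hf : VanishesLinearly Ω f) (hg : VanishesLinearly Ω g) :
    VanishesLinearly Ω fun ε => f ε - g ε := by
  simpa only [sub_eq_add_neg] using hf.add hg.neg

theorem sum {ι : Type*} {s : Finset ι} {f : ι → ℝ → Vec d → Vec d}
    (hf : ∀ i ∈ s, VanishesLinearly Ω (f i)) : VanishesLinearly Ω fun ε => ∑ i ∈ s, f i ε := by
  classical
  induction s using Finset.induction_on with
  | empty =>
    refine ⟨0, le_rfl, fun ε _ _ => ?_⟩
    simp only [Finset.sum_empty]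
    exact ⟨aestronglyMeasurable_zero, by simp⟩
  | insert i s hi ih =>
    simp only [Finset.sum_insert hi]
    exact (hf i (Finset.mem_insert_self i s)).add
      (ih fun j hj => hf j (Finset.mem_insert_of_mem hj))

theorem congr (hf : VanishesLinearly Ω f) (h : ∀ ε, 0 < ε → f ε = g ε) :
    VanishesLinearly Ω g := by
  obtain ⟨C, hC, hf⟩ := hf
  exact ⟨C, hC, fun ε h0 h1 => h ε h0 ▸ hf ε h0 h1⟩

end VanishesLinearly

namespace MollifierData

variable (D : MollifierData Ω)

theorem vanishesLinearly_smul {η : Vec d → ℝ} (hη : IsProfile η) {g : Vec d → Vec d}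
    (hg : Continuous g) : VanishesLinearly Ω fun ε => ε • fieldAvg Ω D.h η ε g := by
  obtain ⟨C, hC0, hC⟩ := D.exists_eLpNorm_two_fieldAvg_le (F := Vec d) hη
  have h2 := memLp_of_continuous_of_isBounded D.isBounded hg 2
  have hi := memLp_one_iff_integrable.1 (memLp_of_continuous_of_isBounded D.isBounded hg 1)
  refine ⟨C * (eLpNorm g 2 (volume.restrict (Ω : Set (Vec d)))).toReal, by positivity,
    fun ε h0 h1 => ⟨((D.continuous_fieldAvg hη h0 hi).const_smul ε).aestronglyMeasurable, ?_⟩⟩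
  rw [eLpNorm_const_smul, mul_comm _ ε, ENNReal.ofReal_mul h0.le, ENNReal.ofReal_mul hC0,
    ENNReal.ofReal_toReal h2.2.ne, Real.enorm_of_nonneg h0.le]
  gcongr
  exact hC ε h0 g hg.aestronglyMeasurable

theorem vanishesLinearly_sub {g : Vec d → Vec d} (hg : ContDiff ℝ ∞ g)
    (hgc : HasCompactSupport g) (hgΩ : tsupport g ⊆ (Ω : Set (Vec d))) :
    VanishesLinearly Ω fun ε => fieldAvg Ω D.h D.η ε g - g := by
  have hlip : ∀ {f : Vec d → Vec d}, ContDiff ℝ ∞ f → HasCompactSupport f →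
      ∃ L, ∀ x y, ‖f x - f y‖ ≤ L * ‖x - y‖ := by
    intro f hf hfc
    obtain ⟨L, hL⟩ := (hfc.fderiv (𝕜 := ℝ)).exists_bound_of_continuous
      (hf.continuous_fderiv (by simp))
    exact ⟨L, fun x y => convex_univ.norm_image_sub_le_of_norm_fderiv_le (𝕜 := ℝ)
      (fun z _ => hf.differentiable (by simp) z) (fun z _ => hL z) (mem_univ y) (mem_univ x)⟩
  obtain ⟨L, hL⟩ := hlip D.contDiff_h D.hasCompactSupport_h
  obtain ⟨L', hL'⟩ := hlip hg hgc
  obtain ⟨H, hH0, hH⟩ := D.exists_bound_h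
  obtain ⟨C, hC0, hC⟩ := exists_norm_fieldAvg_sub_le D.continuous_h hH hL D.isProfile
    D.integral_eq_one hg.continuous hgc hgΩ hL'
  have hfin : IsFiniteMeasure (volume.restrict (Ω : Set (Vec d))) :=
    isFiniteMeasure_restrict.2 D.isBounded.measure_lt_top.ne
  have hi := memLp_one_iff_integrable.1
    (memLp_of_continuous_of_isBounded D.isBounded hg.continuous 1)
  set V := (volume.restrict (Ω : Set (Vec d)) univ) ^ ((2 : ℝ≥0∞).toReal⁻¹) with hV
  have hVtop : V ≠ ⊤ := ENNReal.rpow_ne_top_of_nonneg (by norm_num) (measure_ne_top _ _)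
  refine ⟨V.toReal * C, by positivity, fun ε h0 h1 => ⟨((D.continuous_fieldAvg D.isProfile h0
    hi).sub hg.continuous).aestronglyMeasurable, ?_⟩⟩
  refine (eLpNorm_le_of_ae_bound (C := C * ε)
    (Filter.Eventually.of_forall fun y => hC ε h0 y)).trans ?_
  rw [← hV, mul_assoc, ENNReal.ofReal_mul ENNReal.toReal_nonneg, ENNReal.ofReal_toReal hVtop]

/-- The profile `∂ₑ η` has mean zero, so no limit survives. Quantitatively, `fieldAvg_fderiv_eq`
multiplied by `ε` writes the average as `ε` times averages of continuous fields. -/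
theorem vanishesLinearly_fderiv (e : Vec d) {g : Vec d → Vec d} (hg : ContDiff ℝ ∞ g)
    (hgc : HasCompactSupport g) (hgΩ : tsupport g ⊆ (Ω : Set (Vec d))) :
    VanishesLinearly Ω fun ε => fieldAvg Ω D.h (fun z => fderiv ℝ D.η z e) ε g := by
  have hg' : Continuous (fderiv ℝ g) := hg.continuous_fderiv (by simp)
  have hh' := D.continuous_fderiv_h
  have hg0 := hg.continuous
  have h1 := D.vanishesLinearly_smul D.isProfile (g := fun x => fderiv ℝ g x e) (by fun_prop)
  have h2 := fun m : Fin d => D.vanishesLinearly_smul (D.isProfile.fderiv_apply (unitVec m))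
    (g := fun x => (fderiv ℝ D.h x e m) • g x) (by fun_prop)
  refine (h1.sub (VanishesLinearly.sum (s := Finset.univ) fun m _ => h2 m)).congr
    fun ε h0 => ?_
  ext1 y
  have := fieldAvg_fderiv_eq (ε := ε) D.contDiff_h D.isProfile hg hgc hgΩ y e
  rw [inv_smul_eq_iff₀ h0.ne'] at this
  rw [this, smul_sub, Finset.smul_sum]
  simp

/-- In `fderiv_mollify_test_apply` the average of `Dφ` tends to `Dφ`, while the terms with profile
`∂η` vanish linearly by `vanishesLinearly_fderiv`. Each contribution to the `H¹` error is thus of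
order `ε`, with a constant depending on `φ`. -/
theorem exists_norm_testPair_mollify_sub_le (φ : TestField Ω) : ∃ C : ℝ, 0 ≤ C ∧
    ∀ (ε : ℝ) (h0 : 0 < ε) (h1 : ε ≤ D.ε₀),
      ‖testPair (D.mollify h0 h1 (testL2 φ)) - testPair φ‖ ≤ C * ε := by
  have hφc : Continuous (fderiv ℝ φ) := φ.contDiff.continuous_fderiv (by simp)
  have hφ1 : ContDiff ℝ ∞ (fderiv ℝ φ) := φ.contDiff.fderiv_right (m := ∞) le_rfl
  have hφ0 := φ.contDiff
  have hh1 : ContDiff ℝ ∞ (fderiv ℝ D.h) := D.contDiff_h.fderiv_right (m := ∞) le_rfl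
  have hhc := D.continuous_fderiv_h
  have hts : ∀ {g : Vec d → Vec d}, (∀ x, φ x = 0 → g x = 0) →
      HasCompactSupport g ∧ tsupport g ⊆ (Ω : Set (Vec d)) := by
    intro g hg
    have h1 : Function.support g ⊆ Function.support φ := fun x hx h => hx (hg x h)
    exact ⟨φ.hasCompactSupport.mono h1, (closure_mono h1).trans φ.tsupport_subset⟩
  obtain ⟨C₀, hC₀0, hC₀⟩ := (D.vanishesLinearly_sub hφ0 φ.hasCompactSupport
    φ.tsupport_subset).add (D.vanishesLinearly_smul D.isProfile
      (g := fun x => fderiv ℝ D.h x (φ x)) (by fun_prop))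
  have hD : ∀ k : Fin d, VanishesLinearly Ω fun ε =>
      fieldAvg Ω D.h D.η ε (fun x => fderiv ℝ φ x (unitVec k)) -
        (fun x => fderiv ℝ φ x (unitVec k)) -
          ∑ m, fieldAvg Ω D.h (fun z => fderiv ℝ D.η z (unitVec m)) ε
            (fun x => (fderiv ℝ D.h x (unitVec k) m) • φ x) +
          fieldAvg Ω D.h (fun z => fderiv ℝ D.η z (unitVec k)) ε
            (fun x => fderiv ℝ D.h x (φ x)) := by
    intro k
    refine ((D.vanishesLinearly_sub (by fun_prop) (φ.hasCompactSupport.fderiv_apply (𝕜 := ℝ) _)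
      ?_).sub (VanishesLinearly.sum fun m _ => D.vanishesLinearly_fderiv (unitVec m) (by fun_prop)
        ?_ ?_)).add (D.vanishesLinearly_fderiv (unitVec k) (by fun_prop) ?_ ?_)
    · exact (tsupport_fderiv_apply_subset ℝ _).trans φ.tsupport_subset
    · exact (hts fun x hx => by simp [hx]).1
    · exact (hts fun x hx => by simp [hx]).2
    · exact (hts fun x hx => by simp [hx]).1
    · exact (hts fun x hx => by simp [hx]).2
  choose C₁ hC₁0 hC₁ using hD
  refine ⟨C₀ + ∑ k, C₁ k, add_nonneg hC₀0 (Finset.sum_nonneg fun k _ => hC₁0 k),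
    fun ε h0 h1 => ?_⟩
  have hε1 := h1.trans D.le_one
  have hsub : testPair (D.mollify h0 h1 (testL2 φ)) - testPair φ =
      testPair (D.mollify h0 h1 (testL2 φ) - φ) :=
    (map_sub (testPairHom Ω) (D.mollify h0 h1 (testL2 φ)) φ).symm
  have hae : testL2 φ =ᵐ[volume.restrict (Ω : Set (Vec d))] φ :=
    (memLp_testField φ).coeFn_toLp
  have hae' : (fun x => fderiv ℝ D.h x (testL2 φ x)) =ᵐ[volume.restrict (Ω : Set (Vec d))]
      fun x => fderiv ℝ D.h x (φ x) := by
    filter_upwards [hae] with x hx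
    rw [hx]
  have hpos : 0 ≤ C₀ + ∑ k, C₁ k := add_nonneg hC₀0 (Finset.sum_nonneg fun k _ => hC₁0 k)
  rw [hsub, ← ENNReal.ofReal_le_ofReal_iff (by positivity)]
  refine (ofReal_norm_testPair_le _).trans ?_
  rw [add_mul, Finset.sum_mul, ENNReal.ofReal_add (by positivity)
    (Finset.sum_nonneg fun k _ => mul_nonneg (hC₁0 k) h0.le),
    ENNReal.ofReal_sum_of_nonneg fun k _ => mul_nonneg (hC₁0 k) h0.le]
  gcongr with k
  · refine le_trans (le_of_eq ?_) (hC₀ ε h0 hε1).2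
    congr 1
    ext1 y
    change D.mollify h0 h1 (testL2 φ) y - φ y = _
    rw [D.mollify_apply h0 h1 (testL2 φ) y, fieldAvg_congr_ae hae, fieldAvg_congr_ae hae']
    simp only [Pi.add_apply, Pi.sub_apply, Pi.smul_apply]
    abel
  · refine le_trans (le_of_eq ?_) (hC₁ k ε h0 hε1).2
    congr 1
    ext1 y
    have : fderiv ℝ (D.mollify h0 h1 (testL2 φ) - φ : TestField Ω) y =
        fderiv ℝ (D.mollify h0 h1 (testL2 φ)) y - fderiv ℝ φ y :=
      fderiv_sub ((D.mollify h0 h1 (testL2 φ)).contDiff.differentiable (by simp) y)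
        (hφ0.differentiable (by simp) y)
    rw [this, sub_apply, D.fderiv_mollify_test_apply h0 h1 φ y (unitVec k)]
    simp only [Pi.add_apply, Pi.sub_apply, Finset.sum_apply]
    abel

end MollifierData

/-- A sequence of linear operators that approximates fields in `H¹_{0,σ}` by solenoidal test fields
and is bounded in `H¹` and in all Lebesgue spaces. -/
structure SolenoidalMollifier (Ω : Opens (Vec d)) where
  /-- the operators -/
  op : ℕ → L2 Ω (Vec d) →ₗ[ℝ] TestField Ω
  /-- the bound -/
  C : ℝ
  nonneg : 0 ≤ C
  isSolenoidal : ∀ n, ∀ w ∈ L2sol Ω, IsSolenoidal (op n w)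
  exists_norm_le : ∀ n, ∃ B : ℝ, 0 ≤ B ∧ ∀ w x, ‖op n w x‖ ≤ B * ‖w‖
  eLpNorm_le : ∀ n (w : L2 Ω (Vec d)) (p : ℝ≥0∞), 1 ≤ p →
    eLpNorm (op n w) p (volume.restrict (Ω : Set (Vec d))) ≤
      ENNReal.ofReal C * eLpNorm w p (volume.restrict (Ω : Set (Vec d)))
  norm_testPair_le : ∀ n (u : H10sol Ω), ‖testPair (op n (val u))‖ ≤ C * ‖u‖
  tendsto : ∀ u : H10sol Ω,
    Filter.Tendsto (fun n => testPair (op n (val u))) Filter.atTop (𝓝 (u : GradPair Ω))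

/-- In a Lipschitz domain, the fields in `H¹_{0,σ}` can be approximated by solenoidal test fields,
simultaneously in all Lebesgue spaces. -/
theorem IsLipschitzDomain.nonempty_solenoidalMollifier (hΩ : IsLipschitzDomain Ω) :
    Nonempty (SolenoidalMollifier Ω) := by
  obtain ⟨D⟩ := hΩ.nonempty_mollifierData
  obtain ⟨C₁, hC₁0, hC₁⟩ := D.exists_eLpNorm_mollify_le
  obtain ⟨C₂, hC₂0, hC₂⟩ := D.exists_norm_testPair_mollify_test_le
  set e : ℕ → ℝ := fun n => D.ε₀ / (n + 1) with he
  have hDp := D.pos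
  have h0 : ∀ n, 0 < e n := fun n => by positivity
  have h1 : ∀ n, e n ≤ D.ε₀ := fun n =>
    div_le_self D.pos.le (by linarith [Nat.cast_nonneg (α := ℝ) n])
  have hlim : Filter.Tendsto e Filter.atTop (𝓝 0) := by
    have := (tendsto_one_div_add_atTop_nhds_zero_nat (𝕜 := ℝ)).const_mul D.ε₀
    simpa [he, div_eq_mul_inv] using this
  set S : ℕ → L2 Ω (Vec d) →ₗ[ℝ] TestField Ω := fun n => D.mollify (h0 n) (h1 n) with hS
  -- The uniform bound is known for test fields. For fixed `n` the operator is continuous from `L²`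
  -- to `H¹`, so both sides pass to the limit along test fields converging to `u` in `H¹`.
  have hbd : ∀ n (u : H10sol Ω), ‖testPair (S n (val u))‖ ≤ C₂ * ‖u‖ := by
    intro n u
    obtain ⟨B, hB0, hB⟩ := D.exists_norm_testPair_mollify_le_of_L2 (h0 n) (h1 n)
    let A : L2 Ω (Vec d) →L[ℝ] GradPair Ω :=
      ((testPairHom Ω).comp (S n)).mkContinuous B hB
    obtain ⟨φ, hφ, hφlim⟩ := exists_seq_tendsto_of_mem_H10sol u.2
    have hv : Filter.Tendsto (fun k => testL2 (φ k)) Filter.atTop (𝓝 (val u)) :=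
      ((WithLp.fstL 2 ℝ (L2 Ω (Vec d)) (L2 Ω (Mat d))).continuous.tendsto _).comp hφlim
    refine le_of_tendsto_of_tendsto' ((A.continuous.tendsto _).comp hv).norm
      (hφlim.norm.const_mul C₂) fun k => ?_
    exact hC₂ _ (h0 n) (h1 n) (φ k)
  refine ⟨⟨S, max C₁ C₂, hC₁0.trans (le_max_left _ _),
    fun n w hw => D.isSolenoidal_mollify (h0 n) (h1 n) hw,
    fun n => D.exists_norm_mollify_le (h0 n) (h1 n),
    fun n w p hp => (hC₁ _ (h0 n) (h1 n) w p hp).trans ?_,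
    fun n u => (hbd n u).trans ?_, fun u => ?_⟩⟩
  · gcongr
    exact le_max_left _ _
  · gcongr
    exact le_max_right _ _
  · rw [Metric.tendsto_atTop]
    intro δ hδ
    obtain ⟨φ, hφ, hφlim⟩ := exists_seq_tendsto_of_mem_H10sol u.2
    -- The error `u - ψ` enters once directly and once through the operator of norm at most `C₂`;
    -- together they must stay below `δ / 2`.
    obtain ⟨k, hk⟩ := ((Metric.tendsto_atTop.1 hφlim) (δ / (2 * (C₂ + 1))) (by positivity))
    have hk := hk k le_rfl
    set ψ := testSol (φ k) (hφ k) with hψ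
    have hψu : ‖u - ψ‖ < δ / (2 * (C₂ + 1)) := by
      rw [dist_comm, dist_eq_norm] at hk
      exact hk
    obtain ⟨C, hC0, hC⟩ := D.exists_norm_testPair_mollify_sub_le (φ k)
    have hlim2 : Filter.Tendsto (fun n => C * e n) Filter.atTop (𝓝 0) := by
      simpa using hlim.const_mul C
    obtain ⟨N, hN⟩ := Filter.eventually_atTop.1
      (hlim2.eventually (gt_mem_nhds (show (0 : ℝ) < δ / 2 by positivity)))
    refine ⟨N, fun n hn => ?_⟩
    have e1 : testPair (S n (val u)) - (u : GradPair Ω) =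
        testPair (S n (val (u - ψ))) + (testPair (S n (testL2 (φ k))) - testPair (φ k)) -
          ((u : GradPair Ω) - testPair (φ k)) := by
      have : testPair (S n (val (u - ψ))) =
          testPair (S n (val u)) - testPair (S n (testL2 (φ k))) :=
        map_sub ((testPairHom Ω).comp ((S n).comp (valCLM Ω : H10sol Ω →ₗ[ℝ] L2 Ω (Vec d)))) u ψ
      rw [this]
      abel
    rw [dist_eq_norm, e1]
    have t1 := hbd n (u - ψ)
    have t2 := hC _ (h0 n) (h1 n)
    have t3 := hN n hn
    have t4 : ‖(u : GradPair Ω) - testPair (φ k)‖ = ‖u - ψ‖ := rfl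
    have t5 : (C₂ + 1) * ‖u - ψ‖ < δ / 2 := by
      calc (C₂ + 1) * ‖u - ψ‖ < (C₂ + 1) * (δ / (2 * (C₂ + 1))) := by gcongr
        _ = δ / 2 := by field_simp
    calc _ ≤ ‖testPair (S n (val (u - ψ)))‖ + ‖testPair (S n (testL2 (φ k))) - testPair (φ k)‖ +
          ‖(u : GradPair Ω) - testPair (φ k)‖ :=
        (norm_sub_le _ _).trans (add_le_add_left (norm_add_le _ _) _)
      _ ≤ C₂ * ‖u - ψ‖ + C * e n + ‖u - ψ‖ := by rw [t4]; gcongr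
      _ < δ := by linarith

/-! ### The Gagliardo-Nirenberg inequality -/

theorem eLpNorm_two_sq {α F : Type*} [MeasurableSpace α] [NormedAddCommGroup F] (μ : Measure α)
    (f : α → F) : eLpNorm f 2 μ ^ 2 = ∫⁻ x, ‖f x‖ₑ ^ 2 ∂μ := by
  rw [eLpNorm_eq_lintegral_rpow_enorm_toReal (by norm_num) (by norm_num),
    ← ENNReal.rpow_mul_natCast]
  simp

theorem lintegral_mul_sq_le {α : Type*} [MeasurableSpace α] {μ : Measure α} {f g : α → ℝ≥0∞}
    (hf : AEMeasurable f μ) (hg : AEMeasurable g μ) :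
    (∫⁻ x, f x * g x ∂μ) ^ 2 ≤ (∫⁻ x, f x ^ 2 ∂μ) * ∫⁻ x, g x ^ 2 ∂μ := by
  have h := ENNReal.lintegral_mul_le_Lp_mul_Lq μ Real.HolderConjugate.two_two hf hg
  simp only [Pi.mul_apply, ENNReal.rpow_two] at h
  calc (∫⁻ x, f x * g x ∂μ) ^ 2
      ≤ ((∫⁻ x, f x ^ 2 ∂μ) ^ (1 / 2 : ℝ) * (∫⁻ x, g x ^ 2 ∂μ) ^ (1 / 2 : ℝ)) ^ 2 := by gcongr
    _ = _ := by
      rw [mul_pow, ← ENNReal.rpow_mul_natCast, ← ENNReal.rpow_mul_natCast]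
      norm_num

/-- In the plane the Sobolev inequality with exponent one, applied to `|u|^(k+2)`, bounds `∫
|u|^(2(k+2))` by a multiple of `(∫ |u|^(k+1) |∇u|)²`. The Cauchy-Schwarz inequality splits off `∫
|∇u|²` and leaves the previous power. This replaces the Sobolev exponent `2d/(d-2)`, which is
infinite for `d = 2`. -/
theorem exists_lintegral_pow_le_of_finrank_two (hd : d = 2) (k : ℕ) :
    ∃ C : NNReal, ∀ u : Vec d → Vec d, ContDiff ℝ 1 u → HasCompactSupport u →
      ∫⁻ x, ‖u x‖ₑ ^ (2 * (k + 1)) ≤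
        C * (∫⁻ x, ‖u x‖ₑ ^ 2) * (∫⁻ x, ‖fderiv ℝ u x‖ₑ ^ 2) ^ k := by
  induction k with
  | zero => exact ⟨1, fun u _ _ => by simp⟩
  | succ k ih =>
    obtain ⟨C, hC⟩ := ih
    have hconj : Real.HolderConjugate (Module.finrank ℝ (Vec d)) 2 := by
      rw [finrank_euclideanSpace_fin, hd]
      exact_mod_cast Real.HolderConjugate.two_two
    set C₀ := lintegralPowLePowLIntegralFDerivConst (volume : Measure (Vec d)) 2
    refine ⟨C₀ * (k + 2) ^ 2 * C, fun u hu hs => ?_⟩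
    have hγ : (1 : NNReal) < (k + 2 : ℕ) := by
      norm_cast
      omega
    have hγ' : (1 : ℝ) < (k + 2 : ℕ) := by exact_mod_cast hγ
    have hv : ContDiff ℝ 1 fun x => ‖u x‖ ^ ((k + 2 : ℕ) : ℝ) := hu.norm_rpow hγ'
    have hvs : HasCompactSupport fun x => ‖u x‖ ^ ((k + 2 : ℕ) : ℝ) :=
      hs.norm.rpow_const (by positivity)
    have h1 := lintegral_pow_le_pow_lintegral_fderiv volume hv hvs hconj
    have h2 : ∀ x, ‖fderiv ℝ (fun x => ‖u x‖ ^ ((k + 2 : ℕ) : ℝ)) x‖ₑ ≤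
        (k + 2 : ℕ) * (‖u x‖ₑ ^ (k + 1) * ‖fderiv ℝ u x‖ₑ) := by
      intro x
      have h := enorm_fderiv_norm_rpow_le (hu.differentiable one_ne_zero) hγ (x := x)
      have e : (((k + 2 : ℕ) : NNReal) : ℝ) - 1 = ((k + 1 : ℕ) : ℝ) := by push_cast; ring
      rw [e, ENNReal.rpow_natCast, mul_assoc] at h
      simpa only [NNReal.coe_natCast, ENNReal.coe_natCast] using h
    have hmu : Measurable fun x => ‖u x‖ₑ := hu.continuous.measurable.enorm
    have hmd : Measurable fun x => ‖fderiv ℝ u x‖ₑ :=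
      (hu.continuous_fderiv one_ne_zero).measurable.enorm
    calc ∫⁻ x, ‖u x‖ₑ ^ (2 * (k + 1 + 1))
        = ∫⁻ x, ‖‖u x‖ ^ ((k + 2 : ℕ) : ℝ)‖ₑ ^ (2 : ℝ) := by
          refine lintegral_congr fun x => ?_
          rw [Real.rpow_natCast, enorm_pow, enorm_norm, ENNReal.rpow_two, ← pow_mul]
          congr 1
          ring
      _ ≤ C₀ * (∫⁻ x, (k + 2 : ℕ) * (‖u x‖ₑ ^ (k + 1) * ‖fderiv ℝ u x‖ₑ)) ^ (2 : ℝ) := by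
          refine h1.trans ?_
          gcongr with x
          exact h2 x
      _ = C₀ * (k + 2) ^ 2 * (∫⁻ x, ‖u x‖ₑ ^ (k + 1) * ‖fderiv ℝ u x‖ₑ) ^ 2 := by
          rw [lintegral_const_mul _ (by fun_prop), ENNReal.rpow_two, mul_pow]
          push_cast
          ring
      _ ≤ C₀ * (k + 2) ^ 2 * ((∫⁻ x, ‖u x‖ₑ ^ (2 * (k + 1))) * ∫⁻ x, ‖fderiv ℝ u x‖ₑ ^ 2) := by
          gcongr
          refine (lintegral_mul_sq_le (hmu.pow_const _).aemeasurable hmd.aemeasurable).trans_eq ?_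
          simp_rw [← pow_mul, mul_comm (k + 1) 2]
      _ ≤ C₀ * (k + 2) ^ 2 * ((C * (∫⁻ x, ‖u x‖ₑ ^ 2) * (∫⁻ x, ‖fderiv ℝ u x‖ₑ ^ 2) ^ k) *
            ∫⁻ x, ‖fderiv ℝ u x‖ₑ ^ 2) := by
          gcongr
          exact hC u hu hs
      _ = _ := by
          push_cast
          ring

/-- Weights for the Hölder inequality: the product of a power of the `L²` norm and a power of an
`L^Q` norm of `u` is controlled by `‖u‖₂` and `‖∇u‖₂`. -/
theorem exists_weights_gagliardoNirenberg (hd : 2 ≤ d) {R : ℝ} (hR : d < R) :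
    ∃ (a b Q : ℝ) (C : NNReal), 0 ≤ a ∧ 0 ≤ b ∧ a + b + 2 / R = 1 ∧ 2 * a + Q * b = 2 ∧ 0 ≤ Q ∧
      ∀ u : Vec d → Vec d, ContDiff ℝ 1 u → HasCompactSupport u →
        (∫⁻ x, ‖u x‖ₑ ^ 2) ^ a * (∫⁻ x, ‖u x‖ₑ ^ Q) ^ b ≤
          C * (∫⁻ x, ‖u x‖ₑ ^ 2) ^ (1 - d / R) * (∫⁻ x, ‖fderiv ℝ u x‖ₑ ^ 2) ^ (d / R) := by
  have hd0 : (2 : ℝ) ≤ d := by exact_mod_cast hd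
  have hR0 : 0 < R := by linarith
  rcases hd.eq_or_lt with hd2 | hd3
  · obtain ⟨k, hk⟩ := exists_nat_gt (2 / (R - 2))
    have hd2' : (d : ℝ) = 2 := by exact_mod_cast hd2.symm
    have hR2 : 0 < R - 2 := by linarith
    have hk0 : (0 : ℝ) < k := lt_trans (by positivity) hk
    obtain ⟨C, hC⟩ := exists_lintegral_pow_le_of_finrank_two hd2.symm k
    set b : ℝ := 2 / (R * k)
    have hb : b * k = 2 / R := by simp only [b]; field_simp
    have hb0 : 0 ≤ b := by positivity
    have hb1 : b ≤ 1 - 2 / R := by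
      rw [div_lt_iff₀ hR2] at hk
      rw [div_le_iff₀ (by positivity)]
      have : (1 - 2 / R) * (R * k) = k * (R - 2) := by field_simp
      linarith
    refine ⟨1 - 2 / R - b, b, (2 * (k + 1) : ℕ), C ^ b, by linarith, hb0, by ring, ?_,
      by positivity, fun u hu hs => ?_⟩
    · push_cast
      linear_combination 2 * hb
    · simp only [ENNReal.rpow_natCast]
      calc _ ≤ (∫⁻ x, ‖u x‖ₑ ^ 2) ^ (1 - 2 / R - b) *
            (C * (∫⁻ x, ‖u x‖ₑ ^ 2) * (∫⁻ x, ‖fderiv ℝ u x‖ₑ ^ 2) ^ k) ^ b := by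
            gcongr
            exact hC u hu hs
        _ = _ := by
            rw [ENNReal.mul_rpow_of_nonneg _ _ hb0, ENNReal.mul_rpow_of_nonneg _ _ hb0,
              ← ENNReal.rpow_natCast_mul, mul_comm (k : ℝ), hb, hd2',
              ENNReal.coe_rpow_of_nonneg _ hb0]
            conv_rhs => rw [show 1 - 2 / R = (1 - 2 / R - b) + b by ring,
              ENNReal.rpow_add_of_nonneg _ _ (by linarith) hb0]
            ring
  · have hd3' : (3 : ℝ) ≤ d := by exact_mod_cast hd3
    have hd2 : (0 : ℝ) < d - 2 := by linarith
    -- The Sobolev exponent of `H¹`; the weight `(d-2)/R` is chosen such that the gradient integral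
    -- gets the power `d/R`.
    set Q : NNReal := 2 * d / (d - 2 : ℝ).toNNReal
    have hQ : (Q : ℝ) = 2 * d / (d - 2) := by
      simp [Q, Real.coe_toNNReal _ hd2.le]
    have hQ0 : 0 < (Q : ℝ) := by rw [hQ]; positivity
    set C := SNormLESNormFDerivOfEqConst (Vec d) (volume : Measure (Vec d)) 2
    have hb0 : 0 ≤ (d - 2) / R := by positivity
    refine ⟨1 - d / R, (d - 2) / R, Q, C ^ ((Q : ℝ) * ((d - 2) / R)), ?_, hb0, by ring, ?_, hQ0.le,
      fun u hu hs => ?_⟩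
    · rw [sub_nonneg, div_le_one hR0]
      exact hR.le
    · rw [hQ]
      field_simp
      ring
    · have h := eLpNorm_le_eLpNorm_fderiv_of_eq (F := Vec d) volume hu hs (p := 2) (p' := Q)
        (by norm_num) (by rw [finrank_euclideanSpace_fin]; omega)
        (by
          rw [hQ, finrank_euclideanSpace_fin]
          push_cast
          field_simp)
      rw [eLpNorm_nnreal_eq_lintegral (by exact_mod_cast hQ0.ne'),
        eLpNorm_nnreal_eq_lintegral (by norm_num)] at h
      have h' := ENNReal.rpow_le_rpow h hQ0.le
      rw [← ENNReal.rpow_mul, one_div, inv_mul_cancel₀ hQ0.ne', ENNReal.rpow_one] at h'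
      calc _ ≤ _ := mul_le_mul_right (ENNReal.rpow_le_rpow h' hb0) _
        _ = _ := by
          rw [← ENNReal.rpow_mul, ENNReal.mul_rpow_of_nonneg _ _ (by positivity),
            ENNReal.coe_rpow_of_nonneg _ (by positivity), ← ENNReal.rpow_mul]
          have e : 1 / ((2 : NNReal) : ℝ) * ((Q : ℝ) * ((d - 2) / R)) = d / R := by
            rw [hQ]
            push_cast
            field_simp
          rw [e]
          simp only [NNReal.coe_ofNat, ENNReal.rpow_two]
          ring

/-- The exponent condition in terms of real numbers. -/
theorem exponents_of_le {s : ℝ} {r : ℝ≥0∞} (hd : 2 ≤ d)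
    (hsr : 2 / ENNReal.ofReal s + (d : ℝ≥0∞) / r ≤ 1) :
    2 ≤ s ∧ r ≠ 0 ∧ 2 / s + d / r.toReal ≤ 1 ∧ (r ≠ ⊤ → d < r.toReal) := by
  -- Division by zero in `ℝ≥0∞` gives `⊤` here, so the hypothesis on the exponents excludes `s ≤ 0`
  -- and `r = 0`.
  have hs : 0 < s := by
    by_contra! h
    rw [ENNReal.ofReal_of_nonpos h, ENNReal.div_zero (by norm_num)] at hsr
    simp at hsr
  have hr : r ≠ 0 := by
    rintro rfl
    rw [ENNReal.div_zero (by norm_cast; omega)] at hsr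
    simp at hsr
  have h := ENNReal.toReal_mono (by simp) hsr
  rw [ENNReal.toReal_add, ENNReal.toReal_div, ENNReal.toReal_div, ENNReal.toReal_ofReal hs.le] at h
  rotate_left
  · exact (ENNReal.div_lt_top (by simp) (by simpa using hs)).ne
  · exact (ENNReal.div_lt_top (by simp) hr).ne
  simp only [ENNReal.toReal_ofNat, ENNReal.toReal_natCast, ENNReal.toReal_one] at h
  have h1 : 0 < 2 / s := by positivity
  have h2 : 0 ≤ d / r.toReal := by positivity
  refine ⟨?_, hr, h, fun hrt => ?_⟩
  · have : 2 / s ≤ 1 := by linarith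
    rwa [div_le_one hs] at this
  · have hr0 : 0 < r.toReal := ENNReal.toReal_pos hr hrt
    have : d / r.toReal < 1 := by linarith
    rwa [div_lt_one hr0] at this

/-- The Poincaré inequality. The exponent `p = 2d/(d+2)` has Sobolev conjugate `2` and satisfies `1
≤ p ≤ 2` because `d ≥ 2`; Hölder's inequality on the bounded support replaces `‖∇u‖_p` by `‖∇u‖₂`.
-/
theorem exists_lintegral_sq_le_fderiv (hd : 2 ≤ d) {S : Set (Vec d)} (hS : Bornology.IsBounded S) :
    ∃ C : NNReal, ∀ u : Vec d → Vec d, ContDiff ℝ 1 u → Function.support u ⊆ S →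
      ∫⁻ x, ‖u x‖ₑ ^ 2 ≤ C * ∫⁻ x, ‖fderiv ℝ u x‖ₑ ^ 2 := by
  have hd0 : (2 : ℝ) ≤ d := by exact_mod_cast hd
  set p : NNReal := 2 * d / (d + 2)
  have hp : (p : ℝ) = 2 * d / (d + 2) := by simp [p]
  have hp1 : 1 ≤ p := by
    rw [← NNReal.coe_le_coe, hp]
    push_cast
    rw [le_div_iff₀ (by positivity)]
    linarith
  have hp2 : p ≤ 2 := by
    rw [← NNReal.coe_le_coe, hp]
    push_cast
    rw [div_le_iff₀ (by positivity)]
    linarith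
  have hpd : p < (Module.finrank ℝ (Vec d) : NNReal) := by
    rw [← NNReal.coe_lt_coe, hp, finrank_euclideanSpace_fin]
    push_cast
    rw [div_lt_iff₀ (by positivity)]
    nlinarith
  set C₁ := eLpNormLESNormFDerivOfLeConst (Vec d) (volume : Measure (Vec d)) S p 2
  set K := closure S
  have hK : IsCompact K := hS.isCompact_closure
  set m : NNReal := (volume K).toNNReal
  have hm : (m : ℝ≥0∞) = volume K := ENNReal.coe_toNNReal hK.measure_lt_top.ne
  have he : 0 ≤ 1 / (p : ℝ) - 1 / 2 := by
    rw [hp]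
    field_simp
    linarith
  refine ⟨(C₁ * m ^ (1 / (p : ℝ) - 1 / 2)) ^ 2, fun u hu hs => ?_⟩
  have h1 := eLpNorm_le_eLpNorm_fderiv_of_le (F := Vec d) volume hu hs hp1 hpd (q := 2)
    (by
      rw [finrank_euclideanSpace_fin, NNReal.coe_inv, hp]
      push_cast
      field_simp
      linarith) hS
  have hsub : Function.support (fderiv ℝ u) ⊆ K :=
    (support_fderiv_subset ℝ).trans (closure_mono hs)
  have h2 : eLpNorm (fderiv ℝ u) p volume ≤
      eLpNorm (fderiv ℝ u) 2 volume * (m : ℝ≥0∞) ^ (1 / (p : ℝ) - 1 / 2) := by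
    have hr : ∀ q : ℝ≥0∞, eLpNorm (fderiv ℝ u) q (volume.restrict K) =
        eLpNorm (fderiv ℝ u) q volume :=
      fun q => by
        rw [← eLpNorm_norm (fderiv ℝ u), ← eLpNorm_norm (fderiv ℝ u)]
        refine eLpNorm_restrict_eq_of_support_subset fun x hx => hsub ?_
        simpa using hx
    rw [← hr, ← hr]
    refine (eLpNorm_le_eLpNorm_mul_rpow_measure_univ (q := 2) (by exact_mod_cast hp2)
      (hu.continuous_fderiv one_ne_zero).aestronglyMeasurable).trans_eq ?_
    simp only [Measure.restrict_apply_univ, hm, ENNReal.coe_toReal, ENNReal.toReal_ofNat]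
  rw [← eLpNorm_two_sq, ← eLpNorm_two_sq]
  calc eLpNorm u 2 volume ^ 2
      ≤ (C₁ * (eLpNorm (fderiv ℝ u) 2 volume * (m : ℝ≥0∞) ^ (1 / (p : ℝ) - 1 / 2))) ^ 2 := by
        gcongr
        refine le_trans ?_ (mul_le_mul_right h2 _)
        exact_mod_cast h1
    _ = _ := by
        push_cast
        rw [← ENNReal.coe_rpow_of_nonneg _ he]
        ring

/-- Hölder's inequality with three factors: `|u|²|w|²` is the product of `(|u|²)^a`, `(|u|^Q)^b` and
`(|w|^R)^(2/R)`, with the weights from `exists_weights_gagliardoNirenberg`. -/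
theorem exists_lintegral_mul_sq_le_rpow (hd : 2 ≤ d) {r : ℝ≥0∞} (hr0 : r ≠ 0)
    (hr : r ≠ ⊤ → d < r.toReal) (Ω : Opens (Vec d)) :
    ∃ C : NNReal, ∀ u : Vec d → Vec d, ContDiff ℝ 1 u → HasCompactSupport u →
      ∀ w : Vec d → Vec d, AEStronglyMeasurable w (volume.restrict (Ω : Set (Vec d))) →
        ∫⁻ x in (Ω : Set (Vec d)), (‖u x‖ₑ * ‖w x‖ₑ) ^ 2 ≤
          C * (∫⁻ x, ‖u x‖ₑ ^ 2) ^ (1 - d / r.toReal) *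
            (∫⁻ x, ‖fderiv ℝ u x‖ₑ ^ 2) ^ (d / r.toReal) *
            eLpNorm w r (volume.restrict (Ω : Set (Vec d))) ^ 2 := by
  by_cases hrt : r = ⊤
  · refine ⟨1, fun u hu _ w hw => ?_⟩
    subst hrt
    -- For `r = ∞` the conventions `toReal ⊤ = 0` and `d / 0 = 0` give the exponents `1` and `0`, as
    -- they should be.
    simp only [ENNReal.toReal_top, div_zero, sub_zero, ENNReal.rpow_one, ENNReal.rpow_zero,
      ENNReal.coe_one, one_mul, mul_one]
    rw [← lintegral_mul_const _ (by have := hu.continuous; fun_prop)]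
    refine le_trans ?_ (lintegral_mono' (Measure.restrict_le_self (s := (Ω : Set (Vec d)))) le_rfl)
    refine lintegral_mono_ae ?_
    filter_upwards [enorm_ae_le_eLpNormEssSup w (volume.restrict (Ω : Set (Vec d)))] with x hx
    rw [mul_pow, eLpNorm_exponent_top]
    gcongr
  · have hR := hr hrt
    set R := r.toReal
    have hR0 : 0 < R := ENNReal.toReal_pos hr0 hrt
    obtain ⟨a, b, Q, C, ha, hb, hab, haQ, hQ, hC⟩ := exists_weights_gagliardoNirenberg hd hR
    refine ⟨C, fun u hu hs w hw => ?_⟩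
    set μ := volume.restrict (Ω : Set (Vec d))
    have hmu : Measurable fun x => ‖u x‖ₑ := hu.continuous.measurable.enorm
    have h := ENNReal.lintegral_prod_norm_pow_le (μ := μ) (Finset.univ : Finset (Fin 3))
      (f := ![fun x => ‖u x‖ₑ ^ 2, fun x => ‖u x‖ₑ ^ Q, fun x => ‖w x‖ₑ ^ R])
      (p := ![a, b, 2 / R]) (by
        intro i _
        fin_cases i
        · exact (hmu.pow_const _).aemeasurable
        · exact (hmu.pow_const _).aemeasurable
        · exact hw.enorm.pow_const _) (by simpa [Fin.sum_univ_three] using hab) (by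
        intro i _
        fin_cases i
        · exact ha
        · exact hb
        · exact (by positivity : 0 ≤ 2 / R))
    simp only [Fin.prod_univ_three, Matrix.cons_val_zero, Matrix.cons_val_one,
      Matrix.cons_val] at h
    have hw2 : (∫⁻ x, ‖w x‖ₑ ^ R ∂μ) ^ (2 / R) = eLpNorm w r μ ^ 2 := by
      rw [eLpNorm_eq_lintegral_rpow_enorm_toReal hr0 hrt, ← ENNReal.rpow_mul_natCast]
      congr 1
      push_cast
      ring
    calc ∫⁻ x, (‖u x‖ₑ * ‖w x‖ₑ) ^ 2 ∂μ
        = ∫⁻ x, (‖u x‖ₑ ^ 2) ^ a * (‖u x‖ₑ ^ Q) ^ b * (‖w x‖ₑ ^ R) ^ (2 / R) ∂μ := by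
          refine lintegral_congr fun x => ?_
          rw [← ENNReal.rpow_natCast_mul, ← ENNReal.rpow_mul, ← ENNReal.rpow_mul,
            ← ENNReal.rpow_add_of_nonneg _ _ (by positivity) (by positivity), mul_pow,
            mul_div_cancel₀ _ hR0.ne', Nat.cast_ofNat, haQ, ENNReal.rpow_two, ENNReal.rpow_two]
      _ ≤ _ := h
      _ ≤ (∫⁻ x, ‖u x‖ₑ ^ 2) ^ a * (∫⁻ x, ‖u x‖ₑ ^ Q) ^ b * (∫⁻ x, ‖w x‖ₑ ^ R ∂μ) ^ (2 / R) := by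
          gcongr <;> exact Measure.restrict_le_self
      _ ≤ _ := by
          rw [hw2]
          exact mul_le_mul_left (hC u hu hs) _

/-- If `2/s + d/r < 1`, the scaling of the Gagliardo-Nirenberg inequality leaves an excess power `ρ
= 1 - d/r - 2/s` of `∫ |u|²`. The Poincaré inequality converts it into the same power of `∫ |∇u|²`,
so that the exponents are always `2/s` and `1 - 2/s`. -/
theorem exists_lintegral_mul_sq_le (hd : 2 ≤ d) {s : ℝ} {r : ℝ≥0∞}
    (hsr : 2 / ENNReal.ofReal s + (d : ℝ≥0∞) / r ≤ 1)
    (hb : Bornology.IsBounded (Ω : Set (Vec d))) :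
    ∃ C : NNReal, ∀ u : Vec d → Vec d, ContDiff ℝ 1 u → HasCompactSupport u →
      Function.support u ⊆ Ω → ∀ w : Vec d → Vec d,
        AEStronglyMeasurable w (volume.restrict (Ω : Set (Vec d))) →
        ∫⁻ x in (Ω : Set (Vec d)), (‖u x‖ₑ * ‖w x‖ₑ) ^ 2 ≤
          (∫⁻ x, ‖u x‖ₑ ^ 2) ^ (2 / s) * (∫⁻ x, ‖fderiv ℝ u x‖ₑ ^ 2) ^ (1 - 2 / s) *
            (C * eLpNorm w r (volume.restrict (Ω : Set (Vec d))) ^ 2) := by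
  obtain ⟨hs2, hr0, hle, hr⟩ := exponents_of_le hd hsr
  obtain ⟨C₁, hC₁⟩ := exists_lintegral_mul_sq_le_rpow hd hr0 hr Ω
  obtain ⟨C₂, hC₂⟩ := exists_lintegral_sq_le_fderiv hd hb
  set α := d / r.toReal
  set σ := 2 / s
  have hα : 0 ≤ α := by positivity
  have hσ : 0 ≤ σ := by positivity
  have hρ : 0 ≤ 1 - α - σ := by linarith
  obtain ⟨ρ, hρe⟩ : ∃ ρ, ρ = 1 - α - σ := ⟨_, rfl⟩
  rw [← hρe] at hρ
  refine ⟨C₁ * C₂ ^ ρ, fun u hu hs hsub w hw => ?_⟩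
  refine (hC₁ u hu hs w hw).trans ?_
  rw [show 1 - α = σ + ρ by linarith, ENNReal.rpow_add_of_nonneg _ _ hσ hρ]
  calc _ ≤ C₁ * ((∫⁻ x, ‖u x‖ₑ ^ 2) ^ σ *
        (C₂ * ∫⁻ x, ‖fderiv ℝ u x‖ₑ ^ 2) ^ ρ) *
        (∫⁻ x, ‖fderiv ℝ u x‖ₑ ^ 2) ^ α * _ := by
        gcongr
        exact hC₂ u hu hsub
    _ = _ := by
        rw [ENNReal.mul_rpow_of_nonneg _ _ hρ]
        conv_rhs => rw [show 1 - σ = ρ + α by linarith, ENNReal.rpow_add_of_nonneg _ _ hρ hα]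
        push_cast
        rw [← ENNReal.coe_rpow_of_nonneg _ hρ]
        ring

theorem norm_fderiv_le_norm_gradField (u : Vec d → Vec d) (x : Vec d) :
    ‖fderiv ℝ u x‖ ≤ ‖gradField u x‖ := by
  refine ContinuousLinearMap.opNorm_le_bound _ (norm_nonneg _) fun e => ?_
  have he : fderiv ℝ u x e = ∑ k, e k • fderiv ℝ u x (unitVec k) := by
    conv_lhs => rw [← (EuclideanSpace.basisFun (Fin d) ℝ).sum_repr e, map_sum]
    simp [EuclideanSpace.basisFun_apply]
  have h1 : ‖fderiv ℝ u x e‖ ≤ ∑ k, ‖e k‖ * ‖fderiv ℝ u x (unitVec k)‖ := by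
    rw [he]
    exact (norm_sum_le _ _).trans_eq (by simp [norm_smul])
  refine h1.trans (le_of_sq_le_sq ?_ (by positivity))
  refine (Finset.sum_mul_sq_le_sq_mul_sq _ _ _).trans_eq ?_
  rw [mul_pow, EuclideanSpace.norm_sq_eq e, EuclideanSpace.norm_sq_eq (gradField u x),
    Fintype.sum_prod_type, mul_comm]
  congr 1
  refine Finset.sum_congr rfl fun k _ => ?_
  rw [EuclideanSpace.norm_sq_eq]
  rfl

theorem ofReal_norm_toLp_sq {F : Type} [NormedAddCommGroup F] {f : Vec d → F}
    (hf : MemLp f 2 (volume.restrict (Ω : Set (Vec d)))) :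
    ENNReal.ofReal (‖hf.toLp f‖ ^ 2) = ∫⁻ x in (Ω : Set (Vec d)), ‖f x‖ₑ ^ 2 := by
  rw [← eLpNorm_two_sq, Lp.norm_toLp, ENNReal.ofReal_pow ENNReal.toReal_nonneg,
    ENNReal.ofReal_toReal hf.eLpNorm_ne_top]

/-- The Gagliardo-Nirenberg estimate of `‖|u| |w|‖₂` for `u ∈ H¹_{0,σ}` and `w ∈ L^r`. -/
theorem exists_lintegral_val_mul_sq_le (hd : 2 ≤ d) {s : ℝ} {r : ℝ≥0∞}
    (hsr : 2 / ENNReal.ofReal s + (d : ℝ≥0∞) / r ≤ 1)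
    (hb : Bornology.IsBounded (Ω : Set (Vec d))) :
    ∃ C : NNReal, ∀ (u : H10sol Ω) (w : Vec d → Vec d),
      AEStronglyMeasurable w (volume.restrict (Ω : Set (Vec d))) →
      eLpNorm w r (volume.restrict (Ω : Set (Vec d))) ≠ ⊤ →
        ∫⁻ x in (Ω : Set (Vec d)), (‖val u x‖ₑ * ‖w x‖ₑ) ^ 2 ≤
          ENNReal.ofReal ((‖val u‖ ^ 2) ^ (2 / s) * (‖grad u‖ ^ 2) ^ (1 - 2 / s)) *
            (C * eLpNorm w r (volume.restrict (Ω : Set (Vec d))) ^ 2) := by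
  obtain ⟨C, hC⟩ := exists_lintegral_mul_sq_le hd hsr hb
  obtain ⟨hs2, -, -, -⟩ := exponents_of_le hd hsr
  refine ⟨C, fun u w hw hwr => ?_⟩
  set μ := volume.restrict (Ω : Set (Vec d))
  have hσ : 0 ≤ 2 / s := by positivity
  have hσ1 : 0 ≤ 1 - 2 / s := by
    rw [sub_nonneg, div_le_one (by linarith)]
    exact hs2
  obtain ⟨φ, -, hφ⟩ := exists_seq_tendsto_of_mem_H10sol u.2
  have hv : Filter.Tendsto (fun n => testL2 (φ n)) Filter.atTop (𝓝 (val u)) :=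
    ((WithLp.fstL 2 ℝ (L2 Ω (Vec d)) (L2 Ω (Mat d))).continuous.tendsto _).comp hφ
  have hg : Filter.Tendsto (fun n => (memLp_gradField (φ n)).toLp (gradField (φ n)))
      Filter.atTop (𝓝 (grad u)) :=
    ((WithLp.sndL 2 ℝ (L2 Ω (Vec d)) (L2 Ω (Mat d))).continuous.tendsto _).comp hφ
  -- The estimate passes from test fields to `u` by Fatou's lemma along an almost everywhere
  -- convergent subsequence; only the right-hand side has to converge.
  obtain ⟨ns, hns, hae⟩ := (tendstoInMeasure_of_tendsto_Lp hv).exists_seq_tendsto_ae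
  have hae2 : ∀ᵐ x ∂μ, Filter.Tendsto (fun n => φ (ns n) x) Filter.atTop (𝓝 (val u x)) := by
    have : ∀ᵐ x ∂μ, ∀ n, testL2 (φ n) x = φ n x :=
      ae_all_iff.2 fun n => (memLp_testField (φ n)).coeFn_toLp
    filter_upwards [hae, this] with x h1 h2
    simpa [h2] using h1
  have hbd : ∀ n, ∫⁻ x, (‖φ n x‖ₑ * ‖w x‖ₑ) ^ 2 ∂μ ≤
      ENNReal.ofReal ((‖testL2 (φ n)‖ ^ 2) ^ (2 / s) *
        (‖(memLp_gradField (φ n)).toLp (gradField (φ n))‖ ^ 2) ^ (1 - 2 / s)) *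
        (C * eLpNorm w r μ ^ 2) := by
    intro n
    have hsub : Function.support (φ n) ⊆ Ω := (subset_tsupport _).trans (φ n).tsupport_subset
    refine (hC (φ n) ((φ n).contDiff.of_le (by simp)) (φ n).hasCompactSupport hsub w hw).trans ?_
    have e1 : ∫⁻ x, ‖φ n x‖ₑ ^ 2 = ENNReal.ofReal (‖testL2 (φ n)‖ ^ 2) := by
      rw [testL2, ofReal_norm_toLp_sq]
      refine (setLIntegral_eq_of_support_subset fun x hx => hsub ?_).symm
      simpa using hx
    have e2 : ∫⁻ x, ‖fderiv ℝ (φ n) x‖ₑ ^ 2 ≤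
        ENNReal.ofReal (‖(memLp_gradField (φ n)).toLp (gradField (φ n))‖ ^ 2) := by
      rw [ofReal_norm_toLp_sq, ← setLIntegral_eq_of_support_subset (s := (Ω : Set (Vec d)))]
      · gcongr with x
        exact enorm_le_iff_norm_le.2 (norm_fderiv_le_norm_gradField _ _)
      · intro x hx
        refine (φ n).tsupport_subset (support_fderiv_subset ℝ ?_)
        contrapose! hx
        have h0 : ‖fderiv ℝ (φ n) x‖ = 0 := by rw [Function.notMem_support.1 hx]; exact norm_zero
        rw [Function.notMem_support, ← ofReal_norm, h0]
        simp
    rw [ENNReal.ofReal_mul (by positivity), ← ENNReal.ofReal_rpow_of_nonneg (by positivity) hσ,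
      ← ENNReal.ofReal_rpow_of_nonneg (by positivity) hσ1, e1]
    gcongr
  have hlim : Filter.Tendsto (fun n => ENNReal.ofReal ((‖testL2 (φ (ns n))‖ ^ 2) ^ (2 / s) *
        (‖(memLp_gradField (φ (ns n))).toLp (gradField (φ (ns n)))‖ ^ 2) ^ (1 - 2 / s)) *
        (C * eLpNorm w r μ ^ 2)) Filter.atTop
      (𝓝 (ENNReal.ofReal ((‖val u‖ ^ 2) ^ (2 / s) * (‖grad u‖ ^ 2) ^ (1 - 2 / s)) *
        (C * eLpNorm w r μ ^ 2))) := by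
    refine ENNReal.Tendsto.mul_const (ENNReal.tendsto_ofReal ?_)
      (Or.inr (ENNReal.mul_ne_top ENNReal.coe_ne_top (ENNReal.pow_ne_top hwr)))
    refine Filter.Tendsto.mul ?_ ?_
    · exact (((hv.comp hns.tendsto_atTop).norm.pow 2)).rpow_const (Or.inr hσ)
    · exact (((hg.comp hns.tendsto_atTop).norm.pow 2)).rpow_const (Or.inr hσ1)
  calc ∫⁻ x, (‖val u x‖ₑ * ‖w x‖ₑ) ^ 2 ∂μ
      ≤ ∫⁻ x, Filter.liminf (fun n => (‖φ (ns n) x‖ₑ * ‖w x‖ₑ) ^ 2) Filter.atTop ∂μ := by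
        refine lintegral_mono_ae ?_
        filter_upwards [hae2] with x hx
        refine le_of_eq (Filter.Tendsto.liminf_eq ?_).symm
        exact ((ENNReal.continuous_pow 2).tendsto _).comp
          (ENNReal.Tendsto.mul_const hx.enorm (Or.inr enorm_ne_top))
    _ ≤ Filter.liminf (fun n => ∫⁻ x, (‖φ (ns n) x‖ₑ * ‖w x‖ₑ) ^ 2 ∂μ) Filter.atTop := by
        refine lintegral_liminf_le' fun n => ?_
        have := (φ (ns n)).continuous
        have h2 : AEMeasurable (fun x => ‖w x‖ₑ) μ := hw.enorm
        fun_prop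
    _ ≤ Filter.liminf (fun n => ENNReal.ofReal ((‖testL2 (φ (ns n))‖ ^ 2) ^ (2 / s) *
        (‖(memLp_gradField (φ (ns n))).toLp (gradField (φ (ns n)))‖ ^ 2) ^ (1 - 2 / s)) *
        (C * eLpNorm w r μ ^ 2)) Filter.atTop :=
        Filter.liminf_le_liminf (Filter.Eventually.of_forall fun n => hbd (ns n))
    _ = _ := hlim.liminf_eq

/-! ### The convective term -/

theorem abs_convIntegrand_le (a : L2 Ω (Vec d)) (G : L2 Ω (Mat d)) (w : L2 Ω (Vec d)) (x : Vec d) :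
    |convIntegrand a G w x| ≤ ‖G x‖ * (‖a x‖ * ‖w x‖) := by
  refine abs_le_of_sq_le_sq ?_ (by positivity)
  rw [mul_pow, mul_pow, EuclideanSpace.norm_sq_eq, EuclideanSpace.norm_sq_eq (a x),
    EuclideanSpace.norm_sq_eq (w x)]
  have h := Finset.sum_mul_sq_le_sq_mul_sq Finset.univ (fun p : Fin d × Fin d => G x p)
    fun p => a x p.1 * w x p.2
  have e1 : convIntegrand a G w x = ∑ p : Fin d × Fin d, G x p * (a x p.1 * w x p.2) := by
    rw [convIntegrand, Fintype.sum_prod_type]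
    exact Finset.sum_congr rfl fun i _ => Finset.sum_congr rfl fun j _ => by ring
  have e2 : ∑ p : Fin d × Fin d, (a x p.1 * w x p.2) ^ 2 =
      (∑ i, ‖a x i‖ ^ 2) * ∑ j, ‖w x j‖ ^ 2 := by
    rw [Finset.sum_mul_sum, Fintype.sum_prod_type]
    simp [mul_pow]
  rw [e1, ← e2]
  simpa using h

theorem aestronglyMeasurable_convIntegrand (a : L2 Ω (Vec d)) (G : L2 Ω (Mat d))
    (w : L2 Ω (Vec d)) :
    AEStronglyMeasurable (convIntegrand a G w) (volume.restrict (Ω : Set (Vec d))) := by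
  have hc : ∀ {ι : Type} [Fintype ι] (f : L2 Ω (EuclideanSpace ℝ ι)) (i : ι),
      AEStronglyMeasurable (fun x => f x i) (volume.restrict (Ω : Set (Vec d))) := fun f i =>
    (EuclideanSpace.proj (𝕜 := ℝ) i).continuous.comp_aestronglyMeasurable
      (Lp.aestronglyMeasurable f)
  unfold convIntegrand
  exact Finset.aestronglyMeasurable_fun_sum _ fun i _ =>
    Finset.aestronglyMeasurable_fun_sum _ fun j _ => ((hc a i).mul (hc G (i, j))).mul (hc w j)

/-- The `L²` norm of `|a| |w|`. -/
def prodNorm (Ω : Opens (Vec d)) (a w : Vec d → Vec d) : ℝ≥0∞ :=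
  eLpNorm (fun x => ‖a x‖ * ‖w x‖) 2 (volume.restrict (Ω : Set (Vec d)))

theorem prodNorm_sq (a w : Vec d → Vec d) :
    prodNorm Ω a w ^ 2 = ∫⁻ x in (Ω : Set (Vec d)), (‖a x‖ₑ * ‖w x‖ₑ) ^ 2 := by
  rw [prodNorm, eLpNorm_two_sq]
  simp

theorem prodNorm_comm (a w : Vec d → Vec d) : prodNorm Ω a w = prodNorm Ω w a := by
  simp_rw [prodNorm, mul_comm]

theorem enorm_L2_eq {F : Type} [NormedAddCommGroup F] (f : L2 Ω F) :
    ‖f‖ₑ = eLpNorm f 2 (volume.restrict (Ω : Set (Vec d))) := Lp.enorm_def f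

theorem lintegral_convIntegrand_le (a : L2 Ω (Vec d)) (G : L2 Ω (Mat d)) (w : L2 Ω (Vec d)) :
    ∫⁻ x in (Ω : Set (Vec d)), ‖convIntegrand a G w x‖ₑ ≤ ‖G‖ₑ * prodNorm Ω a w := by
  have ha := (Lp.aestronglyMeasurable a).enorm
  have hw := (Lp.aestronglyMeasurable w).enorm
  have hG := (Lp.aestronglyMeasurable G).enorm
  rw [← ENNReal.pow_le_pow_left_iff two_ne_zero]
  calc (∫⁻ x in (Ω : Set (Vec d)), ‖convIntegrand a G w x‖ₑ) ^ 2
      ≤ (∫⁻ x in (Ω : Set (Vec d)), ‖G x‖ₑ * (‖a x‖ₑ * ‖w x‖ₑ)) ^ 2 := by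
        gcongr with x
        rw [← enorm_norm (G x), ← enorm_norm (a x), ← enorm_norm (w x), ← enorm_mul, ← enorm_mul]
        refine enorm_le_iff_norm_le.2 ?_
        rw [Real.norm_eq_abs, Real.norm_eq_abs]
        exact (abs_convIntegrand_le a G w x).trans (le_abs_self _)
    _ ≤ _ := lintegral_mul_sq_le hG (ha.mul hw)
    _ = _ := by
        rw [← prodNorm_sq, ← eLpNorm_two_sq, mul_pow, enorm_L2_eq]

theorem integrable_convIntegrand {a w : L2 Ω (Vec d)} (G : L2 Ω (Mat d))
    (h : prodNorm Ω a w ≠ ⊤) :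
    Integrable (convIntegrand a G w) (volume.restrict (Ω : Set (Vec d))) :=
  ⟨aestronglyMeasurable_convIntegrand a G w,
    (lintegral_convIntegrand_le a G w).trans_lt
      (ENNReal.mul_lt_top enorm_lt_top (lt_top_iff_ne_top.2 h))⟩

theorem abs_conv_le {a w : L2 Ω (Vec d)} (G : L2 Ω (Mat d)) (h : prodNorm Ω a w ≠ ⊤) :
    |conv a G w| ≤ ‖G‖ * (prodNorm Ω a w).toReal := by
  have h1 := (enorm_integral_le_lintegral_enorm (convIntegrand a G w)).trans
    (lintegral_convIntegrand_le a G w)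
  have h2 := ENNReal.toReal_mono (ENNReal.mul_ne_top enorm_ne_top h) h1
  rwa [ENNReal.toReal_mul, toReal_enorm, toReal_enorm] at h2

theorem prodNorm_le_of_bound {a : L2 Ω (Vec d)} {w : Vec d → Vec d} {B : ℝ} (hB : 0 ≤ B)
    (h : ∀ᵐ x ∂volume.restrict (Ω : Set (Vec d)), ‖w x‖ ≤ B) :
    prodNorm Ω a w ≤ ENNReal.ofReal (B * ‖a‖) := by
  rw [ENNReal.ofReal_mul hB, ofReal_norm, enorm_L2_eq]
  refine eLpNorm_le_mul_eLpNorm_of_ae_le_mul (p := 2) ?_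
  filter_upwards [h] with x hx
  rw [norm_mul, norm_norm, norm_norm, mul_comm]
  gcongr

theorem conv_add_left {a a' w : L2 Ω (Vec d)} (G : L2 Ω (Mat d)) (h : prodNorm Ω a w ≠ ⊤)
    (h' : prodNorm Ω a' w ≠ ⊤) : conv (a + a') G w = conv a G w + conv a' G w := by
  rw [conv, conv, conv,
    ← integral_add (integrable_convIntegrand G h) (integrable_convIntegrand G h')]
  refine integral_congr_ae ?_
  filter_upwards [Lp.coeFn_add a a'] with x hx
  simp only [convIntegrand, hx, ← Finset.sum_add_distrib, Pi.add_apply, PiLp.add_apply, add_mul]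

theorem conv_add_right {a w w' : L2 Ω (Vec d)} (G : L2 Ω (Mat d)) (h : prodNorm Ω a w ≠ ⊤)
    (h' : prodNorm Ω a w' ≠ ⊤) : conv a G (w + w') = conv a G w + conv a G w' := by
  rw [conv, conv, conv,
    ← integral_add (integrable_convIntegrand G h) (integrable_convIntegrand G h')]
  refine integral_congr_ae ?_
  filter_upwards [Lp.coeFn_add w w'] with x hx
  simp only [convIntegrand, hx, ← Finset.sum_add_distrib, Pi.add_apply, PiLp.add_apply, mul_add]

theorem conv_add_mid {a w : L2 Ω (Vec d)} (G G' : L2 Ω (Mat d)) (h : prodNorm Ω a w ≠ ⊤) :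
    conv a (G + G') w = conv a G w + conv a G' w := by
  rw [conv, conv, conv,
    ← integral_add (integrable_convIntegrand G h) (integrable_convIntegrand G' h)]
  refine integral_congr_ae ?_
  filter_upwards [Lp.coeFn_add G G'] with x hx
  simp only [convIntegrand, hx, ← Finset.sum_add_distrib, Pi.add_apply, PiLp.add_apply, mul_add,
    add_mul]

theorem conv_smul_right (t : ℝ) (a w : L2 Ω (Vec d)) (G : L2 Ω (Mat d)) :
    conv a G (t • w) = t * conv a G w := by
  rw [conv, conv, ← integral_const_mul]
  refine integral_congr_ae ?_
  filter_upwards [Lp.coeFn_smul t w] with x hx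
  simp only [convIntegrand, hx, Finset.mul_sum, Pi.smul_apply, PiLp.smul_apply, smul_eq_mul]
  exact Finset.sum_congr rfl fun i _ => Finset.sum_congr rfl fun j _ => by ring

theorem conv_sub_right {a w w' : L2 Ω (Vec d)} {G : L2 Ω (Mat d)}
    (h : Integrable (convIntegrand a G w) (volume.restrict (Ω : Set (Vec d))))
    (h' : Integrable (convIntegrand a G w') (volume.restrict (Ω : Set (Vec d)))) :
    conv a G (w - w') = conv a G w - conv a G w' := by
  rw [conv, conv, conv, ← integral_sub h h']
  refine integral_congr_ae ?_
  filter_upwards [Lp.coeFn_sub w w'] with x hx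
  simp only [convIntegrand, hx, ← Finset.sum_sub_distrib, Pi.sub_apply, PiLp.sub_apply, mul_sub]

theorem conv_sub_mid {a w : L2 Ω (Vec d)} (G G' : L2 Ω (Mat d)) (h : prodNorm Ω a w ≠ ⊤) :
    conv a (G - G') w = conv a G w - conv a G' w := by
  have := conv_add_mid (G - G') G' h
  rw [sub_add_cancel] at this
  linarith

theorem lintegral_convIntegrand_le_of_bound_mid {a w : L2 Ω (Vec d)} {G : L2 Ω (Mat d)} {B : ℝ}
    (hB : 0 ≤ B) (h : ∀ᵐ x ∂volume.restrict (Ω : Set (Vec d)), ‖G x‖ ≤ B) :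
    ∫⁻ x in (Ω : Set (Vec d)), ‖convIntegrand a G w x‖ₑ ≤ ENNReal.ofReal B * (‖a‖ₑ * ‖w‖ₑ) := by
  have ha := (Lp.aestronglyMeasurable a).enorm
  have hw := (Lp.aestronglyMeasurable w).enorm
  have h0 : (∫⁻ x in (Ω : Set (Vec d)), ‖a x‖ₑ * ‖w x‖ₑ) ≤ ‖a‖ₑ * ‖w‖ₑ := by
    rw [← ENNReal.pow_le_pow_left_iff two_ne_zero, mul_pow, enorm_L2_eq, enorm_L2_eq,
      eLpNorm_two_sq, eLpNorm_two_sq]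
    exact lintegral_mul_sq_le ha hw
  refine le_trans ?_ (mul_le_mul_right h0 _)
  rw [← lintegral_const_mul' _ _ ENNReal.ofReal_ne_top]
  refine lintegral_mono_ae ?_
  filter_upwards [h] with x hx
  rw [← enorm_norm (a x), ← enorm_norm (w x), ← Real.enorm_of_nonneg hB, ← enorm_mul, ← enorm_mul]
  refine enorm_le_iff_norm_le.2 ?_
  rw [Real.norm_eq_abs, Real.norm_eq_abs]
  refine le_trans ((abs_convIntegrand_le a G w x).trans ?_) (le_abs_self _)
  gcongr

theorem integrable_convIntegrand_of_bound_mid (a w : L2 Ω (Vec d)) {G : L2 Ω (Mat d)} {B : ℝ}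
    (hB : 0 ≤ B) (h : ∀ᵐ x ∂volume.restrict (Ω : Set (Vec d)), ‖G x‖ ≤ B) :
    Integrable (convIntegrand a G w) (volume.restrict (Ω : Set (Vec d))) :=
  ⟨aestronglyMeasurable_convIntegrand a G w,
    (lintegral_convIntegrand_le_of_bound_mid hB h).trans_lt (ENNReal.mul_lt_top
      ENNReal.ofReal_lt_top (ENNReal.mul_lt_top enorm_lt_top enorm_lt_top))⟩

theorem abs_conv_le_of_bound_mid {a w : L2 Ω (Vec d)} {G : L2 Ω (Mat d)} {B : ℝ} (hB : 0 ≤ B)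
    (h : ∀ᵐ x ∂volume.restrict (Ω : Set (Vec d)), ‖G x‖ ≤ B) :
    |conv a G w| ≤ B * ‖a‖ * ‖w‖ := by
  have h1 := (enorm_integral_le_lintegral_enorm (convIntegrand a G w)).trans
    (lintegral_convIntegrand_le_of_bound_mid hB h)
  have h2 := ENNReal.toReal_mono (ENNReal.mul_ne_top ENNReal.ofReal_ne_top
    (ENNReal.mul_ne_top enorm_ne_top enorm_ne_top)) h1
  rw [ENNReal.toReal_mul, ENNReal.toReal_mul, toReal_enorm, toReal_enorm, toReal_enorm,
    ENNReal.toReal_ofReal hB, ← mul_assoc] at h2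
  exact h2

theorem tendsto_conv_right_of_bound_mid {a w : L2 Ω (Vec d)} {w' : ℕ → L2 Ω (Vec d)}
    {G : L2 Ω (Mat d)} {B : ℝ} (hB : 0 ≤ B)
    (h : ∀ᵐ x ∂volume.restrict (Ω : Set (Vec d)), ‖G x‖ ≤ B)
    (hw : Filter.Tendsto w' Filter.atTop (𝓝 w)) :
    Filter.Tendsto (fun n => conv a G (w' n)) Filter.atTop (𝓝 (conv a G w)) := by
  rw [tendsto_iff_norm_sub_tendsto_zero] at hw ⊢
  have h0 := hw.const_mul (B * ‖a‖)
  rw [mul_zero] at h0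
  refine squeeze_zero (fun _ => norm_nonneg _) (fun n => ?_) h0
  rw [← conv_sub_right (integrable_convIntegrand_of_bound_mid a _ hB h)
    (integrable_convIntegrand_of_bound_mid a _ hB h)]
  exact abs_conv_le_of_bound_mid hB h

theorem tendsto_conv_mid {a w : L2 Ω (Vec d)} (h : prodNorm Ω a w ≠ ⊤) {G : L2 Ω (Mat d)}
    {G' : ℕ → L2 Ω (Mat d)} (hG : Filter.Tendsto G' Filter.atTop (𝓝 G)) :
    Filter.Tendsto (fun n => conv a (G' n) w) Filter.atTop (𝓝 (conv a G w)) := by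
  rw [tendsto_iff_norm_sub_tendsto_zero] at hG ⊢
  have h0 := hG.mul_const (prodNorm Ω a w).toReal
  rw [zero_mul] at h0
  refine squeeze_zero (fun _ => norm_nonneg _) (fun n => ?_) h0
  rw [← conv_sub_mid _ _ h]
  exact abs_conv_le _ h

theorem abs_conv_le_of_bound_right {a w : L2 Ω (Vec d)} {G : L2 Ω (Mat d)} {B : ℝ} (hB : 0 ≤ B)
    (h : ∀ᵐ x ∂volume.restrict (Ω : Set (Vec d)), ‖w x‖ ≤ B) :
    |conv a G w| ≤ B * ‖a‖ * ‖G‖ := by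
  have h1 := prodNorm_le_of_bound (a := a) hB h
  refine (abs_conv_le G (ne_top_of_le_ne_top ENNReal.ofReal_ne_top h1)).trans ?_
  have h2 := ENNReal.toReal_mono ENNReal.ofReal_ne_top h1
  rw [ENNReal.toReal_ofReal (by positivity)] at h2
  rw [mul_comm]
  gcongr

theorem ae_norm_testL2_le (φ : TestField Ω) {B : ℝ} (h : ∀ x, ‖φ x‖ ≤ B) :
    ∀ᵐ x ∂volume.restrict (Ω : Set (Vec d)), ‖testL2 φ x‖ ≤ B := by
  filter_upwards [(memLp_testField φ).coeFn_toLp] with x hx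
  rw [testL2, hx]
  exact h x

theorem exists_norm_testField_le (φ : TestField Ω) : ∃ B : ℝ, 0 ≤ B ∧ ∀ x, ‖φ x‖ ≤ B := by
  obtain ⟨B, hB⟩ := φ.continuous.bounded_above_of_compact_support φ.hasCompactSupport
  exact ⟨B, (norm_nonneg _).trans (hB 0), hB⟩

theorem prodNorm_testL2_ne_top (a : L2 Ω (Vec d)) (φ : TestField Ω) :
    prodNorm Ω a (testL2 φ) ≠ ⊤ := by
  obtain ⟨B, hB, h⟩ := exists_norm_testField_le φ
  exact ne_top_of_le_ne_top ENNReal.ofReal_ne_top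
    (prodNorm_le_of_bound hB (ae_norm_testL2_le φ h))

theorem exists_norm_gradField_le (φ : TestField Ω) :
    ∃ B : ℝ, 0 ≤ B ∧ ∀ x, ‖gradField φ x‖ ≤ B := by
  obtain ⟨B, hB⟩ := (φ.contDiff.continuous_fderiv (by simp)).bounded_above_of_compact_support
    (φ.hasCompactSupport.fderiv (𝕜 := ℝ))
  have hB0 : 0 ≤ B := (norm_nonneg _).trans (hB 0)
  refine ⟨∑ _k : Fin d, B, by positivity, fun x => (norm_gradField_le _ x).trans ?_⟩
  refine Finset.sum_le_sum fun k _ => ((fderiv ℝ φ x).le_opNorm _).trans ?_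
  simpa using hB x

/-- A map of three variables that is additive in each of them and bounded is continuous. -/
theorem continuous_of_trilinear_bound {X Y Z : Type*} [NormedAddCommGroup X]
    [NormedAddCommGroup Y] [NormedAddCommGroup Z] {T : X → Y → Z → ℝ} {B : ℝ}
    (h1 : ∀ a a' b c, T (a + a') b c = T a b c + T a' b c)
    (h2 : ∀ a b b' c, T a (b + b') c = T a b c + T a b' c)
    (h3 : ∀ a b c c', T a b (c + c') = T a b c + T a b c')
    (hT : ∀ a b c, |T a b c| ≤ B * ‖a‖ * ‖b‖ * ‖c‖) :
    Continuous fun p : X × Y × Z => T p.1 p.2.1 p.2.2 := by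
  rw [continuous_iff_continuousAt]
  rintro ⟨a₀, b₀, c₀⟩
  rw [ContinuousAt, tendsto_iff_norm_sub_tendsto_zero]
  have hg : Continuous fun p : X × Y × Z => B * ‖p.1 - a₀‖ * ‖p.2.1‖ * ‖p.2.2‖ +
      B * ‖a₀‖ * ‖p.2.1 - b₀‖ * ‖p.2.2‖ + B * ‖a₀‖ * ‖b₀‖ * ‖p.2.2 - c₀‖ := by fun_prop
  refine squeeze_zero (fun _ => norm_nonneg _) (fun p => ?_)
    ((hg.tendsto (a₀, b₀, c₀)).trans_eq (by simp))
  have e1 := h1 (p.1 - a₀) a₀ p.2.1 p.2.2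
  have e2 := h2 a₀ (p.2.1 - b₀) b₀ p.2.2
  have e3 := h3 a₀ b₀ (p.2.2 - c₀) c₀
  simp only [sub_add_cancel] at e1 e2 e3
  have e : T p.1 p.2.1 p.2.2 - T a₀ b₀ c₀ = T (p.1 - a₀) p.2.1 p.2.2 +
      T a₀ (p.2.1 - b₀) p.2.2 + T a₀ b₀ (p.2.2 - c₀) := by linarith
  rw [e]
  refine (norm_add₃_le).trans ?_
  exact add_le_add (add_le_add (hT _ _ _) (hT _ _ _)) (hT _ _ _)

theorem convIntegrand_grad_eq_inner (a : L2 Ω (Vec d)) (φ : TestField Ω) {w : L2 Ω (Vec d)}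
    {x : Vec d} (hx : (memLp_gradField φ).toLp (gradField φ) x = gradField φ x) :
    convIntegrand a ((memLp_gradField φ).toLp (gradField φ)) w x =
      inner ℝ (fderiv ℝ φ x (a x)) (w x) := by
  have he : fderiv ℝ φ x (a x) = ∑ k, a x k • fderiv ℝ φ x (unitVec k) := by
    conv_lhs => rw [← (EuclideanSpace.basisFun (Fin d) ℝ).sum_repr (a x), map_sum]
    simp [EuclideanSpace.basisFun_apply]
  rw [convIntegrand, hx, he, sum_inner]
  refine Finset.sum_congr rfl fun i _ => ?_
  rw [inner_smul_left, PiLp.inner_apply, Finset.mul_sum]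
  refine Finset.sum_congr rfl fun j _ => ?_
  simp [gradField]
  ring

/-- The two integrands add up to the derivative of `φ · ψ` in the direction of `a`, which integrates
to zero since `a ∈ L²_σ`. -/
theorem conv_testField_antisymm (hb : Bornology.IsBounded (Ω : Set (Vec d))) {a : L2 Ω (Vec d)}
    (ha : a ∈ L2sol Ω) (φ ψ : TestField Ω) :
    conv a ((memLp_gradField φ).toLp (gradField φ)) (testL2 ψ) +
      conv a ((memLp_gradField ψ).toLp (gradField ψ)) (testL2 φ) = 0 := by
  have hK : ContDiff ℝ ∞ fun x => inner ℝ (φ x) (ψ x) := φ.contDiff.inner ℝ ψ.contDiff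
  rw [conv, conv, ← integral_add (integrable_convIntegrand _ (prodNorm_testL2_ne_top _ _))
    (integrable_convIntegrand _ (prodNorm_testL2_ne_top _ _)),
    ← setIntegral_fderiv_apply_eq_zero hb hK ha]
  refine integral_congr_ae ?_
  filter_upwards [(memLp_testField φ).coeFn_toLp, (memLp_testField ψ).coeFn_toLp,
    (memLp_gradField φ).coeFn_toLp, (memLp_gradField ψ).coeFn_toLp] with x h1 h2 h3 h4
  rw [convIntegrand_grad_eq_inner a φ h3, convIntegrand_grad_eq_inner a ψ h4, testL2, testL2, h1,
    h2, fderiv_inner_apply ℝ (φ.contDiff.differentiable (by simp) x)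
      (ψ.contDiff.differentiable (by simp) x), add_comm, real_inner_comm (φ x)]

/-- Test fields tend to `b` in `H¹`. The first term converges because `ψ` is bounded, the second
because `∇ψ` is. -/
theorem conv_testField_antisymm_right (hb : Bornology.IsBounded (Ω : Set (Vec d)))
    {a : L2 Ω (Vec d)} (ha : a ∈ L2sol Ω) (b : H10sol Ω) (ψ : TestField Ω) :
    conv a (grad b) (testL2 ψ) + conv a ((memLp_gradField ψ).toLp (gradField ψ)) (val b) = 0 := by
  obtain ⟨φ, -, hφ⟩ := exists_seq_tendsto_of_mem_H10sol b.2
  have hv : Filter.Tendsto (fun n => testL2 (φ n)) Filter.atTop (𝓝 (val b)) :=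
    ((WithLp.fstL 2 ℝ (L2 Ω (Vec d)) (L2 Ω (Mat d))).continuous.tendsto _).comp hφ
  have hg : Filter.Tendsto (fun n => (memLp_gradField (φ n)).toLp (gradField (φ n)))
      Filter.atTop (𝓝 (grad b)) :=
    ((WithLp.sndL 2 ℝ (L2 Ω (Vec d)) (L2 Ω (Mat d))).continuous.tendsto _).comp hφ
  obtain ⟨B, hB, hψ⟩ := exists_norm_gradField_le ψ
  have hψ' : ∀ᵐ x ∂volume.restrict (Ω : Set (Vec d)),
      ‖(memLp_gradField ψ).toLp (gradField ψ) x‖ ≤ B := by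
    filter_upwards [(memLp_gradField ψ).coeFn_toLp] with x hx
    rw [hx]
    exact hψ x
  have h1 := (tendsto_conv_mid (prodNorm_testL2_ne_top a ψ) hg).add
    (tendsto_conv_right_of_bound_mid (a := a) hB hψ' hv)
  refine tendsto_nhds_unique h1 ?_
  simp_rw [conv_testField_antisymm hb ha]
  exact tendsto_const_nhds

/-- Weak continuity of the convective term in its last argument. -/
theorem tendsto_conv_right_of_prodNorm_le {a w : L2 Ω (Vec d)} {w' : ℕ → L2 Ω (Vec d)} {M : ℝ≥0∞}
    (hM : M ≠ ⊤) (hw : Filter.Tendsto w' Filter.atTop (𝓝 w)) (h : prodNorm Ω a w ≤ M)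
    (h' : ∀ n, prodNorm Ω a (w' n) ≤ M) (G : L2 Ω (Mat d)) :
    Filter.Tendsto (fun n => conv a G (w' n)) Filter.atTop (𝓝 (conv a G w)) := by
  have hbd : ∀ {z : L2 Ω (Vec d)}, prodNorm Ω a z ≤ M → ∀ H : L2 Ω (Mat d),
      |conv a H z| ≤ ‖H‖ * M.toReal := fun {z} hz H =>
    (abs_conv_le H (ne_top_of_le_ne_top hM hz)).trans (by gcongr)
  rw [Metric.tendsto_atTop]
  intro ε hε
  obtain ⟨δ, hδ, hδM⟩ : ∃ δ : ℝ, 0 < δ ∧ δ * M.toReal ≤ ε / 3 := by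
    refine ⟨ε / 3 / (M.toReal + 1), by positivity, ?_⟩
    rw [div_mul_eq_mul_div, div_le_iff₀ (by positivity)]
    nlinarith [ENNReal.toReal_nonneg (a := M)]
  -- `G` is approximated in `L²` by a bounded field `g`. For `g` strong `L²` convergence of `w'`
  -- suffices, and the error is small uniformly in `n` by the common bound `M`.
  obtain ⟨g, hg, hgL⟩ := (Lp.memLp G).exists_boundedContinuous_eLpNorm_sub_le (by norm_num)
    (ε := ENNReal.ofReal δ) (by simpa using hδ)
  have hgb : ∀ᵐ x ∂volume.restrict (Ω : Set (Vec d)), ‖hgL.toLp g x‖ ≤ ‖g‖ := by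
    filter_upwards [hgL.coeFn_toLp] with x hx
    rw [hx]
    exact g.norm_coe_le_norm x
  have hGg : ‖G - hgL.toLp g‖ ≤ δ := by
    have e : G - hgL.toLp g = ((Lp.memLp G).sub hgL).toLp (⇑G - ⇑g) := by
      rw [MemLp.toLp_sub (Lp.memLp G) hgL, Lp.toLp_coeFn]
    rw [e, Lp.norm_toLp]
    exact ENNReal.toReal_le_of_le_ofReal hδ.le hg
  have hlim := tendsto_conv_right_of_bound_mid (a := a) (norm_nonneg g) hgb hw
  obtain ⟨N, hN⟩ := Metric.tendsto_atTop.1 hlim (ε / 3) (by positivity)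
  refine ⟨N, fun n hn => ?_⟩
  have h1 := hN n hn
  have h2 := hbd (h' n) (G - hgL.toLp g)
  have h3 := hbd h (G - hgL.toLp g)
  rw [conv_sub_mid _ _ (ne_top_of_le_ne_top hM (h' n))] at h2
  rw [conv_sub_mid _ _ (ne_top_of_le_ne_top hM h)] at h3
  have h4 : ‖G - hgL.toLp g‖ * M.toReal ≤ ε / 3 := le_trans (by gcongr) hδM
  rw [Real.dist_eq] at h1 ⊢
  rw [abs_lt] at h1 ⊢
  rw [abs_le] at h2 h3
  constructor <;> linarith [h1.1, h1.2, h2.1, h2.2, h3.1, h3.2]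

namespace SolenoidalMollifier

variable (S : SolenoidalMollifier Ω)

theorem tendsto_val (u : H10sol Ω) :
    Filter.Tendsto (fun n => testL2 (S.op n (val u))) Filter.atTop (𝓝 (val u)) :=
  ((WithLp.fstL 2 ℝ (L2 Ω (Vec d)) (L2 Ω (Mat d))).continuous.tendsto _).comp (S.tendsto u)

theorem tendsto_grad (u : H10sol Ω) :
    Filter.Tendsto (fun n => (memLp_gradField (S.op n (val u))).toLp (gradField (S.op n (val u))))
      Filter.atTop (𝓝 (grad u)) :=
  ((WithLp.sndL 2 ℝ (L2 Ω (Vec d)) (L2 Ω (Mat d))).continuous.tendsto _).comp (S.tendsto u)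

end SolenoidalMollifier

/-! ### Absorption of the convective term -/

/-- A constant in the Gagliardo-Nirenberg estimate of `‖|u| |w|‖₂`. -/
def IsProductConst (Ω : Opens (Vec d)) (s : ℝ) (r : ℝ≥0∞) (C : ℝ) : Prop :=
  ∀ (u : H10sol Ω) (w : L2 Ω (Vec d)), eLpNorm w r (volume.restrict (Ω : Set (Vec d))) ≠ ⊤ →
    prodNorm Ω (val u) w ^ 2 ≤
      ENNReal.ofReal (C * ((‖val u‖ ^ 2) ^ (2 / s) * (‖grad u‖ ^ 2) ^ (1 - 2 / s)) *
        (eLpNorm w r (volume.restrict (Ω : Set (Vec d)))).toReal ^ 2)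

theorem exists_isProductConst (hd : 2 ≤ d) {s : ℝ} {r : ℝ≥0∞}
    (hsr : 2 / ENNReal.ofReal s + (d : ℝ≥0∞) / r ≤ 1)
    (hb : Bornology.IsBounded (Ω : Set (Vec d))) :
    ∃ C : ℝ, 0 < C ∧ IsProductConst Ω s r C := by
  obtain ⟨C, hC⟩ := exists_lintegral_val_mul_sq_le hd hsr hb
  refine ⟨C + 1, by positivity, fun u w hw => ?_⟩
  rw [prodNorm_sq]
  refine (hC u w (Lp.aestronglyMeasurable w) hw).trans ?_
  have e : (C : ℝ≥0∞) * eLpNorm w r (volume.restrict (Ω : Set (Vec d))) ^ 2 = ENNReal.ofReal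
      (C * (eLpNorm w r (volume.restrict (Ω : Set (Vec d)))).toReal ^ 2) := by
    rw [ENNReal.ofReal_mul (by positivity), ENNReal.ofReal_coe_nnreal,
      ENNReal.ofReal_pow (by positivity), ENNReal.ofReal_toReal hw]
  rw [e, ← ENNReal.ofReal_mul (by positivity)]
  refine ENNReal.ofReal_le_ofReal ?_
  have h1 : 0 ≤ (‖val u‖ ^ 2) ^ (2 / s) * (‖grad u‖ ^ 2) ^ (1 - 2 / s) *
      (eLpNorm w r (volume.restrict (Ω : Set (Vec d)))).toReal ^ 2 := by positivity
  nlinarith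

/-- The bound of `‖|u| |w|‖₂` in terms of a bound `A` of `‖w‖_r`. -/
def prodBound (C s : ℝ) (u : H10sol Ω) (A : ℝ) : ℝ :=
  √(C * ((‖val u‖ ^ 2) ^ (2 / s) * (‖grad u‖ ^ 2) ^ (1 - 2 / s))) * A

/-- The constant in the absorption of the convective term. -/
def absorbConst (C ν s : ℝ) : ℝ := 2 * ((√C) ^ s * (ν / 2) ^ (1 - s))

theorem absorbConst_pos {C ν s : ℝ} (hC : 0 < C) (hν : 0 < ν) : 0 < absorbConst C ν s := by
  unfold absorbConst
  positivity

/-- With `X = ‖u‖²` and `Y = ‖∇u‖²` the left-hand side is `√C A X^(1/s) Y^(1-1/s)`. Young's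
inequality with weights `1/s` and `1 - 1/s` is applied to `(ν/2) Y` and `P`, where `P` is chosen to
make the product exact; this fixes the factor `(√C)^s (ν/2)^(1-s)`. The factor `2` in `absorbConst`
compensates the `½` in the relative energy. -/
theorem norm_grad_mul_prodBound_le {C ν s : ℝ} (hC : 0 < C) (hν : 0 < ν) (hs : 2 ≤ s)
    (u : H10sol Ω) {A : ℝ} (hA : 0 ≤ A) :
    ‖grad u‖ * prodBound C s u A ≤
      ν / 2 * ‖grad u‖ ^ 2 + absorbConst C ν s / 2 * A ^ s * ‖val u‖ ^ 2 := by
  have hs0 : 0 < s := by linarith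
  have hθ1 : 0 ≤ 1 - 1 / s := by
    rw [sub_nonneg, div_le_one hs0]
    linarith
  have hσ1 : 0 ≤ 1 - 2 / s := by
    rw [sub_nonneg, div_le_one hs0]
    exact hs
  set X := ‖val u‖ ^ 2
  set Y := ‖grad u‖ ^ 2
  have hX : 0 ≤ X := by positivity
  have hY : 0 ≤ Y := by positivity
  have e1 : ‖grad u‖ = Y ^ (1 / 2 : ℝ) := by
    rw [← Real.sqrt_eq_rpow, Real.sqrt_sq (norm_nonneg _)]
  have e2 : prodBound C s u A = √C * (X ^ (1 / s) * Y ^ (1 / 2 - 1 / s)) * A := by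
    rw [prodBound, Real.sqrt_mul hC.le, Real.sqrt_mul (by positivity), Real.sqrt_eq_rpow (X ^ _),
      Real.sqrt_eq_rpow (Y ^ _), ← Real.rpow_mul hX, ← Real.rpow_mul hY]
    congr 4 <;> ring_nf
  set P := absorbConst C ν s / 2 * A ^ s * X
  have hP : 0 ≤ P := by
    have := absorbConst_pos (s := s) hC hν
    positivity
  have e3 : P ^ (1 / s) * (ν / 2 * Y) ^ (1 - 1 / s) = √C * A * X ^ (1 / s) * Y ^ (1 - 1 / s) := by
    have hc : absorbConst C ν s / 2 = (√C) ^ s * (ν / 2) ^ (1 - s) := by rw [absorbConst]; ring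
    have e4 : (((√C) ^ s : ℝ)) ^ (1 / s) = √C := by
      rw [← Real.rpow_mul (Real.sqrt_nonneg _), mul_one_div_cancel hs0.ne', Real.rpow_one]
    have e5 : (A ^ s : ℝ) ^ (1 / s) = A := by
      rw [← Real.rpow_mul hA, mul_one_div_cancel hs0.ne', Real.rpow_one]
    have e6 : ((ν / 2) ^ (1 - s)) ^ (1 / s) * (ν / 2) ^ (1 - 1 / s) = 1 := by
      rw [← Real.rpow_mul (by positivity), ← Real.rpow_add (by positivity),
        show (1 - s) * (1 / s) + (1 - 1 / s) = 0 by field_simp; ring, Real.rpow_zero]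
    simp only [P]
    rw [hc, Real.mul_rpow (by positivity) hX, Real.mul_rpow (by positivity) (by positivity),
      Real.mul_rpow (by positivity) (by positivity), Real.mul_rpow (by positivity) hY, e4, e5]
    linear_combination √C * A * X ^ (1 / s) * Y ^ (1 - 1 / s) * e6
  have e7 : Y ^ (1 / 2 : ℝ) * Y ^ (1 / 2 - 1 / s) = Y ^ (1 - 1 / s) := by
    have h : 0 ≤ 1 / 2 - 1 / s := by
      have : 1 / s = (2 / s) / 2 := by ring
      linarith
    rw [← Real.rpow_add_of_nonneg hY (by norm_num) h]
    congr 1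
    ring
  have h := Real.geom_mean_le_arith_mean2_weighted (w₁ := 1 / s) (w₂ := 1 - 1 / s) (by positivity)
    hθ1 hP (by positivity : 0 ≤ ν / 2 * Y) (by ring)
  rw [e3] at h
  have h1 : 1 / s ≤ 1 := by linarith
  have h2 : 0 ≤ 1 / s := by positivity
  have h3 : 0 ≤ ν / 2 * Y := by positivity
  calc ‖grad u‖ * prodBound C s u A = √C * A * X ^ (1 / s) * Y ^ (1 - 1 / s) := by
        rw [e1, e2, ← e7]
        ring
    _ ≤ _ := h
    _ ≤ ν / 2 * Y + P := by nlinarith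

namespace IsProductConst

variable {s : ℝ} {r : ℝ≥0∞} {C : ℝ}

theorem prodNorm_le (hC : IsProductConst Ω s r C) (hC0 : 0 < C) (u : H10sol Ω) {w : L2 Ω (Vec d)}
    {A : ℝ} (hA : 0 ≤ A)
    (hw : eLpNorm w r (volume.restrict (Ω : Set (Vec d))) ≤ ENNReal.ofReal A) :
    prodNorm Ω (val u) w ≤ ENNReal.ofReal (prodBound C s u A) := by
  rw [← ENNReal.pow_le_pow_left_iff two_ne_zero]
  refine (hC u w (ne_top_of_le_ne_top ENNReal.ofReal_ne_top hw)).trans ?_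
  rw [← ENNReal.ofReal_pow (by unfold prodBound; positivity), prodBound, mul_pow,
    Real.sq_sqrt (by positivity)]
  refine ENNReal.ofReal_le_ofReal ?_
  gcongr
  exact ENNReal.toReal_le_of_le_ofReal hA hw

theorem prodNorm_ne_top (hC : IsProductConst Ω s r C) (u : H10sol Ω) {w : L2 Ω (Vec d)}
    (hw : eLpNorm w r (volume.restrict (Ω : Set (Vec d))) ≠ ⊤) :
    prodNorm Ω (val u) w ≠ ⊤ := by
  intro h
  have := hC u w hw
  rw [h] at this
  simp at this

theorem abs_conv_grad_le (hC : IsProductConst Ω s r C) (hC0 : 0 < C) {ν : ℝ} (hν : 0 < ν)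
    (hs : 2 ≤ s) (u : H10sol Ω) {w : L2 Ω (Vec d)} {A : ℝ} (hA : 0 ≤ A)
    (hw : eLpNorm w r (volume.restrict (Ω : Set (Vec d))) ≤ ENNReal.ofReal A) :
    |conv (val u) (grad u) w| ≤
      ν / 2 * ‖grad u‖ ^ 2 + absorbConst C ν s / 2 * A ^ s * ‖val u‖ ^ 2 := by
  have h := hC.prodNorm_le hC0 u hA hw
  refine (abs_conv_le _ (ne_top_of_le_ne_top ENNReal.ofReal_ne_top h)).trans
    (le_trans ?_ (norm_grad_mul_prodBound_le hC0 hν hs u hA))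
  gcongr
  exact ENNReal.toReal_le_of_le_ofReal (by unfold prodBound; positivity) h

end IsProductConst

theorem SolenoidalMollifier.eLpNorm_testL2_op_le (S : SolenoidalMollifier Ω) {r : ℝ≥0∞}
    (hr : 1 ≤ r) (n : ℕ) {w : L2 Ω (Vec d)} {A : ℝ}
    (hw : eLpNorm w r (volume.restrict (Ω : Set (Vec d))) ≤ ENNReal.ofReal A) :
    eLpNorm (testL2 (S.op n w)) r (volume.restrict (Ω : Set (Vec d))) ≤
      ENNReal.ofReal (S.C * A) := by
  rw [testL2, eLpNorm_congr_ae (g := S.op n w) (memLp_testField (S.op n w)).coeFn_toLp,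
    ENNReal.ofReal_mul S.nonneg]
  exact (S.eLpNorm_le n w r hr).trans (by gcongr)

namespace IsProductConst

variable {s : ℝ} {r : ℝ≥0∞} {C : ℝ}

theorem tendsto_conv_op (hC : IsProductConst Ω s r C) (hC0 : 0 < C) (hr : 1 ≤ r)
    (S : SolenoidalMollifier Ω) (u w : H10sol Ω) (G : L2 Ω (Mat d))
    (hw : eLpNorm (val w) r (volume.restrict (Ω : Set (Vec d))) ≠ ⊤) :
    Filter.Tendsto (fun n => conv (val u) G (testL2 (S.op n (val w)))) Filter.atTop
      (𝓝 (conv (val u) G (val w))) := by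
  have hA := (ENNReal.ofReal_toReal hw).ge
  set A := (eLpNorm (val w) r (volume.restrict (Ω : Set (Vec d)))).toReal
  have hA0 : 0 ≤ A := ENNReal.toReal_nonneg
  refine tendsto_conv_right_of_prodNorm_le
    (M := ENNReal.ofReal (prodBound C s u A) + ENNReal.ofReal (prodBound C s u (S.C * A)))
    (ENNReal.add_ne_top.2 ⟨ENNReal.ofReal_ne_top, ENNReal.ofReal_ne_top⟩) (S.tendsto_val w)
    ((hC.prodNorm_le hC0 u hA0 hA).trans le_self_add)
    (fun n => (hC.prodNorm_le hC0 u (mul_nonneg S.nonneg hA0)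
      (S.eLpNorm_testL2_op_le hr n hA)).trans le_add_self) G

/-- The identity holds with `w` mollified. In the first term the mollification is removed by weak
continuity, which needs the uniform `L^r` bound of the operators; in the second one `∇w` converges
strongly in `L²` while `|a||b|` is in `L²`. -/
theorem conv_antisymm (hC : IsProductConst Ω s r C) (hC0 : 0 < C) (hr : 1 ≤ r)
    (S : SolenoidalMollifier Ω) (hb : Bornology.IsBounded (Ω : Set (Vec d))) (a b w : H10sol Ω)
    (hw : eLpNorm (val w) r (volume.restrict (Ω : Set (Vec d))) ≠ ⊤)
    (hab : prodNorm Ω (val a) (val b) ≠ ⊤) :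
    conv (val a) (grad b) (val w) + conv (val a) (grad w) (val b) = 0 := by
  have h1 := (hC.tendsto_conv_op hC0 hr S a w (grad b) hw).add
    (tendsto_conv_mid hab (S.tendsto_grad w))
  refine tendsto_nhds_unique h1 ?_
  simp_rw [conv_testField_antisymm_right hb (val_mem_L2sol a)]
  exact tendsto_const_nhds

/-- Expand the first term with `v = u + w`. By antisymmetry `((u·∇)w, w)` and `((w·∇)w, w)` vanish,
and `((w·∇)u, w)` cancels `((w·∇)w, u)`; only the term quadratic in `u` survives. It is the one that
the viscosity can absorb. -/
theorem conv_add_conv_sub_eq (hC : IsProductConst Ω s r C) (hC0 : 0 < C) (hr : 1 ≤ r)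
    (S : SolenoidalMollifier Ω) (hb : Bornology.IsBounded (Ω : Set (Vec d))) (v w : H10sol Ω)
    (hw : eLpNorm (val w) r (volume.restrict (Ω : Set (Vec d))) ≠ ⊤) :
    conv (val v) (grad v) (val w) + conv (val w) (grad w) (val (v - w)) =
      conv (val (v - w)) (grad (v - w)) (val w) := by
  obtain ⟨u, hu⟩ : ∃ u, u = v - w := ⟨_, rfl⟩
  have hv : v = u + w := by rw [hu]; abel
  rw [← hu, hv]
  have huw := hC.prodNorm_ne_top u hw
  have hww := hC.prodNorm_ne_top w hw
  have hwu : prodNorm Ω (val w) (val u) ≠ ⊤ := by rwa [prodNorm_comm]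
  have e1 : val (u + w) = val u + val w := rfl
  have e2 : grad (u + w) = grad u + grad w := rfl
  have h1 := hC.conv_antisymm hC0 hr S hb u w w hw huw
  have h2 := hC.conv_antisymm hC0 hr S hb w w w hw hww
  have h3 := hC.conv_antisymm hC0 hr S hb w u w hw hwu
  rw [e1, e2, conv_add_left _ huw hww, conv_add_mid _ _ huw, conv_add_mid _ _ hww]
  linarith

end IsProductConst

/-- The convective term with mollified last argument is jointly continuous. -/
theorem SolenoidalMollifier.continuous_conv_op (S : SolenoidalMollifier Ω) (n : ℕ) :
    Continuous fun p : L2 Ω (Vec d) × L2 Ω (Mat d) × L2 Ω (Vec d) =>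
      conv p.1 p.2.1 (testL2 (S.op n p.2.2)) := by
  obtain ⟨B, hB, h⟩ := S.exists_norm_le n
  have hp := prodNorm_testL2_ne_top (Ω := Ω)
  refine continuous_of_trilinear_bound (B := B)
    (T := fun a G w => conv a G (testL2 (S.op n w)))
    (fun a a' G w => conv_add_left G (hp _ _) (hp _ _))
    (fun a G G' w => conv_add_mid G G' (hp _ _)) (fun a G w w' => ?_) (fun a G w => ?_)
  · have e : testL2 (S.op n (w + w')) = testL2 (S.op n w) + testL2 (S.op n w') := by
      rw [map_add]
      exact (testL2Hom Ω).map_add _ _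
    simp only [e]
    exact conv_add_right G (hp _ _) (hp _ _)
  · refine (abs_conv_le_of_bound_right (by positivity)
      (ae_norm_testL2_le (S.op n w) (h w))).trans_eq ?_
    ring

/-! ### The weak form and its mollification -/

instance : CompleteSpace (H10sol Ω) :=
  (Submodule.isClosed_topologicalClosure _).completeSpace_coe

theorem secondCountableTopology_L2 {F : Type} [NormedAddCommGroup F] [SecondCountableTopology F] :
    SecondCountableTopology (L2 Ω F) := by
  have : Fact ((2 : ℝ≥0∞) ≠ ⊤) := ⟨by simp⟩
  infer_instance

instance : SecondCountableTopology (H10sol Ω) := by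
  have := secondCountableTopology_L2 (Ω := Ω) (F := Vec d)
  have := secondCountableTopology_L2 (Ω := Ω) (F := Mat d)
  have : SecondCountableTopology (GradPair Ω) :=
    (WithLp.prodContinuousLinearEquiv 2 ℝ (L2 Ω (Vec d)) (L2 Ω
      (Mat d))).toHomeomorph.secondCountableTopology
  exact TopologicalSpace.Subtype.secondCountableTopology _

variable (S : SolenoidalMollifier Ω)

/-- The mollification as a bounded operator on `H¹_{0,σ}`. -/
def SolenoidalMollifier.opH (n : ℕ) : H10sol Ω →L[ℝ] H10sol Ω :=
  LinearMap.mkContinuous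
    { toFun := fun y => testSol (S.op n (val y)) (S.isSolenoidal n _ (val_mem_L2sol y))
      map_add' := fun y z => Subtype.ext (by
        change testPair (S.op n (val y + val z)) =
          testPair (S.op n (val y)) + testPair (S.op n (val z))
        rw [map_add]
        exact (testPairHom Ω).map_add _ _)
      map_smul' := fun a y => Subtype.ext (by
        change testPair (S.op n (a • val y)) = a • testPair (S.op n (val y))
        rw [map_smul]
        exact (testPairHom Ω).map_smul _ _) } S.C (fun y => S.norm_testPair_le n y)

theorem SolenoidalMollifier.val_opH (n : ℕ) (y : H10sol Ω) :
    val (S.opH n y) = testL2 (S.op n (val y)) := rfl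

theorem SolenoidalMollifier.norm_opH_le (n : ℕ) (y : H10sol Ω) : ‖S.opH n y‖ ≤ S.C * ‖y‖ :=
  S.norm_testPair_le n y

theorem SolenoidalMollifier.tendsto_opH (y : H10sol Ω) :
    Filter.Tendsto (fun n => S.opH n y) Filter.atTop (𝓝 y) := by
  rw [tendsto_subtype_rng]
  exact S.tendsto y

/-- The weak form of the stationary part of the equation. -/
def weakForm (ν : ℝ) (a : H10sol Ω) (g₁ : HNeg1 Ω) (g₂ : L2 Ω (Vec d)) (y : H10sol Ω) : ℝ :=
  ν * inner ℝ (grad a) (grad y) + conv (val a) (grad a) (val y) - pairing g₁ g₂ y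

section Dual

variable {E : Type*} [NormedAddCommGroup E] [NormedSpace ℝ E] {p q : Submodule ℝ E}

theorem dual_inclusion_add (h : p ≤ q) (g : StrongDual ℝ q) (y z : p) :
    g (Submodule.inclusion h (y + z)) =
      g (Submodule.inclusion h y) + g (Submodule.inclusion h z) :=
  map_add g (Submodule.inclusion h y) (Submodule.inclusion h z)

theorem dual_inclusion_smul (h : p ≤ q) (g : StrongDual ℝ q) (t : ℝ) (y : p) :
    g (Submodule.inclusion h (t • y)) = t * g (Submodule.inclusion h y) :=
  map_smul g t (Submodule.inclusion h y)

theorem abs_dual_inclusion_le (h : p ≤ q) (g : StrongDual ℝ q) (y : p) :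
    |g (Submodule.inclusion h y)| ≤ ‖g‖ * ‖y‖ :=
  g.le_opNorm (Submodule.inclusion h y)

end Dual

theorem pairing_add (g₁ : HNeg1 Ω) (g₂ : L2 Ω (Vec d)) (y z : H10sol Ω) :
    pairing g₁ g₂ (y + z) = pairing g₁ g₂ y + pairing g₁ g₂ z := by
  have h2 : inner ℝ g₂ (val (y + z)) = inner ℝ g₂ (val y) + inner ℝ g₂ (val z) :=
    inner_add_right g₂ (val y) (val z)
  have h1 := dual_inclusion_add (H10sol_le_H10 Ω) g₁ y z
  unfold pairing
  linear_combination h1 + h2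

theorem pairing_smul (g₁ : HNeg1 Ω) (g₂ : L2 Ω (Vec d)) (t : ℝ) (y : H10sol Ω) :
    pairing g₁ g₂ (t • y) = t * pairing g₁ g₂ y := by
  have h2 : inner ℝ g₂ (val (t • y)) = t * inner ℝ g₂ (val y) :=
    real_inner_smul_right g₂ (val y) t
  have h1 := dual_inclusion_smul (H10sol_le_H10 Ω) g₁ t y
  unfold pairing
  linear_combination h1 + h2

theorem pairing_sub (g₁ : HNeg1 Ω) (g₂ : L2 Ω (Vec d)) (y z : H10sol Ω) :
    pairing g₁ g₂ (y - z) = pairing g₁ g₂ y - pairing g₁ g₂ z := by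
  have := pairing_add g₁ g₂ (y - z) z
  rw [sub_add_cancel] at this
  linarith

theorem continuous_pairing :
    Continuous fun p : HNeg1 Ω × L2 Ω (Vec d) × H10sol Ω => pairing p.1 p.2.1 p.2.2 := by
  unfold pairing
  have h1 : Continuous fun p : HNeg1 Ω × L2 Ω (Vec d) × H10sol Ω =>
      Submodule.inclusion (H10sol_le_H10 Ω) p.2.2 := by
    refine Continuous.comp (g := Submodule.inclusion (H10sol_le_H10 Ω)) ?_ (by fun_prop)
    exact continuous_inclusion (H10sol_le_H10 Ω)
  have h2 : Continuous fun p : HNeg1 Ω × L2 Ω (Vec d) × H10sol Ω => val p.2.2 :=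
    (valCLM Ω).continuous.comp (by fun_prop)
  exact (continuous_fst.clm_apply h1).add ((continuous_fst.comp continuous_snd).inner h2)

theorem abs_pairing_le (g₁ : HNeg1 Ω) (g₂ : L2 Ω (Vec d)) (y : H10sol Ω) :
    |pairing g₁ g₂ y| ≤ ‖g₁‖ * ‖y‖ + ‖g₂‖ * ‖val y‖ := by
  refine (abs_add_le _ _).trans (add_le_add ?_ (abs_real_inner_le_norm _ _))
  exact abs_dual_inclusion_le (H10sol_le_H10 Ω) g₁ y

/-- Joint continuity in the data and the test field provides the measurability in time, and on the
product of two time intervals, by composition. -/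
theorem SolenoidalMollifier.continuous_weakForm (n : ℕ) (ν : ℝ) :
    Continuous fun p : H10sol Ω × HNeg1 Ω × L2 Ω (Vec d) × H10sol Ω =>
      weakForm ν p.1 p.2.1 p.2.2.1 (S.opH n p.2.2.2) := by
  unfold weakForm
  have hop : Continuous fun p : H10sol Ω × HNeg1 Ω × L2 Ω (Vec d) × H10sol Ω => S.opH n p.2.2.2 :=
    (S.opH n).continuous.comp (by fun_prop)
  have hv : Continuous fun p : H10sol Ω × HNeg1 Ω × L2 Ω (Vec d) × H10sol Ω => val p.1 :=
    (valCLM Ω).continuous.comp (by fun_prop)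
  have hg : Continuous fun p : H10sol Ω × HNeg1 Ω × L2 Ω (Vec d) × H10sol Ω => grad p.1 :=
    (gradCLM Ω).continuous.comp (by fun_prop)
  have hy : Continuous fun p : H10sol Ω × HNeg1 Ω × L2 Ω (Vec d) × H10sol Ω => val p.2.2.2 :=
    (valCLM Ω).continuous.comp (by fun_prop)
  have hgo : Continuous fun p : H10sol Ω × HNeg1 Ω × L2 Ω (Vec d) × H10sol Ω =>
      grad (S.opH n p.2.2.2) := (gradCLM Ω).continuous.comp hop
  have hi : Continuous fun p : H10sol Ω × HNeg1 Ω × L2 Ω (Vec d) × H10sol Ω =>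
      (inner ℝ (grad p.1) (grad (S.opH n p.2.2.2)) : ℝ) := hg.inner hgo
  have hc : Continuous fun p : H10sol Ω × HNeg1 Ω × L2 Ω (Vec d) × H10sol Ω =>
      conv (val p.1) (grad p.1) (val (S.opH n p.2.2.2)) := by
    have h := (S.continuous_conv_op n).comp (hv.prodMk (hg.prodMk hy))
    simpa only [Function.comp_def, S.val_opH] using h
  have hp : Continuous fun p : H10sol Ω × HNeg1 Ω × L2 Ω (Vec d) × H10sol Ω =>
      pairing p.2.1 p.2.2.1 (S.opH n p.2.2.2) := by
    have h1 : Continuous fun p : H10sol Ω × HNeg1 Ω × L2 Ω (Vec d) × H10sol Ω => p.2.1 := by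
      fun_prop
    have h2 : Continuous fun p : H10sol Ω × HNeg1 Ω × L2 Ω (Vec d) × H10sol Ω => p.2.2.1 := by
      fun_prop
    have h := continuous_pairing.comp (h1.prodMk (h2.prodMk hop))
    simpa only [Function.comp_def] using h
  exact ((continuous_const.mul hi).add hc).sub hp

theorem SolenoidalMollifier.exists_abs_weakForm_le (n : ℕ) {ν : ℝ} (hν : 0 ≤ ν) :
    ∃ B : ℝ, 0 ≤ B ∧ ∀ (a : H10sol Ω) (g₁ : HNeg1 Ω) (g₂ : L2 Ω (Vec d)) (y : H10sol Ω),
      |weakForm ν a g₁ g₂ (S.opH n y)| ≤ B * (‖a‖ + ‖a‖ ^ 2 + ‖g₁‖ + ‖g₂‖) * ‖y‖ := by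
  obtain ⟨B, hB, h⟩ := S.exists_norm_le n
  have hC := S.nonneg
  refine ⟨ν * S.C + B + S.C, by positivity, fun a g₁ g₂ y => ?_⟩
  have h1 : |ν * inner ℝ (grad a) (grad (S.opH n y))| ≤ ν * S.C * ‖a‖ * ‖y‖ := by
    rw [abs_mul, abs_of_nonneg hν, mul_assoc, mul_assoc]
    gcongr
    calc _ ≤ ‖grad a‖ * ‖grad (S.opH n y)‖ := abs_real_inner_le_norm _ _
      _ ≤ ‖a‖ * (S.C * ‖y‖) := by
        gcongr
        · exact norm_grad_le a
        · exact (norm_grad_le _).trans (S.norm_opH_le n y)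
      _ = _ := by ring
  have h2 : |conv (val a) (grad a) (val (S.opH n y))| ≤ B * ‖a‖ ^ 2 * ‖y‖ := by
    rw [S.val_opH]
    refine (abs_conv_le_of_bound_right (by positivity)
      (ae_norm_testL2_le (S.op n (val y)) (h (val y)))).trans ?_
    calc B * ‖val y‖ * ‖val a‖ * ‖grad a‖ ≤ B * ‖y‖ * ‖a‖ * ‖a‖ := by
          gcongr
          · exact norm_val_le y
          · exact norm_val_le a
          · exact norm_grad_le a
      _ = _ := by ring
  have h3 : |pairing g₁ g₂ (S.opH n y)| ≤ S.C * (‖g₁‖ + ‖g₂‖) * ‖y‖ := by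
    have h4 := S.norm_opH_le n y
    refine (abs_pairing_le _ _ _).trans ?_
    calc _ ≤ ‖g₁‖ * (S.C * ‖y‖) + ‖g₂‖ * (S.C * ‖y‖) := by
          gcongr
          exact (norm_val_le _).trans h4
      _ = _ := by ring
  have h5 : |weakForm ν a g₁ g₂ (S.opH n y)| ≤ _ := (abs_sub _ _).trans
    (add_le_add ((abs_add_le _ _).trans (add_le_add h1 h2)) h3)
  refine h5.trans ?_
  have : 0 ≤ ‖a‖ * ‖y‖ := by positivity
  have : 0 ≤ ‖a‖ ^ 2 * ‖y‖ := by positivity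
  have : 0 ≤ ‖g₁‖ * ‖y‖ := by positivity
  have : 0 ≤ ‖g₂‖ * ‖y‖ := by positivity
  have : 0 ≤ ν * S.C := by positivity
  rw [← sub_nonneg]
  have e : (ν * S.C + B + S.C) * (‖a‖ + ‖a‖ ^ 2 + ‖g₁‖ + ‖g₂‖) * ‖y‖ -
      (ν * S.C * ‖a‖ * ‖y‖ + B * ‖a‖ ^ 2 * ‖y‖ + S.C * (‖g₁‖ + ‖g₂‖) * ‖y‖) =
      (B + S.C) * (‖a‖ * ‖y‖) + (ν * S.C + S.C) * (‖a‖ ^ 2 * ‖y‖) +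
        (ν * S.C + B) * (‖g₁‖ * ‖y‖) + (ν * S.C + B) * (‖g₂‖ * ‖y‖) := by ring
  rw [e]
  positivity

theorem weakForm_add (ν : ℝ) {a : H10sol Ω} (g₁ : HNeg1 Ω) (g₂ : L2 Ω (Vec d)) {y z : H10sol Ω}
    (hy : prodNorm Ω (val a) (val y) ≠ ⊤) (hz : prodNorm Ω (val a) (val z) ≠ ⊤) :
    weakForm ν a g₁ g₂ (y + z) = weakForm ν a g₁ g₂ y + weakForm ν a g₁ g₂ z := by
  have e1 : val (y + z) = val y + val z := rfl
  have e2 : grad (y + z) = grad y + grad z := rfl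
  rw [weakForm, weakForm, weakForm, e1, e2, inner_add_right, conv_add_right _ hy hz, pairing_add]
  ring

theorem weakForm_smul (ν : ℝ) (a : H10sol Ω) (g₁ : HNeg1 Ω) (g₂ : L2 Ω (Vec d)) (t : ℝ)
    (y : H10sol Ω) : weakForm ν a g₁ g₂ (t • y) = t * weakForm ν a g₁ g₂ y := by
  have e1 : val (t • y) = t • val y := rfl
  have e2 : grad (t • y) = t • grad y := rfl
  rw [weakForm, weakForm, e1, e2, inner_smul_right, conv_smul_right, pairing_smul]
  ring

/-- Without mollification the convective integral need not converge for every test field, and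
linearity may fail. Mollified fields are bounded, which makes the functional linear and continuous.
-/
theorem SolenoidalMollifier.exists_weakForm_clm (n : ℕ) {ν : ℝ} (hν : 0 ≤ ν) (a : H10sol Ω)
    (g₁ : HNeg1 Ω) (g₂ : L2 Ω (Vec d)) :
    ∃ L : H10sol Ω →L[ℝ] ℝ, ∀ y, L y = weakForm ν a g₁ g₂ (S.opH n y) := by
  obtain ⟨B, -, h⟩ := S.exists_abs_weakForm_le n hν
  refine ⟨LinearMap.mkContinuous
    { toFun := fun y => weakForm ν a g₁ g₂ (S.opH n y)
      map_add' := fun y z => ?_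
      map_smul' := fun t y => ?_ } _ (fun y => h a g₁ g₂ y), fun y => rfl⟩
  · rw [map_add]
    exact weakForm_add ν g₁ g₂ (prodNorm_testL2_ne_top _ _) (prodNorm_testL2_ne_top _ _)
  · rw [(S.opH n).map_smul]
    exact weakForm_smul ν a g₁ g₂ t _

/-! ### Testing the equation with products -/

theorem isTestPath_smul {T : ℝ} {θ θ' : ℝ → ℝ} (hθ : ∀ t, HasDerivAt θ (θ' t) t)
    (hθ' : Continuous θ') {T' : ℝ} (hT' : T' < T) (h0 : ∀ t ∈ Icc T' T, θ t = 0) {φ : TestField Ω}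
    (hφ : IsSolenoidal φ) : IsTestPath T (fun t => θ t • φ) (fun t => θ' t • φ) where
  solenoidal t := (solenoidalTest Ω).smul_mem _ hφ
  hasDeriv t _ := by
    have h := (hasDerivAt_iff_tendsto_slope.1 (hθ t)).mono_left
      (nhdsWithin_mono t (fun τ (hτ : τ ∈ Icc 0 T \ {t}) => hτ.2))
    refine (h.smul_const φ).congr fun τ => ?_
    rw [← sub_smul, smul_smul, slope_def_field]
    congr 1
    ring
  continuous_deriv := (hθ'.smul continuous_const).continuousOn
  compact_support := ⟨T', hT', fun t ht => by simp [h0 t ht]⟩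

theorem IsWeakSolution.weak_form_smul {ν T : ℝ} {f₁ : ℝ → HNeg1 Ω} {f₂ : ℝ → L2 Ω (Vec d)}
    {v₀ : L2sol Ω} {v : ℝ → H10sol Ω} (hw : IsWeakSolution ν T f₁ f₂ v₀ v) {φ : TestField Ω}
    (hφ : IsSolenoidal φ)
    (hint : IntegrableOn (fun t => weakForm ν (v t) (f₁ t) (f₂ t) (testSol φ hφ)) (Ioo 0 T))
    (hpair : IntegrableOn (fun t => pairing (f₁ t) (f₂ t) (testSol φ hφ)) (Ioo 0 T))
    {θ θ' : ℝ → ℝ} (hθ : ∀ t, HasDerivAt θ (θ' t) t)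
    (hθ' : Continuous θ') {T' : ℝ} (hT' : T' < T) (h0 : ∀ t ∈ Icc T' T, θ t = 0) :
    -(∫ t in Ioo 0 T, θ' t * inner ℝ (val (v t)) (testL2 φ)) +
      ∫ t in Ioo 0 T, θ t * weakForm ν (v t) (f₁ t) (f₂ t) (testSol φ hφ) =
      θ 0 * inner ℝ (v₀ : L2 Ω (Vec d)) (testL2 φ) := by
  have h := hw.weak_form _ _ (isTestPath_smul hθ hθ' hT' h0 hφ)
  have e1 : ∀ c : ℝ, testL2 (c • φ) = c • testL2 φ := fun c => (testL2Hom Ω).map_smul c φ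
  have e2 : ∀ (c : ℝ) (hc : IsSolenoidal (c • φ)), testSol (c • φ) hc = c • testSol φ hφ :=
    fun c hc => Subtype.ext ((testPairHom Ω).map_smul c φ)
  have e3 : ∀ c : ℝ, grad (c • testSol φ hφ) = c • grad (testSol φ hφ) := fun c => rfl
  simp only [e1, e2, e3, inner_smul_right, conv_smul_right, pairing_smul] at h
  have hc : Continuous θ := continuous_iff_continuousAt.2 fun t => (hθ t).continuousAt
  have hb : ∀ {g : ℝ → ℝ}, IntegrableOn g (Ioo 0 T) →
      IntegrableOn (fun t => θ t * g t) (Ioo 0 T) := by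
    intro g hg
    exact (IntegrableOn.continuousOn_mul_of_subset (K := Icc 0 T) hc.continuousOn hg isCompact_Icc
      measurableSet_Ioo Ioo_subset_Icc_self)
  have e4 : ∀ t, ν * (θ t * inner ℝ (grad (v t)) (grad (testSol φ hφ))) +
      θ t * conv (val (v t)) (grad (v t)) (testL2 φ) =
      θ t * weakForm ν (v t) (f₁ t) (f₂ t) (testSol φ hφ) +
        θ t * pairing (f₁ t) (f₂ t) (testSol φ hφ) := by
    intro t
    have : val (testSol φ hφ) = testL2 φ := rfl
    rw [weakForm, this]
    ring
  simp only [e4] at h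
  rw [integral_add (hb hint) (hb hpair)] at h
  linarith

/-! ### The equation integrated in time -/

theorem integrableOn_Ioo_iff {F : Type*} [NormedAddCommGroup F] {f : ℝ → F} {a b : ℝ}
    (hab : a ≤ b) : IntegrableOn f (Ioo a b) ↔ IntervalIntegrable f volume a b := by
  rw [intervalIntegrable_iff_integrableOn_Ioo_of_le hab]

theorem setIntegral_Ioo_eq {F : Type*} [NormedAddCommGroup F] [NormedSpace ℝ F] {f : ℝ → F}
    {a b : ℝ} (hab : a ≤ b) : ∫ t in Ioo a b, f t = ∫ t in a..b, f t := by
  rw [intervalIntegral.integral_of_le hab, integral_Ioc_eq_integral_Ioo]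

/-- A function with a weak derivative in time is almost everywhere a primitive. -/
theorem ae_eq_sub_integral {T : ℝ} (hT : 0 < T) {A B : ℝ → ℝ} {ℓ : ℝ}
    (hA : IntegrableOn A (Ioo 0 T)) (hB : IntegrableOn B (Ioo 0 T))
    (h : ∀ θ θ' : ℝ → ℝ, (∀ t, HasDerivAt θ (θ' t) t) → Continuous θ' →
      ∀ T' < T, (∀ t ∈ Icc T' T, θ t = 0) →
        -(∫ t in Ioo 0 T, θ' t * A t) + ∫ t in Ioo 0 T, θ t * B t = θ 0 * ℓ) :
    ∀ᵐ t ∂timeMeasure T, A t = ℓ - ∫ σ in Ioo 0 t, B σ := by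
  have hBi : IntervalIntegrable B volume 0 T := (integrableOn_Ioo_iff hT.le).1 hB
  set G : ℝ → ℝ := fun t => ∫ σ in (0 : ℝ)..t, B σ
  have hG : AbsolutelyContinuousOnInterval G 0 T :=
    hBi.absolutelyContinuousOnInterval_intervalIntegral (by simp)
  have hGc : ContinuousOn G (Icc 0 T) := by
    have := hG.continuousOn
    rwa [uIcc_of_le hT.le] at this
  have hGi : IntegrableOn G (Ioo 0 T) :=
    (hGc.integrableOn_compact isCompact_Icc).mono_set Ioo_subset_Icc_self
  have hloc : IntegrableOn (fun t => ℓ - G t - A t) (Ioo 0 T) :=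
    ((integrableOn_const (by simp)).sub hGi).sub hA
  have hae := isOpen_Ioo.ae_eq_zero_of_integral_contDiff_smul_eq_zero (μ := volume)
    hloc.locallyIntegrableOn (by
      intro g hg hgs hgt
      have hgc : Continuous g := hg.continuous
      -- The primitive of `g` that vanishes at `T` is an admissible time factor, and `θ 0 = -∫ g`.
      -- Integration by parts against the primitive `G` of `B` reduces the hypothesis to the
      -- fundamental lemma of the calculus of variations for `ℓ - G - A`.
      set θ : ℝ → ℝ := fun t => ∫ σ in T..t, g σ
      have hθ : ∀ t, HasDerivAt θ (g t) t := fun t =>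
        (hgc.integral_hasStrictDerivAt T t).hasDerivAt
      have hg0 : ∀ t, t ∉ Ioo 0 T → g t = 0 := fun t ht => by
        by_contra hne
        exact ht (hgt (subset_tsupport _ hne))
      obtain ⟨T', hT', hT'g⟩ : ∃ T' < T, ∀ t ∈ Icc T' T, g t = 0 := by
        have hcl : IsClosed (tsupport g ∪ Iic 0) := (isClosed_tsupport g).union isClosed_Iic
        have hTn : T ∈ (tsupport g ∪ Iic 0)ᶜ := by
          rintro (hc | hc)
          · exact lt_irrefl _ (hgt hc).2
          · exact absurd hc (not_le.2 hT)
        obtain ⟨ε, hε, hball⟩ := Metric.isOpen_iff.1 hcl.isOpen_compl T hTn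
        refine ⟨T - ε / 2, by linarith, fun t ht => ?_⟩
        have : t ∈ Metric.ball T ε := by
          rw [Metric.mem_ball, Real.dist_eq, abs_lt]
          constructor <;> linarith [ht.1, ht.2]
        by_contra hne
        exact hball this (Or.inl (subset_tsupport _ hne))
      have hθ0 : ∀ t ∈ Icc T' T, θ t = 0 := by
        intro t ht
        refine intervalIntegral.integral_zero_ae (Filter.Eventually.of_forall fun σ hσ => ?_)
        rw [uIoc_of_ge ht.2] at hσ
        exact hT'g σ ⟨ht.1.trans hσ.1.le, hσ.2⟩
      have hw := h θ g hθ hgc T' hT' hθ0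
      have hθa : AbsolutelyContinuousOnInterval θ 0 T :=
        (hgc.intervalIntegrable 0 T).absolutelyContinuousOnInterval_intervalIntegral (by simp)
      have hibp := hθa.integral_mul_deriv_eq_deriv_mul hG
      have e1 : ∫ t in (0 : ℝ)..T, θ t * deriv G t = ∫ t in Ioo 0 T, θ t * B t := by
        rw [setIntegral_Ioo_eq hT.le]
        refine intervalIntegral.integral_congr_ae ?_
        filter_upwards [hBi.ae_hasDerivAt_integral] with t ht hmem
        rw [(ht (uIoc_subset_uIcc hmem) 0 (by simp)).deriv]
      have e2 : ∫ t in (0 : ℝ)..T, deriv θ t * G t = ∫ t in Ioo 0 T, g t * G t := by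
        rw [setIntegral_Ioo_eq hT.le]
        simp_rw [(hθ _).deriv]
      have e3 : θ 0 = -∫ t in Ioo 0 T, g t := by
        rw [setIntegral_Ioo_eq hT.le, ← intervalIntegral.integral_symm]
      have e4 : θ T = 0 := hθ0 T ⟨hT'.le, le_rfl⟩
      have e5 : G 0 = 0 := intervalIntegral.integral_same
      rw [e1, e2, e4, e5] at hibp
      have hm : ∀ {f : ℝ → ℝ}, IntegrableOn f (Ioo 0 T) →
          IntegrableOn (fun t => g t * f t) (Ioo 0 T) := fun hf =>
        IntegrableOn.continuousOn_mul_of_subset (K := Icc 0 T) hgc.continuousOn hf isCompact_Icc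
          measurableSet_Ioo Ioo_subset_Icc_self
      have e6 : ∫ t, g t • (ℓ - G t - A t) = ∫ t in Ioo 0 T, g t * (ℓ - G t - A t) := by
        refine (setIntegral_eq_integral_of_forall_compl_eq_zero fun t ht => ?_).symm
        rw [hg0 t ht, zero_smul]
      rw [e6]
      have e7 : ∀ t, g t * (ℓ - G t - A t) = g t * ℓ - g t * G t - g t * A t := fun t => by ring
      simp_rw [e7]
      have hgi : IntegrableOn (fun t => g t * ℓ) (Ioo 0 T) := hm (integrableOn_const (by simp))
      have hgd : IntegrableOn (fun t => g t * ℓ - g t * G t) (Ioo 0 T) := hgi.sub (hm hGi)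
      rw [integral_sub hgd (hm hA), integral_sub hgi (hm hGi),
        integral_mul_const]
      rw [e3] at hw
      linarith)
  rw [timeMeasure, ae_restrict_iff' measurableSet_Ioo]
  filter_upwards [hae] with t ht hmem
  have := ht hmem
  rw [setIntegral_Ioo_eq hmem.1.le]
  linarith

/-- Integration in time of linear functionals along a `C¹` path. -/
theorem integral_path_eq {Y : Type*} [NormedAddCommGroup Y] [NormedSpace ℝ Y] {t : ℝ} (ht : 0 < t)
    {Λ : ℝ → Y → ℝ} {Λ₀ : Y →L[ℝ] ℝ} {Γ : ℝ → Y →L[ℝ] ℝ} {y y' : ℝ → Y}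
    (hyc : ContinuousOn y (Icc 0 t)) (hy : ∀ τ ∈ Ioo 0 t, HasDerivAt y (y' τ) τ)
    (hy' : ContinuousOn y' (Icc 0 t)) {b : ℝ → ℝ} (hb : IntegrableOn b (Ioo 0 t))
    (hΓ : ∀ σ z, |Γ σ z| ≤ b σ * ‖z‖)
    (hm : AEStronglyMeasurable (fun p : ℝ × ℝ => Γ p.1 (y' p.2))
      ((volume.restrict (Ioo 0 t)).prod (volume.restrict (Ioo 0 t))))
    (hm2 : ∀ z, AEStronglyMeasurable (fun σ => Γ σ z) (volume.restrict (Ioo 0 t)))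
    (hm3 : AEStronglyMeasurable (fun σ => Γ σ (y σ)) (volume.restrict (Ioo 0 t)))
    (hΛ : ∀ᵐ τ ∂volume.restrict (Ioo 0 t), ∀ z, Λ τ z = Λ₀ z - ∫ σ in Ioo 0 τ, Γ σ z)
    (hΛt : ∀ z, Λ t z = Λ₀ z - ∫ σ in Ioo 0 t, Γ σ z) :
    Λ t (y t) - Λ₀ (y 0) =
      (∫ τ in Ioo 0 t, Λ τ (y' τ)) - ∫ τ in Ioo 0 t, Γ τ (y τ) := by
  set μ : Measure ℝ := volume.restrict (Ioo 0 t)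
  obtain ⟨M, hM⟩ := isCompact_Icc.exists_bound_of_continuousOn hy'
  obtain ⟨M₂, hM₂⟩ := isCompact_Icc.exists_bound_of_continuousOn hyc
  have hM0 : 0 ≤ M := (norm_nonneg _).trans (hM 0 ⟨le_rfl, ht.le⟩)
  have hftc : ∀ (L : Y →L[ℝ] ℝ) (σ : ℝ), 0 ≤ σ → σ ≤ t →
      ∫ τ in Ioo σ t, L (y' τ) = L (y t) - L (y σ) := by
    intro L σ h0 h1
    rw [setIntegral_Ioo_eq h1]
    have hsub : Icc σ t ⊆ Icc 0 t := Icc_subset_Icc_left h0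
    refine intervalIntegral.integral_eq_sub_of_hasDerivAt_of_le h1
      (L.continuous.comp_continuousOn (hyc.mono hsub))
      (fun τ hτ => L.hasFDerivAt.comp_hasDerivAt τ (hy τ ⟨h0.trans_lt hτ.1, hτ.2⟩)) ?_
    refine ContinuousOn.intervalIntegrable ?_
    rw [uIcc_of_le h1]
    exact L.continuous.comp_continuousOn (hy'.mono hsub)
  have hS : MeasurableSet {p : ℝ × ℝ | p.1 < p.2} := measurableSet_lt measurable_fst measurable_snd
  -- No derivative of `Λ` in time is used. The term `∫ (∫_0^τ Γ σ (y' τ) dσ) dτ` is an integral over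
  -- the triangle `σ < τ`; after the exchange of the order the inner integral of `y'` over `(σ, t)`
  -- gives `Γ σ (y t) - Γ σ (y σ)`.
  set F : ℝ × ℝ → ℝ := {p : ℝ × ℝ | p.1 < p.2}.indicator fun p => Γ p.1 (y' p.2)
  have hFm : AEStronglyMeasurable F (μ.prod μ) := hm.indicator hS
  have hFi : Integrable F (μ.prod μ) := by
    have hdom : Integrable (fun p : ℝ × ℝ => |b p.1| * M) (μ.prod μ) :=
      Integrable.mul_prod hb.abs (integrable_const M)
    refine hdom.mono' hFm ?_
    have hmem : ∀ᵐ p ∂μ.prod μ, p.2 ∈ Ioo 0 t :=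
      Measure.quasiMeasurePreserving_snd.ae (ae_restrict_mem measurableSet_Ioo)
    filter_upwards [hmem] with p hp
    refine (norm_indicator_le_norm_self _ _).trans ?_
    refine (hΓ p.1 (y' p.2)).trans ?_
    have := hM p.2 (Ioo_subset_Icc_self hp)
    gcongr
    exact le_abs_self _
  have e1 : ∫ τ, Λ τ (y' τ) ∂μ = ∫ τ, (Λ₀ (y' τ) - ∫ σ, F (σ, τ) ∂μ) ∂μ := by
    refine integral_congr_ae ?_
    filter_upwards [hΛ, ae_restrict_mem measurableSet_Ioo] with τ hτ hmem
    rw [hτ]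
    congr 1
    have : ∀ σ, F (σ, τ) = (Iio τ).indicator (fun σ => Γ σ (y' τ)) σ := fun σ => rfl
    simp_rw [this]
    rw [integral_indicator measurableSet_Iio, Measure.restrict_restrict measurableSet_Iio]
    congr 2
    ext σ
    simp only [mem_Ioo, mem_inter_iff, mem_Iio]
    constructor
    · rintro ⟨h1, h2⟩
      exact ⟨h2, h1, h2.trans hmem.2⟩
    · rintro ⟨h1, h2, -⟩
      exact ⟨h2, h1⟩
  have e2 : ∫ τ, (∫ σ, F (σ, τ) ∂μ) ∂μ = ∫ σ, (Γ σ (y t) - Γ σ (y σ)) ∂μ := by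
    rw [integral_integral_swap (f := fun τ σ => F (σ, τ)) hFi.swap]
    refine integral_congr_ae ?_
    filter_upwards [ae_restrict_mem measurableSet_Ioo] with σ hmem
    have : ∀ τ, F (σ, τ) = (Ioi σ).indicator (fun τ => Γ σ (y' τ)) τ := fun τ => rfl
    simp_rw [this]
    rw [integral_indicator measurableSet_Ioi, Measure.restrict_restrict measurableSet_Ioi,
      ← hftc (Γ σ) σ hmem.1.le hmem.2.le]
    congr 2
    ext τ
    simp only [mem_Ioo, mem_inter_iff, mem_Ioi]
    constructor
    · rintro ⟨h1, -, h3⟩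
      exact ⟨h1, h3⟩
    · rintro ⟨h1, h2⟩
      exact ⟨h1, hmem.1.trans h1, h2⟩
  have hi1 : Integrable (fun τ => Λ₀ (y' τ)) μ :=
    ((Λ₀.continuous.comp_continuousOn hy').integrableOn_compact isCompact_Icc).mono_set
      Ioo_subset_Icc_self
  have hi2 : Integrable (fun τ => ∫ σ, F (σ, τ) ∂μ) μ := hFi.integral_prod_right
  have hi3 : Integrable (fun σ => Γ σ (y t)) μ :=
    (hb.mul_const ‖y t‖).mono' (hm2 _) (Filter.Eventually.of_forall fun σ => hΓ σ _)
  have hi4 : Integrable (fun σ => Γ σ (y σ)) μ := by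
    refine ((hb.norm).mul_const M₂).mono' hm3 ?_
    filter_upwards [ae_restrict_mem measurableSet_Ioo] with σ hmem
    refine (hΓ σ _).trans ?_
    have := hM₂ σ (Ioo_subset_Icc_self hmem)
    gcongr
    exact le_abs_self _
  have e3 := hftc Λ₀ 0 le_rfl ht.le
  rw [e1, integral_sub hi1 hi2, e2, integral_sub hi3 hi4, hΛt, e3]
  ring

theorem integrable_norm_of_memLp {α F : Type*} [MeasurableSpace α] [NormedAddCommGroup F]
    {μ : Measure α} [IsFiniteMeasure μ] {f : α → F} {p : ℝ≥0∞} (hp : 1 ≤ p) (h : MemLp f p μ) :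
    Integrable (fun x => ‖f x‖) μ :=
  (h.integrable hp).norm

section WeakSolution

variable {ν T : ℝ} {f₁ : ℝ → HNeg1 Ω} {f₂ : ℝ → L2 Ω (Vec d)} {v₀ : L2sol Ω} {v : ℝ → H10sol Ω}

theorem IsStateX.integrableOn_norm_sq (hv : IsStateX T v) :
    IntegrableOn (fun σ => ‖v σ‖ ^ 2) (Ioo 0 T) := by
  have h : MemLp v 2 (volume.restrict (Ioo 0 T)) := hv.1
  exact h.integrable_norm_pow (by norm_num)

theorem IsStateX.integrableOn_bound (hv : IsStateX T v) (hf₁ : MemLp f₁ 2 (timeMeasure T))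
    (hf₂ : MemLp f₂ 1 (timeMeasure T)) :
    IntegrableOn (fun σ => ‖v σ‖ + ‖v σ‖ ^ 2 + ‖f₁ σ‖ + ‖f₂ σ‖) (Ioo 0 T) := by
  have h1 : IntegrableOn (fun σ => ‖v σ‖) (Ioo 0 T) := integrable_norm_of_memLp one_le_two hv.1
  have h2 : IntegrableOn (fun σ => ‖f₁ σ‖) (Ioo 0 T) :=
    integrable_norm_of_memLp (F := HNeg1 Ω) one_le_two hf₁
  have h3 : IntegrableOn (fun σ => ‖f₂ σ‖) (Ioo 0 T) := integrable_norm_of_memLp le_rfl hf₂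
  exact ((h1.add hv.integrableOn_norm_sq).add h2).add h3

/-- The data of the equation at a time, as one measurable function. -/
theorem aestronglyMeasurable_data (hv : IsStateX T v) (hf₁ : MemLp f₁ 2 (timeMeasure T))
    (hf₂ : MemLp f₂ 1 (timeMeasure T)) :
    AEStronglyMeasurable (fun σ => (v σ, f₁ σ, f₂ σ)) (volume.restrict (Ioo 0 T)) :=
  hv.1.1.prodMk (hf₁.1.prodMk hf₂.1)

theorem SolenoidalMollifier.aestronglyMeasurable_weakForm (S : SolenoidalMollifier Ω) (n : ℕ)
    (ν : ℝ) {α : Type*} [MeasurableSpace α] {μ : Measure α} {a : α → H10sol Ω} {g₁ : α → HNeg1 Ω}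
    {g₂ : α → L2 Ω (Vec d)} {y : α → H10sol Ω}
    (h : AEStronglyMeasurable (fun p => (a p, g₁ p, g₂ p)) μ) (hy : AEStronglyMeasurable y μ) :
    AEStronglyMeasurable (fun p => weakForm ν (a p) (g₁ p) (g₂ p) (S.opH n (y p))) μ := by
  have hc : Continuous fun p : (H10sol Ω × HNeg1 Ω × L2 Ω (Vec d)) × H10sol Ω =>
      weakForm ν p.1.1 p.1.2.1 p.1.2.2 (S.opH n p.2) := by
    have h1 : Continuous fun p : (H10sol Ω × HNeg1 Ω × L2 Ω (Vec d)) × H10sol Ω =>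
      (p.1.1, p.1.2.1, p.1.2.2, p.2) := by fun_prop
    have h2 := (S.continuous_weakForm n ν).comp h1
    simpa only [Function.comp_def] using h2
  have hp : AEStronglyMeasurable (fun p => ((a p, g₁ p, g₂ p), y p)) μ := h.prodMk hy
  have h3 := hc.comp_aestronglyMeasurable hp
  exact h3

/-- The equation integrated in time, for mollified test fields. -/
theorem IsWeakSolution.ae_inner_opH_eq (hw : IsWeakSolution ν T f₁ f₂ v₀ v) (hT : 0 < T)
    (hν : 0 ≤ ν) (hf₁ : MemLp f₁ 2 (timeMeasure T)) (hf₂ : MemLp f₂ 1 (timeMeasure T))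
    (S : SolenoidalMollifier Ω) (n : ℕ) :
    ∀ᵐ t ∂timeMeasure T, ∀ y : H10sol Ω, inner ℝ (val (v t)) (val (S.opH n y)) =
      inner ℝ (v₀ : L2 Ω (Vec d)) (val (S.opH n y)) -
        ∫ σ in Ioo 0 t, weakForm ν (v σ) (f₁ σ) (f₂ σ) (S.opH n y) := by
  obtain ⟨B, hB, hbd⟩ := S.exists_abs_weakForm_le n hν
  have hdata := aestronglyMeasurable_data hw.state hf₁ hf₂
  have hbi := hw.state.integrableOn_bound hf₁ hf₂
  have hwm : ∀ y : H10sol Ω, AEStronglyMeasurable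
      (fun σ => weakForm ν (v σ) (f₁ σ) (f₂ σ) (S.opH n y)) (volume.restrict (Ioo 0 T)) :=
    fun y => S.aestronglyMeasurable_weakForm n ν hdata aestronglyMeasurable_const
  have hwi : ∀ y : H10sol Ω,
      IntegrableOn (fun σ => weakForm ν (v σ) (f₁ σ) (f₂ σ) (S.opH n y)) (Ioo 0 T) := fun y =>
    ((hbi.const_mul B).mul_const ‖y‖).mono' (hwm y)
      (Filter.Eventually.of_forall fun σ => hbd _ _ _ _)
  have hv2 : MemLp v 2 (volume.restrict (Ioo 0 T)) := hw.state.1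
  have hfix : ∀ y : H10sol Ω, ∀ᵐ t ∂timeMeasure T, inner ℝ (val (v t)) (val (S.opH n y)) =
      inner ℝ (v₀ : L2 Ω (Vec d)) (val (S.opH n y)) -
        ∫ σ in Ioo 0 t, weakForm ν (v σ) (f₁ σ) (f₂ σ) (S.opH n y) := by
    intro y
    have hA : IntegrableOn (fun t => inner ℝ (val (v t)) (val (S.opH n y))) (Ioo 0 T) :=
      (((valCLM Ω).comp_memLp' hv2).integrable one_le_two).inner_const _
    have hp : IntegrableOn (fun t => pairing (f₁ t) (f₂ t) (S.opH n y)) (Ioo 0 T) := by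
      refine ((hbi.mul_const ‖S.opH n y‖)).mono' ?_ (Filter.Eventually.of_forall fun σ => ?_)
      · exact continuous_pairing.comp_aestronglyMeasurable
          (hf₁.1.prodMk (hf₂.1.prodMk aestronglyMeasurable_const))
      · refine (abs_pairing_le _ _ _).trans ?_
        have := norm_val_le (S.opH n y)
        calc _ ≤ ‖f₁ σ‖ * ‖S.opH n y‖ + ‖f₂ σ‖ * ‖S.opH n y‖ := by gcongr
          _ = (0 + 0 + ‖f₁ σ‖ + ‖f₂ σ‖) * ‖S.opH n y‖ := by ring
          _ ≤ _ := by gcongr <;> positivity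
    exact ae_eq_sub_integral hT hA (hwi y) fun θ θ' hθ hθ' T' hT' h0 =>
      hw.weak_form_smul (S.isSolenoidal n _ (val_mem_L2sol y)) (hwi y) hp hθ hθ' hT' h0
  -- The null set in `hfix` depends on `y`. A dense sequence reduces this to countably many null
  -- sets, and both sides are continuous in `y`, so a single null set serves all of `H¹_{0,σ}`.
  have hall := ae_all_iff.2 fun k => hfix (denseSeq (H10sol Ω) k)
  filter_upwards [hall, (ae_restrict_mem measurableSet_Ioo : ∀ᵐ t ∂timeMeasure T, t ∈ Ioo 0 T)]
    with t ht hmem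
  have hsub : Ioo 0 t ⊆ Ioo 0 T := Ioo_subset_Ioo_right hmem.2.le
  have hc1 : Continuous fun y => val (S.opH n y) :=
    (valCLM Ω).continuous.comp (S.opH n).continuous
  have hc2 : Continuous fun y =>
      ∫ σ in Ioo 0 t, weakForm ν (v σ) (f₁ σ) (f₂ σ) (S.opH n y) := by
    rw [continuous_iff_continuousAt]
    intro y₀
    refine continuousAt_of_dominated (bound := fun σ =>
      B * (‖v σ‖ + ‖v σ‖ ^ 2 + ‖f₁ σ‖ + ‖f₂ σ‖) * (‖y₀‖ + 1))
      (Filter.Eventually.of_forall fun y => (hwm y).mono_set hsub) ?_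
      (((hbi.mono_set hsub).const_mul B).mul_const _) ?_
    · have hev : ∀ᶠ y in 𝓝 y₀, ‖y‖ < ‖y₀‖ + 1 :=
        continuous_norm.continuousAt.eventually_lt_const (by linarith)
      filter_upwards [hev] with y hy
      refine Filter.Eventually.of_forall fun σ => (hbd _ _ _ _).trans ?_
      gcongr
    · refine Filter.Eventually.of_forall fun σ => ?_
      have h1 : Continuous fun y : H10sol Ω => (v σ, f₁ σ, f₂ σ, y) := by fun_prop
      have h2 := (S.continuous_weakForm n ν).comp h1
      simp only [Function.comp_def] at h2
      exact h2.continuousAt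
  have := Continuous.ext_on (denseRange_denseSeq (H10sol Ω))
    (Continuous.inner continuous_const hc1) ((Continuous.inner continuous_const hc1).sub hc2)
    (by
      rintro _ ⟨k, rfl⟩
      exact ht k)
  exact fun y => congrFun this y

end WeakSolution

/-! ### Lebesgue norms and the equation along paths -/

/-- The `L^r` norm may be infinite and discontinuous on `L²`, but it is lower semicontinuous by
Fatou's lemma along an almost everywhere convergent subsequence. This suffices for the measurability
of `‖w(τ)‖_r` in time. -/
theorem lowerSemicontinuous_eLpNorm (r : ℝ≥0∞) : LowerSemicontinuous fun u : L2 Ω (Vec d) =>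
    eLpNorm u r (volume.restrict (Ω : Set (Vec d))) := by
  rw [lowerSemicontinuous_iff_isClosed_preimage]
  intro c
  refine isClosed_of_closure_subset fun u hu => ?_
  obtain ⟨x, hx, hlim⟩ := mem_closure_iff_seq_limit.1 hu
  obtain ⟨ns, -, hae⟩ := (tendstoInMeasure_of_tendsto_Lp hlim).exists_seq_tendsto_ae
  refine (Lp.eLpNorm_lim_le_liminf_eLpNorm (f := fun n => (x (ns n) : Vec d → Vec d))
    (fun n => Lp.aestronglyMeasurable _) _ hae).trans ?_
  exact Filter.liminf_le_of_frequently_le' (Filter.Frequently.of_forall fun n => hx (ns n))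

theorem aemeasurable_eLpNorm {α : Type*} [MeasurableSpace α] {μ : Measure α} {y : α → L2 Ω (Vec d)}
    (hy : AEStronglyMeasurable y μ) (r : ℝ≥0∞) :
    AEMeasurable (fun t => eLpNorm (y t) r (volume.restrict (Ω : Set (Vec d)))) μ := by
  let : MeasurableSpace (L2 Ω (Vec d)) := borel _
  have : BorelSpace (L2 Ω (Vec d)) := ⟨rfl⟩
  exact (lowerSemicontinuous_eLpNorm r).measurable.comp_aemeasurable hy.aemeasurable

/-- A `C¹` path in `H¹_{0,σ}` on `[0,t]` with derivative `w'`. -/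
structure IsC1Path (t : ℝ) (w w' : ℝ → H10sol Ω) : Prop where
  continuousOn : ContinuousOn w (Icc 0 t)
  hasDerivAt : ∀ τ ∈ Ioo 0 t, HasDerivAt w (w' τ) τ
  continuousOn_deriv : ContinuousOn w' (Icc 0 t)

namespace IsC1Path

variable {t : ℝ} {w w' : ℝ → H10sol Ω}

theorem aestronglyMeasurable (h : IsC1Path t w w') :
    AEStronglyMeasurable w (volume.restrict (Ioo 0 t)) :=
  (h.continuousOn.mono Ioo_subset_Icc_self).aestronglyMeasurable measurableSet_Ioo

theorem aestronglyMeasurable_deriv (h : IsC1Path t w w') :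
    AEStronglyMeasurable w' (volume.restrict (Ioo 0 t)) :=
  (h.continuousOn_deriv.mono Ioo_subset_Icc_self).aestronglyMeasurable measurableSet_Ioo

theorem exists_bound (h : IsC1Path t w w') :
    ∃ M : ℝ, 0 ≤ M ∧ ∀ τ ∈ Ioo 0 t, ‖w τ‖ ≤ M ∧ ‖w' τ‖ ≤ M := by
  obtain ⟨M₁, h₁⟩ := isCompact_Icc.exists_bound_of_continuousOn h.continuousOn
  obtain ⟨M₂, h₂⟩ := isCompact_Icc.exists_bound_of_continuousOn h.continuousOn_deriv
  exact ⟨max 0 (max M₁ M₂), le_max_left _ _, fun τ hτ =>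
    ⟨(h₁ τ (Ioo_subset_Icc_self hτ)).trans ((le_max_left _ _).trans (le_max_right _ _)),
      (h₂ τ (Ioo_subset_Icc_self hτ)).trans ((le_max_right _ _).trans (le_max_right _ _))⟩⟩

end IsC1Path

section WeakSolution

variable {ν T : ℝ} {f₁ : ℝ → HNeg1 Ω} {f₂ : ℝ → L2 Ω (Vec d)} {v₀ : L2sol Ω} {v : ℝ → H10sol Ω}

theorem IsStateX.exists_norm_val_le (hv : IsStateX T v) :
    ∃ V : ℝ, 0 ≤ V ∧ ∀ᵐ t ∂volume.restrict (Ioo 0 T), ‖val (v t)‖ ≤ V := by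
  have h : MemLp (fun t => val (v t)) ⊤ (volume.restrict (Ioo 0 T)) := hv.2
  refine ⟨(eLpNorm (fun t => val (v t)) ⊤ (volume.restrict (Ioo 0 T))).toReal,
    ENNReal.toReal_nonneg, ?_⟩
  filter_upwards [enorm_ae_le_eLpNormEssSup (fun t => val (v t)) (volume.restrict (Ioo 0 T))]
    with t ht
  rw [← eLpNorm_exponent_top] at ht
  have := ENNReal.toReal_mono h.eLpNorm_ne_top ht
  rwa [toReal_enorm] at this

/-- The equation integrated in time along a path of mollified test fields. -/
theorem IsWeakSolution.ae_inner_opH_path_eq (hw : IsWeakSolution ν T f₁ f₂ v₀ v) (hT : 0 < T)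
    (hν : 0 ≤ ν) (hf₁ : MemLp f₁ 2 (timeMeasure T)) (hf₂ : MemLp f₂ 1 (timeMeasure T))
    (S : SolenoidalMollifier Ω) (n : ℕ) :
    ∀ᵐ t ∂timeMeasure T, ∀ w w' : ℝ → H10sol Ω, IsC1Path t w w' →
      inner ℝ (val (v t)) (val (S.opH n (w t))) -
          inner ℝ (v₀ : L2 Ω (Vec d)) (val (S.opH n (w 0))) =
        (∫ τ in Ioo 0 t, inner ℝ (val (v τ)) (val (S.opH n (w' τ)))) -
          ∫ τ in Ioo 0 t, weakForm ν (v τ) (f₁ τ) (f₂ τ) (S.opH n (w τ)) := by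
  have h := hw.ae_inner_opH_eq hT hν hf₁ hf₂ S n
  obtain ⟨B, hB, hbd⟩ := S.exists_abs_weakForm_le n hν
  choose Γ hΓ using fun σ => S.exists_weakForm_clm n hν (v σ) (f₁ σ) (f₂ σ)
  have hdata := aestronglyMeasurable_data hw.state hf₁ hf₂
  have hbi := hw.state.integrableOn_bound hf₁ hf₂
  filter_upwards [h, (ae_restrict_mem measurableSet_Ioo : ∀ᵐ t ∂timeMeasure T, t ∈ Ioo 0 T)]
    with t ht hmem w w' hp
  have hsub : Ioo 0 t ⊆ Ioo 0 T := Ioo_subset_Ioo_right hmem.2.le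
  have hdata' := hdata.mono_set hsub
  have h' : ∀ᵐ τ ∂volume.restrict (Ioo 0 t), ∀ y : H10sol Ω,
      inner ℝ (val (v τ)) (val (S.opH n y)) =
      inner ℝ (v₀ : L2 Ω (Vec d)) (val (S.opH n y)) -
        ∫ σ in Ioo 0 τ, weakForm ν (v σ) (f₁ σ) (f₂ σ) (S.opH n y) :=
    ae_restrict_of_ae_restrict_of_subset hsub h
  have hkey := integral_path_eq (Y := H10sol Ω) hmem.1
    (Λ := fun τ y => inner ℝ (val (v τ)) (val (S.opH n y)))
    (Λ₀ := (innerSL ℝ (v₀ : L2 Ω (Vec d))).comp ((valCLM Ω).comp (S.opH n))) (Γ := Γ)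
    hp.continuousOn hp.hasDerivAt hp.continuousOn_deriv
    (b := fun σ => B * (‖v σ‖ + ‖v σ‖ ^ 2 + ‖f₁ σ‖ + ‖f₂ σ‖))
    ((hbi.mono_set hsub).const_mul B) (fun σ z => by rw [hΓ]; exact hbd _ _ _ _)
    (by
      simp_rw [hΓ]
      exact S.aestronglyMeasurable_weakForm n ν hdata'.comp_fst
        hp.aestronglyMeasurable_deriv.comp_snd)
    (fun z => by
      simp_rw [hΓ]
      exact S.aestronglyMeasurable_weakForm n ν hdata' aestronglyMeasurable_const)
    (by
      simp_rw [hΓ]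
      exact S.aestronglyMeasurable_weakForm n ν hdata' hp.aestronglyMeasurable)
    (by
      simp_rw [hΓ]
      exact h')
    (by
      simp_rw [hΓ]
      exact ht)
  simp_rw [hΓ] at hkey
  exact hkey

end WeakSolution

/-! ### Gronwall's inequality -/

theorem absolutelyContinuousOnInterval_exp_neg {G : ℝ → ℝ} {a b : ℝ}
    (hG : AbsolutelyContinuousOnInterval G a b) (h0 : ∀ x ∈ uIcc a b, 0 ≤ G x) :
    AbsolutelyContinuousOnInterval (fun x => Real.exp (-G x)) a b := by
  have hlip : ∀ x y : ℝ, 0 ≤ x → x ≤ y → Real.exp (-x) - Real.exp (-y) ≤ y - x := by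
    intro x y hx hxy
    have h1 : Real.exp (-y) = Real.exp (-x) * Real.exp (x - y) := by
      rw [← Real.exp_add]
      congr 1
      ring
    have h2 := Real.add_one_le_exp (x - y)
    have h3 : Real.exp (-x) ≤ 1 := Real.exp_le_one_iff.2 (by linarith)
    have h4 := Real.exp_pos (-x)
    rw [h1]
    nlinarith
  have hdist : ∀ x y : ℝ, 0 ≤ x → 0 ≤ y → dist (Real.exp (-x)) (Real.exp (-y)) ≤ dist x y := by
    intro x y hx hy
    rw [Real.dist_eq, Real.dist_eq]
    rcases le_total x y with h | h
    · rw [abs_of_nonneg (sub_nonneg.2 (Real.exp_le_exp.2 (by linarith))), abs_sub_comm,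
        abs_of_nonneg (sub_nonneg.2 h)]
      exact hlip x y hx h
    · rw [abs_sub_comm, abs_of_nonneg (sub_nonneg.2 (Real.exp_le_exp.2 (by linarith))),
        abs_of_nonneg (sub_nonneg.2 h)]
      exact hlip y x hy h
  refine squeeze_zero' (Filter.Eventually.of_forall fun E => Finset.sum_nonneg fun i _ =>
    dist_nonneg) ?_ hG
  refine Filter.eventually_inf_principal.2 (Filter.Eventually.of_forall fun E hE => ?_)
  exact Finset.sum_le_sum fun i hi => hdist _ _ (h0 _ (hE.1 i hi).1) (h0 _ (hE.1 i hi).2)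

/-- The integral form of Gronwall's inequality, with a source term. -/
theorem gronwall_integral {t R₀ : ℝ} (ht : 0 < t) {g k R : ℝ → ℝ} (hg : IntegrableOn g (Ioo 0 t))
    (hk : IntegrableOn k (Ioo 0 t)) (hkR : IntegrableOn (fun τ => k τ * R τ) (Ioo 0 t))
    (hk0 : ∀ τ, 0 ≤ k τ)
    (h : ∀ᵐ τ ∂volume.restrict (Ioo 0 t),
      R τ ≤ R₀ - (∫ σ in Ioo 0 τ, g σ) + ∫ σ in Ioo 0 τ, k σ * R σ)
    (hR : R t ≤ R₀ - (∫ σ in Ioo 0 t, g σ) + ∫ σ in Ioo 0 t, k σ * R σ) :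
    IntegrableOn (fun τ => g τ * Real.exp (∫ σ in Ioo τ t, k σ)) (Ioo 0 t) ∧
      R t + ∫ τ in Ioo 0 t, g τ * Real.exp (∫ σ in Ioo τ t, k σ) ≤
        R₀ * Real.exp (∫ σ in Ioo 0 t, k σ) := by
  have hgi := (integrableOn_Ioo_iff ht.le).1 hg
  have hki := (integrableOn_Ioo_iff ht.le).1 hk
  have hkRi := (integrableOn_Ioo_iff ht.le).1 hkR
  have hmi : IntervalIntegrable (fun τ => k τ * R τ - g τ) volume 0 t := hkRi.sub hgi
  set G : ℝ → ℝ := fun x => ∫ σ in (0 : ℝ)..x, k σ with hG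
  -- `R` need not be continuous. The absolutely continuous function `F` majorizes it almost
  -- everywhere and at `t`, and can be differentiated in its place.
  set F : ℝ → ℝ := fun x => R₀ + ∫ σ in (0 : ℝ)..x, (k σ * R σ - g σ) with hF
  set E : ℝ → ℝ := fun x => Real.exp (-G x) with hE
  have hu : uIcc 0 t = Icc 0 t := uIcc_of_le ht.le
  have hGac : AbsolutelyContinuousOnInterval G 0 t :=
    hki.absolutelyContinuousOnInterval_intervalIntegral (by simp)
  have hG0 : ∀ x ∈ uIcc 0 t, 0 ≤ G x := fun x hx => by
    rw [hu] at hx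
    exact intervalIntegral.integral_nonneg_of_forall hx.1 hk0
  have hEac : AbsolutelyContinuousOnInterval E 0 t :=
    absolutelyContinuousOnInterval_exp_neg hGac hG0
  have hcac : AbsolutelyContinuousOnInterval (fun _ : ℝ => R₀) 0 t :=
    ((LipschitzWith.const R₀).lipschitzOnWith (s := uIcc 0 t)).absolutelyContinuousOnInterval
  have hFac : AbsolutelyContinuousOnInterval F 0 t :=
    hcac.add (hmi.absolutelyContinuousOnInterval_intervalIntegral (by simp))
  have hFeq : ∀ τ ∈ Icc 0 t,
      F τ = R₀ - (∫ σ in Ioo 0 τ, g σ) + ∫ σ in Ioo 0 τ, k σ * R σ := by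
    intro τ hτ
    have hsub : uIcc 0 τ ⊆ uIcc 0 t := by
      rw [hu, uIcc_of_le hτ.1]
      exact Icc_subset_Icc_right hτ.2
    rw [setIntegral_Ioo_eq hτ.1, setIntegral_Ioo_eq hτ.1, hF]
    simp only
    rw [intervalIntegral.integral_sub (hkRi.mono_set hsub) (hgi.mono_set hsub)]
    ring
  have hkey := hFac.integral_deriv_mul_eq_sub hEac
  have hFt : R t ≤ F t := by
    rw [hFeq t ⟨ht.le, le_rfl⟩]
    exact hR
  have hF0 : F 0 = R₀ := by simp [hF]
  have hE0 : E 0 = 1 := by simp [hE, hG]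
  have hder : ∀ᵐ x ∂volume.restrict (Ioo 0 t), deriv F x * E x + F x * deriv E x =
      (k x * R x - g x) * E x + F x * (E x * -k x) := by
    have h1 := ae_restrict_of_ae (s := Ioo 0 t) hmi.ae_hasDerivAt_integral
    have h2 := ae_restrict_of_ae (s := Ioo 0 t) hki.ae_hasDerivAt_integral
    filter_upwards [h1, h2, ae_restrict_mem measurableSet_Ioo] with x h1 h2 hx
    have hx' : x ∈ uIcc 0 t := by
      rw [hu]
      exact Ioo_subset_Icc_self hx
    have h3 : HasDerivAt F (k x * R x - g x) x := (h1 hx' 0 (by simp)).const_add R₀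
    have h4 : HasDerivAt E (E x * -k x) x := (h2 hx' 0 (by simp)).neg.exp
    rw [h3.deriv, h4.deriv]
  have hi1 : IntervalIntegrable (fun x => g x * E x) volume 0 t :=
    hgi.mul_continuousOn hEac.continuousOn
  have hi2 : IntervalIntegrable (fun x => (k x * R x - g x) * E x + F x * (E x * -k x))
      volume 0 t :=
    (hmi.mul_continuousOn hEac.continuousOn).add
      ((hki.neg.continuousOn_mul hEac.continuousOn).continuousOn_mul hFac.continuousOn)
  -- Almost everywhere `(F E)' = (k R - g - k F) E ≤ -g E`, because `R ≤ F` and `k ≥ 0`.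
  -- Multiplication by `exp (G t)` afterwards gives the weights `exp (∫_τ^t k)`.
  have hle : F t * E t - R₀ ≤ -∫ x in Ioo 0 t, g x * E x := by
    have e : F t * E t - F 0 * E 0 =
        ∫ x in Ioo 0 t, ((k x * R x - g x) * E x + F x * (E x * -k x)) := by
      rw [← hkey, ← setIntegral_Ioo_eq ht.le]
      exact integral_congr_ae hder
    rw [hF0, hE0, mul_one] at e
    rw [e, ← integral_neg]
    refine integral_mono_ae ((integrableOn_Ioo_iff ht.le).2 hi2)
      ((integrableOn_Ioo_iff ht.le).2 hi1).neg ?_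
    filter_upwards [h, ae_restrict_mem measurableSet_Ioo] with x hx hxt
    rw [← hFeq x (Ioo_subset_Icc_self hxt)] at hx
    have h1 : 0 ≤ k x * E x := mul_nonneg (hk0 x) (Real.exp_pos _).le
    nlinarith [mul_nonneg h1 (sub_nonneg.2 hx)]
  have hGI : ∀ τ ∈ Ioo 0 t, g τ * Real.exp (∫ σ in Ioo τ t, k σ) =
      Real.exp (G t) * (g τ * E τ) := by
    intro τ hτ
    have hm : τ ∈ uIcc 0 t := by
      rw [hu]
      exact Ioo_subset_Icc_self hτ
    have e : ∫ σ in Ioo τ t, k σ = G t + -G τ := by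
      rw [setIntegral_Ioo_eq hτ.2.le, hG, ← sub_eq_add_neg]
      refine (intervalIntegral.integral_interval_sub_left hki (hki.mono_set ?_)).symm
      exact uIcc_subset_uIcc left_mem_uIcc hm
    rw [e, Real.exp_add]
    ring
  have hgE := (integrableOn_Ioo_iff ht.le).2 hi1
  have hgE' : IntegrableOn (fun τ => Real.exp (G t) * (g τ * E τ)) (Ioo 0 t) := hgE.const_mul _
  have hGt : ∫ σ in Ioo 0 t, k σ = G t := setIntegral_Ioo_eq ht.le
  refine ⟨hgE'.congr_fun (fun τ hτ => (hGI τ hτ).symm) measurableSet_Ioo, ?_⟩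
  rw [setIntegral_congr_fun measurableSet_Ioo hGI, integral_const_mul, hGt]
  have hEt : E t * Real.exp (G t) = 1 := by
    rw [hE, ← Real.exp_add]
    simp
  have hm := mul_le_mul_of_nonneg_right hle (Real.exp_pos (G t)).le
  have e1 : (F t * E t - R₀) * Real.exp (G t) = F t - R₀ * Real.exp (G t) := by
    linear_combination F t * hEt
  rw [e1] at hm
  linarith

/-! ### Integrability in time and removal of the mollification -/

theorem val_sub (y z : H10sol Ω) : val (y - z) = val y - val z := rfl

theorem grad_sub (y z : H10sol Ω) : grad (y - z) = grad y - grad z := rfl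

theorem pairing_zero (y : H10sol Ω) : pairing 0 0 y = 0 := by
  rw [pairing, inner_zero_left, add_zero]
  rfl

theorem integrable_norm_sq_of_memLp {α F : Type*} [MeasurableSpace α] [NormedAddCommGroup F]
    {μ : Measure α} {f : α → F} (h : MemLp f 2 μ) : Integrable (fun x => ‖f x‖ ^ 2) μ :=
  h.integrable_norm_pow (by norm_num)

theorem memLp_zero_fun {α F : Type*} [MeasurableSpace α] [NormedAddCommGroup F] (μ : Measure α)
    (p : ℝ≥0∞) : MemLp (fun _ : α => (0 : F)) p μ :=
  MemLp.zero'

theorem memLp_restrict_mono {F : Type*} [NormedAddCommGroup F] {f : ℝ → F} {p : ℝ≥0∞} {A B : Set ℝ}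
    (h : MemLp f p (volume.restrict B)) (hAB : A ⊆ B) : MemLp f p (volume.restrict A) :=
  h.mono_measure (Measure.restrict_mono_set _ hAB)

theorem integrable_affine_bound {α : Type*} [MeasurableSpace α] {μ : Measure α} [IsFiniteMeasure μ]
    {e f g h : α → ℝ} (he : Integrable e μ) (hf : Integrable f μ) (hg : Integrable g μ)
    (hh : Integrable h μ) (c₁ c₂ c₃ c₄ c₅ : ℝ) :
    Integrable (fun p => c₁ * (e p + c₂) + (c₃ * e p + c₄ * f p) + (g p + h p) * c₅) μ :=
  (((he.add (integrable_const _)).const_mul _).add ((he.const_mul _).add (hf.const_mul _))).add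
    ((hg.add hh).mul_const _)

section Bounds

variable {α : Type*} [MeasurableSpace α] {μ : Measure α} {g₁ : α → HNeg1 Ω}
  {g₂ : α → L2 Ω (Vec d)} {a y : α → H10sol Ω} {V M s : ℝ} {r : ℝ≥0∞}

theorem integrable_pairing (hg₁ : MemLp g₁ 2 μ) (hg₂ : MemLp g₂ 1 μ)
    (hy : AEStronglyMeasurable y μ) (hy2 : Integrable (fun p => ‖y p‖ ^ 2) μ)
    (hV : ∀ᵐ p ∂μ, ‖val (y p)‖ ≤ V) :
    Integrable (fun p => pairing (g₁ p) (g₂ p) (y p)) μ := by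
  have h1 : Integrable (fun p => ‖g₁ p‖ ^ 2) μ :=
    integrable_norm_sq_of_memLp (F := HNeg1 Ω) hg₁
  have h2 : Integrable (fun p => ‖g₂ p‖) μ := (memLp_one_iff_integrable.1 hg₂).norm
  refine ((h1.add hy2).add (h2.mul_const V)).mono'
    (continuous_pairing.comp_aestronglyMeasurable (hg₁.1.prodMk (hg₂.1.prodMk hy))) ?_
  filter_upwards [hV] with p hp
  refine (abs_pairing_le _ _ _).trans ?_
  simp only [Pi.add_apply]
  gcongr
  nlinarith [sq_nonneg (‖g₁ p‖ - ‖y p‖), sq_nonneg ‖g₁ p‖, sq_nonneg ‖y p‖]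

theorem ae_eLpNorm_ne_top (hs : 0 < s) (hy : AEStronglyMeasurable y μ)
    (hK : ∫⁻ p, eLpNorm (val (y p)) r (volume.restrict (Ω : Set (Vec d))) ^ s ∂μ ≠ ⊤) :
    ∀ᵐ p ∂μ, eLpNorm (val (y p)) r (volume.restrict (Ω : Set (Vec d))) ≠ ⊤ := by
  have hm := aemeasurable_eLpNorm ((valCLM Ω).continuous.comp_aestronglyMeasurable hy) r
  filter_upwards [ae_lt_top' (hm.pow_const s) hK] with p hp
  exact ((ENNReal.rpow_lt_top_iff_of_pos hs).1 hp).ne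

theorem integrable_toReal_eLpNorm_rpow (hy : AEStronglyMeasurable y μ)
    (hK : ∫⁻ p, eLpNorm (val (y p)) r (volume.restrict (Ω : Set (Vec d))) ^ s ∂μ ≠ ⊤) :
    Integrable (fun p =>
      (eLpNorm (val (y p)) r (volume.restrict (Ω : Set (Vec d)))).toReal ^ s) μ := by
  have hm := aemeasurable_eLpNorm ((valCLM Ω).continuous.comp_aestronglyMeasurable hy) r
  have h := integrable_toReal_of_lintegral_ne_top (hm.pow_const s) hK
  refine h.congr (Filter.Eventually.of_forall fun p => ?_)
  exact (ENNReal.toReal_rpow _ _).symm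

variable {C ν : ℝ}

/-- The bound does not depend on `n`, and along `v` and a path of finite regularity measure it is
integrable in time: this is the majorant for dominated convergence. It needs the operators to be
bounded in `H¹` and in `L^r` simultaneously. -/
theorem IsProductConst.abs_weakForm_opH_le (hC : IsProductConst Ω s r C) (hC0 : 0 < C)
    (hν : 0 < ν) (hs : 2 ≤ s) (hr : 1 ≤ r) (S : SolenoidalMollifier Ω) (n : ℕ) {a y : H10sol Ω}
    (g₁ : HNeg1 Ω) (g₂ : L2 Ω (Vec d)) {A : ℝ} (hA : 0 ≤ A) (hV : ‖val a‖ ≤ V) (hM : ‖y‖ ≤ M)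
    (hy : eLpNorm (val y) r (volume.restrict (Ω : Set (Vec d))) ≤ ENNReal.ofReal A) :
    |weakForm ν a g₁ g₂ (S.opH n y)| ≤ ν * (‖a‖ ^ 2 + (S.C * M) ^ 2) +
      (ν / 2 * ‖a‖ ^ 2 + absorbConst C ν s / 2 * S.C ^ s * V ^ 2 * A ^ s) +
      (‖g₁‖ + ‖g₂‖) * (S.C * M) := by
  have hSC := S.nonneg
  have hop : ‖S.opH n y‖ ≤ S.C * M :=
    (S.norm_opH_le n y).trans (mul_le_mul_of_nonneg_left hM hSC)
  have hga := norm_grad_le a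
  have c1 : |ν * inner ℝ (grad a) (grad (S.opH n y))| ≤ ν * (‖a‖ ^ 2 + (S.C * M) ^ 2) := by
    rw [abs_mul, abs_of_pos hν]
    refine mul_le_mul_of_nonneg_left ?_ hν.le
    refine (abs_real_inner_le_norm _ _).trans
      ((mul_le_mul hga ((norm_grad_le _).trans hop) (norm_nonneg _) (norm_nonneg _)).trans ?_)
    nlinarith [sq_nonneg (‖a‖ - S.C * M), sq_nonneg ‖a‖, sq_nonneg (S.C * M)]
  have c2 : |conv (val a) (grad a) (val (S.opH n y))| ≤
      ν / 2 * ‖a‖ ^ 2 + absorbConst C ν s / 2 * S.C ^ s * V ^ 2 * A ^ s := by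
    have hc := absorbConst_pos (s := s) hC0 hν
    refine (hC.abs_conv_grad_le hC0 hν hs a (mul_nonneg hSC hA)
      (S.eLpNorm_testL2_op_le hr n hy)).trans ?_
    rw [Real.mul_rpow hSC hA]
    have e1 : ‖grad a‖ ^ 2 ≤ ‖a‖ ^ 2 := pow_le_pow_left₀ (norm_nonneg _) hga 2
    have e2 : ‖val a‖ ^ 2 ≤ V ^ 2 := pow_le_pow_left₀ (norm_nonneg _) hV 2
    have e3 : 0 ≤ absorbConst C ν s / 2 * (S.C ^ s * A ^ s) := by positivity
    linarith [mul_le_mul_of_nonneg_left e2 e3, mul_le_mul_of_nonneg_left e1 (half_pos hν).le]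
  have c3 : |pairing g₁ g₂ (S.opH n y)| ≤ (‖g₁‖ + ‖g₂‖) * (S.C * M) := by
    refine (abs_pairing_le _ _ _).trans ?_
    rw [add_mul]
    exact add_le_add (mul_le_mul_of_nonneg_left hop g₁.opNorm_nonneg)
      (mul_le_mul_of_nonneg_left ((norm_val_le _).trans hop) (norm_nonneg _))
  rw [weakForm]
  exact (abs_sub _ _).trans (add_le_add ((abs_add_le _ _).trans (add_le_add c1 c2)) c3)

theorem IsProductConst.tendsto_weakForm_opH (hC : IsProductConst Ω s r C) (hC0 : 0 < C)
    (hr : 1 ≤ r) (S : SolenoidalMollifier Ω) {a y : H10sol Ω} (g₁ : HNeg1 Ω) (g₂ : L2 Ω (Vec d))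
    (hy : eLpNorm (val y) r (volume.restrict (Ω : Set (Vec d))) ≠ ⊤) :
    Filter.Tendsto (fun n => weakForm ν a g₁ g₂ (S.opH n y)) Filter.atTop
      (𝓝 (weakForm ν a g₁ g₂ y)) := by
  have l0 := S.tendsto_opH y
  have l1 : Filter.Tendsto (fun n => inner ℝ (grad a) (grad (S.opH n y))) Filter.atTop
      (𝓝 (inner ℝ (grad a) (grad y))) :=
    tendsto_const_nhds.inner (((gradCLM Ω).continuous.tendsto _).comp l0)
  have l2 := hC.tendsto_conv_op hC0 hr S a y (grad a) hy
  have l3 : Filter.Tendsto (fun n => pairing g₁ g₂ (S.opH n y)) Filter.atTop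
      (𝓝 (pairing g₁ g₂ y)) := by
    have hc : Continuous fun z : H10sol Ω => pairing g₁ g₂ z := by
      have l4 : Continuous fun z : H10sol Ω => (g₁, g₂, z) := by fun_prop
      have l5 := continuous_pairing.comp l4
      simpa only [Function.comp_def] using l5
    exact (hc.tendsto y).comp l0
  exact ((l1.const_mul ν).add l2).sub l3

/-- The weak form with mollified test fields converges, and its limit is integrable. -/
theorem IsProductConst.weakForm_limit (hC : IsProductConst Ω s r C) (hC0 : 0 < C) (hν : 0 < ν)
    (hs : 2 ≤ s) (hr : 1 ≤ r) (S : SolenoidalMollifier Ω) [IsFiniteMeasure μ]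
    (hg₁ : MemLp g₁ 2 μ) (hg₂ : MemLp g₂ 1 μ) (ha : AEStronglyMeasurable a μ)
    (ha2 : Integrable (fun p => ‖a p‖ ^ 2) μ) (hV : ∀ᵐ p ∂μ, ‖val (a p)‖ ≤ V)
    (hy : AEStronglyMeasurable y μ) (hM : ∀ᵐ p ∂μ, ‖y p‖ ≤ M)
    (hK : ∫⁻ p, eLpNorm (val (y p)) r (volume.restrict (Ω : Set (Vec d))) ^ s ∂μ ≠ ⊤) :
    Integrable (fun p => weakForm ν (a p) (g₁ p) (g₂ p) (y p)) μ ∧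
      Filter.Tendsto (fun n => ∫ p, weakForm ν (a p) (g₁ p) (g₂ p) (S.opH n (y p)) ∂μ) Filter.atTop
        (𝓝 (∫ p, weakForm ν (a p) (g₁ p) (g₂ p) (y p) ∂μ)) := by
  have hs0 : 0 < s := by linarith
  have hAi := integrable_toReal_eLpNorm_rpow hy hK
  have hfin := ae_eLpNorm_ne_top hs0 hy hK
  have hmeas : ∀ n, AEStronglyMeasurable
      (fun p => weakForm ν (a p) (g₁ p) (g₂ p) (S.opH n (y p))) μ := fun n =>
    S.aestronglyMeasurable_weakForm n ν (ha.prodMk (hg₁.1.prodMk hg₂.1)) hy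
  have h1 : Integrable (fun p => ‖g₁ p‖) μ := integrable_norm_of_memLp (F := HNeg1 Ω) one_le_two hg₁
  have h2 : Integrable (fun p => ‖g₂ p‖) μ := integrable_norm_of_memLp le_rfl hg₂
  have hbi := integrable_affine_bound ha2 hAi h1 h2 ν ((S.C * M) ^ 2) (ν / 2)
    (absorbConst C ν s / 2 * S.C ^ s * V ^ 2) (S.C * M)
  have hbd : ∀ n, ∀ᵐ p ∂μ, ‖weakForm ν (a p) (g₁ p) (g₂ p) (S.opH n (y p))‖ ≤
      ν * (‖a p‖ ^ 2 + (S.C * M) ^ 2) + (ν / 2 * ‖a p‖ ^ 2 +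
        absorbConst C ν s / 2 * S.C ^ s * V ^ 2 *
          (eLpNorm (val (y p)) r (volume.restrict (Ω : Set (Vec d)))).toReal ^ s) +
        (‖g₁ p‖ + ‖g₂ p‖) * (S.C * M) := by
    intro n
    filter_upwards [hV, hM, hfin] with p hVp hMp hp
    exact hC.abs_weakForm_opH_le hC0 hν hs hr S n (g₁ p) (g₂ p) ENNReal.toReal_nonneg hVp hMp
      (ENNReal.ofReal_toReal hp).ge
  have hlim : ∀ᵐ p ∂μ, Filter.Tendsto (fun n => weakForm ν (a p) (g₁ p) (g₂ p) (S.opH n (y p)))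
      Filter.atTop (𝓝 (weakForm ν (a p) (g₁ p) (g₂ p) (y p))) := by
    exact hfin.mono fun p hp => hC.tendsto_weakForm_opH hC0 hr S (g₁ p) (g₂ p) hp
  refine ⟨?_, tendsto_integral_of_dominated_convergence _ hmeas hbi hbd hlim⟩
  refine hbi.mono' (aestronglyMeasurable_of_tendsto_ae _ hmeas hlim) ?_
  filter_upwards [ae_all_iff.2 hbd, hlim] with p h1 h2
  exact le_of_tendsto h2.norm (Filter.Eventually.of_forall h1)

theorem IsProductConst.integrable_conv (hC : IsProductConst Ω s r C) (hC0 : 0 < C)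
    (hs : 2 ≤ s) (hr : 1 ≤ r) (S : SolenoidalMollifier Ω) [IsFiniteMeasure μ]
    (ha : AEStronglyMeasurable a μ)
    (ha2 : Integrable (fun p => ‖a p‖ ^ 2) μ) (hV : ∀ᵐ p ∂μ, ‖val (a p)‖ ≤ V)
    (hy : AEStronglyMeasurable y μ) (hM : ∀ᵐ p ∂μ, ‖y p‖ ≤ M)
    (hK : ∫⁻ p, eLpNorm (val (y p)) r (volume.restrict (Ω : Set (Vec d))) ^ s ∂μ ≠ ⊤) :
    Integrable (fun p => conv (val (a p)) (grad (a p)) (val (y p))) μ := by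
  -- With `ν = 1` and zero force the weak form is the convective term plus an integrable gradient
  -- term.
  have h := (hC.weakForm_limit hC0 one_pos hs hr S (g₁ := fun _ => 0) (g₂ := fun _ => 0)
    (memLp_zero_fun (F := HNeg1 Ω) μ 2) (memLp_zero_fun μ 1) ha ha2 hV hy hM hK).1
  have hi : Integrable (fun p => inner ℝ (grad (a p)) (grad (y p))) μ := by
    refine (ha2.add (integrable_const (M ^ 2))).mono' ?_ ?_
    · exact ((gradCLM Ω).continuous.comp_aestronglyMeasurable ha).inner
        ((gradCLM Ω).continuous.comp_aestronglyMeasurable hy)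
    · filter_upwards [hM] with p hp
      refine (abs_real_inner_le_norm _ _).trans ((mul_le_mul (norm_grad_le _)
        ((norm_grad_le _).trans hp) (norm_nonneg _) (norm_nonneg _)).trans ?_)
      simp only [Pi.add_apply]
      nlinarith [sq_nonneg (‖a p‖ - M), sq_nonneg ‖a p‖, sq_nonneg M]
  refine (h.sub hi).congr (Filter.Eventually.of_forall fun p => ?_)
  simp only [Pi.sub_apply, weakForm, pairing_zero]
  ring

end Bounds

section WeakSolution

variable {ν T C s : ℝ} {r : ℝ≥0∞} {f₁ : ℝ → HNeg1 Ω} {f₂ : ℝ → L2 Ω (Vec d)} {v₀ : L2sol Ω}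
  {v : ℝ → H10sol Ω}

/-- The equation tested with a `C¹` path of finite regularity measure. -/
theorem IsWeakSolution.ae_inner_path_eq (hw : IsWeakSolution ν T f₁ f₂ v₀ v) (hT : 0 < T)
    (hν : 0 < ν) (hf₁ : MemLp f₁ 2 (timeMeasure T)) (hf₂ : MemLp f₂ 1 (timeMeasure T))
    (S : SolenoidalMollifier Ω) (hC : IsProductConst Ω s r C) (hC0 : 0 < C) (hs : 2 ≤ s)
    (hr : 1 ≤ r) :
    ∀ᵐ t ∂timeMeasure T, ∀ w w' : ℝ → H10sol Ω, IsC1Path t w w' →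
      ∫⁻ τ in Ioo 0 t, eLpNorm (val (w τ)) r (volume.restrict (Ω : Set (Vec d))) ^ s ≠ ⊤ →
      IntegrableOn (fun τ => weakForm ν (v τ) (f₁ τ) (f₂ τ) (w τ)) (Ioo 0 t) ∧
      inner ℝ (val (v t)) (val (w t)) - inner ℝ (v₀ : L2 Ω (Vec d)) (val (w 0)) =
        (∫ τ in Ioo 0 t, inner ℝ (val (v τ)) (val (w' τ))) -
          ∫ τ in Ioo 0 t, weakForm ν (v τ) (f₁ τ) (f₂ τ) (w τ) := by
  obtain ⟨V, hV0, hV⟩ := hw.state.exists_norm_val_le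
  have hv2 := hw.state.integrableOn_norm_sq
  have hvm : AEStronglyMeasurable v (volume.restrict (Ioo 0 T)) := hw.state.1.1
  filter_upwards [ae_all_iff.2 fun n => hw.ae_inner_opH_path_eq hT hν.le hf₁ hf₂ S n,
    (ae_restrict_mem measurableSet_Ioo : ∀ᵐ t ∂timeMeasure T, t ∈ Ioo 0 T)]
    with t ht hmem w w' hp hK
  have hsub : Ioo 0 t ⊆ Ioo 0 T := Ioo_subset_Ioo_right hmem.2.le
  obtain ⟨M, hM0, hM⟩ := hp.exists_bound
  have hMae : ∀ᵐ τ ∂volume.restrict (Ioo 0 t), ‖w τ‖ ≤ M ∧ ‖w' τ‖ ≤ M := by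
    filter_upwards [ae_restrict_mem measurableSet_Ioo] with τ hτ using hM τ hτ
  have hVt := ae_restrict_of_ae_restrict_of_subset hsub hV
  obtain ⟨hi, hlim⟩ := hC.weakForm_limit hC0 hν hs hr S (μ := volume.restrict (Ioo 0 t))
    (memLp_restrict_mono (F := HNeg1 Ω) hf₁ hsub) (memLp_restrict_mono hf₂ hsub) (hvm.mono_set hsub)
    (hv2.mono_set hsub) hVt hp.aestronglyMeasurable (hMae.mono fun τ h => h.1) hK
  refine ⟨hi, ?_⟩
  have hop : ∀ y : H10sol Ω, Filter.Tendsto (fun n => val (S.opH n y)) Filter.atTop (𝓝 (val y)) :=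
    fun y => ((valCLM Ω).continuous.tendsto _).comp (S.tendsto_opH y)
  have hlim2 : Filter.Tendsto
      (fun n => ∫ τ in Ioo 0 t, inner ℝ (val (v τ)) (val (S.opH n (w' τ)))) Filter.atTop
      (𝓝 (∫ τ in Ioo 0 t, inner ℝ (val (v τ)) (val (w' τ)))) := by
    refine tendsto_integral_of_dominated_convergence (fun _ => V * (S.C * M)) (fun n => ?_)
      (integrable_const _) (fun n => ?_) (Filter.Eventually.of_forall fun τ =>
        tendsto_const_nhds.inner (hop _))
    · exact ((valCLM Ω).continuous.comp_aestronglyMeasurable (hvm.mono_set hsub)).inner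
        (((valCLM Ω).continuous.comp (S.opH n).continuous).comp_aestronglyMeasurable
          hp.aestronglyMeasurable_deriv)
    · filter_upwards [hVt, hMae] with τ h1 h2
      have h3 := S.nonneg
      have h4 : ‖val (S.opH n (w' τ))‖ ≤ S.C * M :=
        (norm_val_le _).trans ((S.norm_opH_le n _).trans (mul_le_mul_of_nonneg_left h2.2 h3))
      exact (abs_real_inner_le_norm _ _).trans (mul_le_mul h1 h4 (norm_nonneg _) hV0)
  refine tendsto_nhds_unique (Filter.Tendsto.congr (fun n => (ht n w w' hp).symm)
    (hlim2.sub hlim)) ?_ |>.symm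
  exact (tendsto_const_nhds.inner (hop _)).sub (tendsto_const_nhds.inner (hop _))

end WeakSolution

/-! ### The relative energy inequality -/

/-- `W(v | w) + ⟨A(w), v - w⟩` at a time, where `w'` is the time derivative of `w`. -/
def relSource (ν : ℝ) (g₁ : HNeg1 Ω) (g₂ : L2 Ω (Vec d)) (v w w' : H10sol Ω) : ℝ :=
  relDissipation ν v w + (inner ℝ (val w') (val (v - w)) + conv (val w) (grad w) (val (v - w)) +
    ν * inner ℝ (grad w) (grad (v - w)) - pairing g₁ g₂ (v - w))

/-- With `u = v - w`, the viscous terms on the left equal `-ν‖∇u‖² - ν(∇w, ∇u)`. Half of `ν‖∇u‖²` is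
the relative dissipation, and the other half absorbs `((u·∇)u, w)`, the only convective term left by
`conv_add_conv_sub_eq`. All remaining terms match those of `relSource` exactly. -/
theorem IsProductConst.energy_density_le {C ν s : ℝ} {r : ℝ≥0∞} (hC : IsProductConst Ω s r C)
    (hC0 : 0 < C) (hν : 0 < ν) (hs : 2 ≤ s) (hr : 1 ≤ r) (S : SolenoidalMollifier Ω)
    (hb : Bornology.IsBounded (Ω : Set (Vec d))) (g₁ : HNeg1 Ω) (g₂ : L2 Ω (Vec d))
    (v w w' : H10sol Ω) (hw : eLpNorm (val w) r (volume.restrict (Ω : Set (Vec d))) ≠ ⊤) :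
    pairing g₁ g₂ v - ν * ‖grad v‖ ^ 2 - inner ℝ (val v) (val w') + weakForm ν v g₁ g₂ w +
        inner ℝ (val w) (val w') ≤
      -relSource ν g₁ g₂ v w w' + absorbConst C ν s *
        (eLpNorm (val w) r (volume.restrict (Ω : Set (Vec d)))).toReal ^ s *
          relEnergy (val v) (val w) := by
  have h1 := hC.conv_add_conv_sub_eq hC0 hr S hb v w hw
  have h2 := le_of_abs_le (hC.abs_conv_grad_le hC0 hν hs (v - w) ENNReal.toReal_nonneg
    (ENNReal.ofReal_toReal hw).ge)
  have h3 : ‖grad v - grad w‖ ^ 2 =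
      ‖grad v‖ ^ 2 - 2 * inner ℝ (grad v) (grad w) + ‖grad w‖ ^ 2 := norm_sub_sq_real _ _
  have h4 : inner ℝ (grad w) (grad v - grad w) = inner ℝ (grad v) (grad w) - ‖grad w‖ ^ 2 := by
    rw [inner_sub_right, real_inner_self_eq_norm_sq, real_inner_comm]
  have h5 : inner ℝ (val w') (val v - val w) =
      inner ℝ (val v) (val w') - inner ℝ (val w) (val w') := by
    rw [inner_sub_right, real_inner_comm, real_inner_comm (val w)]
  rw [relSource, relDissipation, relEnergy, weakForm, pairing_sub]
  rw [val_sub] at h1 h2 ⊢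
  rw [grad_sub] at h1 h2 ⊢
  rw [h4, h5, h3]
  rw [h3] at h2
  linarith

theorem integrable_inner_of_memLp {α E F : Type*} [MeasurableSpace α] {μ : Measure α}
    [NormedAddCommGroup E] [NormedSpace ℝ E] [NormedAddCommGroup F] [InnerProductSpace ℝ F]
    (L : E →L[ℝ] F) {a b : α → E} (ha : MemLp a 2 μ) (hb : MemLp b 2 μ) :
    Integrable (fun p => inner ℝ (L (a p)) (L (b p))) μ := by
  have ha' := L.comp_memLp' ha
  have hb' := L.comp_memLp' hb
  exact (ha'.norm.integrable_mul hb'.norm).mono' (ha'.1.inner hb'.1)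
    (Filter.Eventually.of_forall fun p => abs_real_inner_le_norm _ _)

theorem integral_energy_density {α : Type*} [MeasurableSpace α] {μ : Measure α} (ν : ℝ)
    {P D I W J : α → ℝ} (hP : Integrable P μ) (hD : Integrable D μ) (hI : Integrable I μ)
    (hW : Integrable W μ) (hJ : Integrable J μ) :
    Integrable (fun p => P p - ν * D p - I p + W p + J p) μ ∧
    ∫ p, (P p - ν * D p - I p + W p + J p) ∂μ =
      (∫ p, P p ∂μ) - ν * (∫ p, D p ∂μ) - (∫ p, I p ∂μ) + (∫ p, W p ∂μ) + ∫ p, J p ∂μ := by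
  have h1 : Integrable (fun p => P p - ν * D p) μ := hP.sub (hD.const_mul ν)
  have h2 : Integrable (fun p => P p - ν * D p - I p) μ := h1.sub hI
  have h3 : Integrable (fun p => P p - ν * D p - I p + W p) μ := h2.add hW
  refine ⟨h3.add hJ, ?_⟩
  rw [integral_add h3 hJ, integral_add h2 hW, integral_sub h1 hI, integral_sub hP (hD.const_mul ν),
    integral_const_mul]

namespace IsC1Path

variable {t : ℝ} {w w' : ℝ → H10sol Ω}

theorem mono (h : IsC1Path t w w') {σ : ℝ} (hσ : σ ≤ t) : IsC1Path σ w w' where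
  continuousOn := h.continuousOn.mono (Icc_subset_Icc_right hσ)
  hasDerivAt τ hτ := h.hasDerivAt τ ⟨hτ.1, hτ.2.trans_le hσ⟩
  continuousOn_deriv := h.continuousOn_deriv.mono (Icc_subset_Icc_right hσ)

theorem memLp (h : IsC1Path t w w') : MemLp w 2 (volume.restrict (Ioo 0 t)) := by
  obtain ⟨M, -, hM⟩ := h.exists_bound
  refine MemLp.of_bound h.aestronglyMeasurable M ?_
  filter_upwards [ae_restrict_mem measurableSet_Ioo] with τ hτ using (hM τ hτ).1

theorem memLp_deriv (h : IsC1Path t w w') : MemLp w' 2 (volume.restrict (Ioo 0 t)) := by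
  obtain ⟨M, -, hM⟩ := h.exists_bound
  refine MemLp.of_bound h.aestronglyMeasurable_deriv M ?_
  filter_upwards [ae_restrict_mem measurableSet_Ioo] with τ hτ using (hM τ hτ).2

theorem half_norm_sq_eq (h : IsC1Path t w w') (ht : 0 ≤ t) :
    1 / 2 * ‖val (w t)‖ ^ 2 - 1 / 2 * ‖val (w 0)‖ ^ 2 =
      ∫ τ in Ioo 0 t, inner ℝ (val (w τ)) (val (w' τ)) := by
  have hi : IntegrableOn (fun τ => inner ℝ (val (w τ)) (val (w' τ))) (Ioo 0 t) :=
    integrable_inner_of_memLp (valCLM Ω) h.memLp h.memLp_deriv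
  have hc : ContinuousOn (fun τ => val (w τ)) (Icc 0 t) :=
    (valCLM Ω).continuous.comp_continuousOn h.continuousOn
  rw [setIntegral_Ioo_eq ht]
  refine (intervalIntegral.integral_eq_sub_of_hasDerivAt_of_le ht
    (f := fun τ => 1 / 2 * ‖val (w τ)‖ ^ 2) ((hc.norm.pow 2).const_mul _) (fun τ hτ => ?_)
    ((integrableOn_Ioo_iff ht).1 hi)).symm
  have h1 : HasDerivAt (fun τ => val (w τ)) (val (w' τ)) τ :=
    (valCLM Ω).hasFDerivAt.comp_hasDerivAt τ (h.hasDerivAt τ hτ)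
  have h2 := h1.norm_sq.const_mul (1 / 2)
  refine h2.congr_deriv ?_
  ring

end IsC1Path

section WeakSolution

variable {ν T C s : ℝ} {r : ℝ≥0∞} {f₁ : ℝ → HNeg1 Ω} {f₂ : ℝ → L2 Ω (Vec d)} {v₀ : L2sol Ω}
  {v : ℝ → H10sol Ω}

/-- By `conv_add_conv_sub_eq` the term is the difference of `((u·∇)u, w)` and `((v·∇)v, w)`, with `u
= v - w`. Both have the path in the last slot, where `integrable_conv` applies. -/
theorem IsProductConst.integrableOn_conv_sub (hC : IsProductConst Ω s r C) (hC0 : 0 < C)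
    (hs : 2 ≤ s) (hr : 1 ≤ r) (S : SolenoidalMollifier Ω)
    (hb : Bornology.IsBounded (Ω : Set (Vec d))) {t V U M : ℝ} {w : ℝ → H10sol Ω}
    (hvL : MemLp v 2 (volume.restrict (Ioo 0 t)))
    (huL : MemLp (fun τ => v τ - w τ) 2 (volume.restrict (Ioo 0 t)))
    (hwL : MemLp w 2 (volume.restrict (Ioo 0 t)))
    (hV : ∀ᵐ τ ∂volume.restrict (Ioo 0 t), ‖val (v τ)‖ ≤ V)
    (hU : ∀ᵐ τ ∂volume.restrict (Ioo 0 t), ‖val (v τ - w τ)‖ ≤ U)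
    (hM : ∀ᵐ τ ∂volume.restrict (Ioo 0 t), ‖w τ‖ ≤ M)
    (hK : ∫⁻ τ in Ioo 0 t, eLpNorm (val (w τ)) r (volume.restrict (Ω : Set (Vec d))) ^ s ≠ ⊤) :
    IntegrableOn (fun τ => conv (val (w τ)) (grad (w τ)) (val (v τ - w τ))) (Ioo 0 t) := by
  have hfin := ae_eLpNorm_ne_top (by linarith) hwL.1 hK
  have j1 := hC.integrable_conv hC0 hs hr S huL.1 (integrable_norm_sq_of_memLp huL)
    hU hwL.1 hM hK
  have j2 := hC.integrable_conv hC0 hs hr S hvL.1 (integrable_norm_sq_of_memLp hvL)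
    hV hwL.1 hM hK
  refine (j1.sub j2).congr ?_
  filter_upwards [hfin] with τ hτ
  exact sub_eq_of_eq_add' (hC.conv_add_conv_sub_eq hC0 hr S hb (v τ) (w τ) hτ).symm

theorem IsC1Path.integrableOn_relEnergy {t U : ℝ} {w w' : ℝ → H10sol Ω} (hp : IsC1Path t w w')
    (c : ℝ) (huL : MemLp (fun τ => v τ - w τ) 2 (volume.restrict (Ioo 0 t)))
    (hU : ∀ᵐ τ ∂volume.restrict (Ioo 0 t), ‖val (v τ - w τ)‖ ≤ U)
    (hK : ∫⁻ τ in Ioo 0 t, eLpNorm (val (w τ)) r (volume.restrict (Ω : Set (Vec d))) ^ s ≠ ⊤) :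
    IntegrableOn (fun τ => c *
      (eLpNorm (val (w τ)) r (volume.restrict (Ω : Set (Vec d)))).toReal ^ s * relEnergy (val (v τ)) (val (w τ))) (Ioo 0 t) := by
  have hA := (integrable_toReal_eLpNorm_rpow hp.aestronglyMeasurable hK).const_mul c
  have hm : AEStronglyMeasurable (fun τ => relEnergy (val (v τ)) (val (w τ)))
      (volume.restrict (Ioo 0 t)) :=
    ((((valCLM Ω).comp_memLp' huL).1.norm.pow 2).const_mul (1 / 2))
  refine (hA.norm.mul_const (1 / 2 * U ^ 2)).mono' (hA.1.mul hm) ?_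
  filter_upwards [hU] with τ hτ
  rw [norm_mul]
  refine mul_le_mul_of_nonneg_left ?_ (norm_nonneg _)
  have h0 : 0 ≤ relEnergy (val (v τ)) (val (w τ)) := by
    unfold relEnergy
    positivity
  rw [Real.norm_eq_abs, abs_of_nonneg h0, relEnergy]
  rw [val_sub] at hτ
  exact mul_le_mul_of_nonneg_left (pow_le_pow_left₀ (norm_nonneg _) hτ 2) (by norm_num)

theorem integrable_source_terms {α : Type*} [MeasurableSpace α] {μ : Measure α} {a b c e f : α → ℝ}
    (ha : Integrable a μ) (hb : Integrable b μ) (hc : Integrable c μ) (he : Integrable e μ)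
    (hf : Integrable f μ) (ν : ℝ) :
    Integrable (fun p => a p + (b p + c p + ν * e p - f p)) μ :=
  ha.add (((hb.add hc).add (he.const_mul ν)).sub hf)

theorem IsWeakSolution.integrableOn_relSource (hw : IsWeakSolution ν T f₁ f₂ v₀ v)
    (hf₁ : MemLp f₁ 2 (timeMeasure T)) (hf₂ : MemLp f₂ 1 (timeMeasure T))
    (S : SolenoidalMollifier Ω) (hb : Bornology.IsBounded (Ω : Set (Vec d)))
    (hC : IsProductConst Ω s r C) (hC0 : 0 < C) (hs : 2 ≤ s) (hr : 1 ≤ r) {t : ℝ} (ht : t ≤ T)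
    {w w' : ℝ → H10sol Ω} (hp : IsC1Path t w w')
    (hK : ∫⁻ τ in Ioo 0 t, eLpNorm (val (w τ)) r (volume.restrict (Ω : Set (Vec d))) ^ s ≠ ⊤) :
    IntegrableOn (fun τ => relSource ν (f₁ τ) (f₂ τ) (v τ) (w τ) (w' τ)) (Ioo 0 t) ∧
      IntegrableOn (fun τ => absorbConst C ν s *
        (eLpNorm (val (w τ)) r (volume.restrict (Ω : Set (Vec d)))).toReal ^ s *
          relEnergy (val (v τ)) (val (w τ))) (Ioo 0 t) := by
  have hsub : Ioo 0 t ⊆ Ioo 0 T := Ioo_subset_Ioo_right ht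
  obtain ⟨V, hV0, hV⟩ := hw.state.exists_norm_val_le
  have hVt := ae_restrict_of_ae_restrict_of_subset hsub hV
  obtain ⟨M, hM0, hM⟩ := hp.exists_bound
  have hMae : ∀ᵐ τ ∂volume.restrict (Ioo 0 t), ‖w τ‖ ≤ M := by
    filter_upwards [ae_restrict_mem measurableSet_Ioo] with τ hτ using (hM τ hτ).1
  have hvL : MemLp v 2 (volume.restrict (Ioo 0 t)) := memLp_restrict_mono hw.state.1 hsub
  have huL : MemLp (fun τ => v τ - w τ) 2 (volume.restrict (Ioo 0 t)) := hvL.sub hp.memLp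
  have huV : ∀ᵐ τ ∂volume.restrict (Ioo 0 t), ‖val (v τ - w τ)‖ ≤ V + M := by
    filter_upwards [hVt, hMae] with τ h1 h2
    rw [val_sub]
    exact (norm_sub_le _ _).trans (add_le_add h1 ((norm_val_le _).trans h2))
  have hi2 := integrable_inner_of_memLp (valCLM Ω) hp.memLp_deriv huL
  have hi4 := integrable_inner_of_memLp (gradCLM Ω) hp.memLp huL
  have hi3 := hC.integrableOn_conv_sub hC0 hs hr S hb hvL huL hp.memLp hVt
    huV hMae hK
  have hi1 := (integrable_norm_sq_of_memLp ((gradCLM Ω).comp_memLp' huL)).const_mul (ν / 2)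
  have hi5 := integrable_pairing (memLp_restrict_mono (F := HNeg1 Ω) hf₁ hsub)
    (memLp_restrict_mono hf₂ hsub) huL.1 (integrable_norm_sq_of_memLp huL) huV
  exact ⟨integrable_source_terms hi1 hi2 hi3 hi4 hi5 ν, hp.integrableOn_relEnergy _ huL huV hK⟩

/-- Expand both relative energies. The energy inequality, minus the equation tested with `w`, plus
the identity for `½‖w‖²`, bounds their difference by the time integral of the left-hand side of
`energy_density_le`. -/
theorem IsWeakSolution.ae_relEnergy_le (hw : IsWeakSolution ν T f₁ f₂ v₀ v)
    (he : EnergyInequality ν T f₁ f₂ v₀ v) (hT : 0 < T) (hν : 0 < ν)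
    (hf₁ : MemLp f₁ 2 (timeMeasure T)) (hf₂ : MemLp f₂ 1 (timeMeasure T))
    (S : SolenoidalMollifier Ω) (hb : Bornology.IsBounded (Ω : Set (Vec d)))
    (hC : IsProductConst Ω s r C) (hC0 : 0 < C) (hs : 2 ≤ s) (hr : 1 ≤ r) :
    ∀ᵐ t ∂timeMeasure T, ∀ w w' : ℝ → H10sol Ω, IsC1Path t w w' →
      ∫⁻ τ in Ioo 0 t, eLpNorm (val (w τ)) r (volume.restrict (Ω : Set (Vec d))) ^ s ≠ ⊤ →
      relEnergy (val (v t)) (val (w t)) ≤ relEnergy (v₀ : L2 Ω (Vec d)) (val (w 0)) -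
        (∫ τ in Ioo 0 t, relSource ν (f₁ τ) (f₂ τ) (v τ) (w τ) (w' τ)) +
        ∫ τ in Ioo 0 t, absorbConst C ν s *
          (eLpNorm (val (w τ)) r (volume.restrict (Ω : Set (Vec d)))).toReal ^ s *
            relEnergy (val (v τ)) (val (w τ)) := by
  obtain ⟨V, hV0, hV⟩ := hw.state.exists_norm_val_le
  filter_upwards [he, hw.ae_inner_path_eq hT hν hf₁ hf₂ S hC hC0 hs hr,
    (ae_restrict_mem measurableSet_Ioo : ∀ᵐ t ∂timeMeasure T, t ∈ Ioo 0 T)]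
    with t het hpath hmem w w' hp hK
  have hsub : Ioo 0 t ⊆ Ioo 0 T := Ioo_subset_Ioo_right hmem.2.le
  have hVt := ae_restrict_of_ae_restrict_of_subset hsub hV
  have hvL : MemLp v 2 (volume.restrict (Ioo 0 t)) := memLp_restrict_mono hw.state.1 hsub
  obtain ⟨hW, hpe⟩ := hpath w w' hp hK
  obtain ⟨hsrc, hKR⟩ := hw.integrableOn_relSource hf₁ hf₂ S hb hC hC0 hs hr hmem.2.le hp hK
  have hfin := ae_eLpNorm_ne_top (by linarith) hp.aestronglyMeasurable hK
  have hP : IntegrableOn (fun τ => pairing (f₁ τ) (f₂ τ) (v τ)) (Ioo 0 t) :=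
    integrable_pairing (memLp_restrict_mono (F := HNeg1 Ω) hf₁ hsub)
      (memLp_restrict_mono hf₂ hsub) hvL.1 (integrable_norm_sq_of_memLp hvL) hVt
  have hD : IntegrableOn (fun τ => ‖grad (v τ)‖ ^ 2) (Ioo 0 t) :=
    integrable_norm_sq_of_memLp ((gradCLM Ω).comp_memLp' hvL)
  have hI : IntegrableOn (fun τ => inner ℝ (val (v τ)) (val (w' τ))) (Ioo 0 t) :=
    integrable_inner_of_memLp (valCLM Ω) hvL hp.memLp_deriv
  have hJ : IntegrableOn (fun τ => inner ℝ (val (w τ)) (val (w' τ))) (Ioo 0 t) :=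
    integrable_inner_of_memLp (valCLM Ω) hp.memLp hp.memLp_deriv
  obtain ⟨hint, heq⟩ := integral_energy_density ν hP hD hI hW hJ
  have hle : ∫ τ in Ioo 0 t, (pairing (f₁ τ) (f₂ τ) (v τ) - ν * ‖grad (v τ)‖ ^ 2 -
      inner ℝ (val (v τ)) (val (w' τ)) + weakForm ν (v τ) (f₁ τ) (f₂ τ) (w τ) +
        inner ℝ (val (w τ)) (val (w' τ))) ≤
      -(∫ τ in Ioo 0 t, relSource ν (f₁ τ) (f₂ τ) (v τ) (w τ) (w' τ)) +
        ∫ τ in Ioo 0 t, absorbConst C ν s *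
          (eLpNorm (val (w τ)) r (volume.restrict (Ω : Set (Vec d)))).toReal ^ s *
            relEnergy (val (v τ)) (val (w τ)) := by
    have hneg : IntegrableOn (fun τ => -relSource ν (f₁ τ) (f₂ τ) (v τ) (w τ) (w' τ)) (Ioo 0 t) :=
      hsrc.neg
    rw [← integral_neg, ← integral_add hneg hKR]
    refine integral_mono_ae hint (hneg.add hKR) ?_
    filter_upwards [hfin] with τ hτ
    exact hC.energy_density_le hC0 hν hs hr S hb _ _ _ _ _ hτ
  have hww := hp.half_norm_sq_eq hmem.1.le
  have e1 := norm_sub_sq_real (val (v t)) (val (w t))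
  have e2 := norm_sub_sq_real (v₀ : L2 Ω (Vec d)) (val (w 0))
  rw [relEnergy, relEnergy, e1, e2]
  rw [heq] at hle
  linarith

/-- The relative energy inequality along `C¹` paths of finite regularity measure. -/
theorem IsWeakSolution.ae_relEnergy_exp_le (hw : IsWeakSolution ν T f₁ f₂ v₀ v)
    (he : EnergyInequality ν T f₁ f₂ v₀ v) (hT : 0 < T) (hν : 0 < ν)
    (hf₁ : MemLp f₁ 2 (timeMeasure T)) (hf₂ : MemLp f₂ 1 (timeMeasure T))
    (S : SolenoidalMollifier Ω) (hb : Bornology.IsBounded (Ω : Set (Vec d)))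
    (hC : IsProductConst Ω s r C) (hC0 : 0 < C) (hs : 2 ≤ s) (hr : 1 ≤ r) :
    ∀ᵐ t ∂timeMeasure T, ∀ (w w' : ℝ → H10sol Ω) (k : ℝ → ℝ), IsC1Path t w w' →
      ∫⁻ τ in Ioo 0 t, eLpNorm (val (w τ)) r (volume.restrict (Ω : Set (Vec d))) ^ s ≠ ⊤ →
      (∀ τ, k τ = absorbConst C ν s *
        (eLpNorm (val (w τ)) r (volume.restrict (Ω : Set (Vec d)))).toReal ^ s) →
      IntegrableOn (fun τ => relSource ν (f₁ τ) (f₂ τ) (v τ) (w τ) (w' τ) *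
        Real.exp (∫ σ in Ioo τ t, k σ)) (Ioo 0 t) ∧
      relEnergy (val (v t)) (val (w t)) +
          ∫ τ in Ioo 0 t, relSource ν (f₁ τ) (f₂ τ) (v τ) (w τ) (w' τ) *
            Real.exp (∫ σ in Ioo τ t, k σ) ≤
        relEnergy (v₀ : L2 Ω (Vec d)) (val (w 0)) * Real.exp (∫ σ in Ioo 0 t, k σ) := by
  have h := hw.ae_relEnergy_le he hT hν hf₁ hf₂ S hb hC hC0 hs hr
  filter_upwards [h, (ae_restrict_mem measurableSet_Ioo : ∀ᵐ t ∂timeMeasure T, t ∈ Ioo 0 T)]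
    with t ht hmem w w' k hp hK hk
  have hsub : Ioo 0 t ⊆ Ioo 0 T := Ioo_subset_Ioo_right hmem.2.le
  obtain ⟨hsrc, hKR⟩ := hw.integrableOn_relSource hf₁ hf₂ S hb hC hC0 hs hr hmem.2.le hp hK
  have hki : IntegrableOn k (Ioo 0 t) :=
    ((integrable_toReal_eLpNorm_rpow hp.aestronglyMeasurable hK).const_mul
      (absorbConst C ν s)).congr (Filter.Eventually.of_forall fun τ => (hk τ).symm)
  have hc := absorbConst_pos (s := s) hC0 hν
  simp_rw [← hk] at hKR
  refine gronwall_integral (R := fun τ => relEnergy (val (v τ)) (val (w τ))) hmem.1 hsrc hki hKR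
    (fun τ => ?_) ?_ ?_
  · rw [hk]
    positivity
  · have h' : ∀ᵐ t ∂volume.restrict (Ioo 0 T), _ := h
    -- Gronwall's inequality needs the bound at almost every earlier time for the same path. The
    -- null set does not depend on the path, and the path restricts to `[0, σ]` with finite
    -- regularity measure.
    filter_upwards [ae_restrict_of_ae_restrict_of_subset hsub h', ae_restrict_mem measurableSet_Ioo]
      with σ hσ hσt
    have := hσ w w' (hp.mono hσt.2.le)
      (ne_top_of_le_ne_top hK (lintegral_mono_set (Ioo_subset_Ioo_right hσt.2.le)))
    simpa only [hk] using this
  · simpa only [hk] using ht w w' hp hK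

end WeakSolution

/-! ### Paths in `H² ∩ H¹_{0,σ}` and conclusion -/

/-- The inclusion of `H² ∩ H¹_{0,σ}` into `H¹_{0,σ}` as a continuous linear map. -/
def toH10solCLM (Ω : Opens (Vec d)) : H2sol Ω →L[ℝ] H10sol Ω :=
  (WithLp.fstL 2 ℝ (H10sol Ω) (L2 Ω (Ten d))).comp (H2sol Ω).subtypeL

theorem isC1Path_clm_comp {E : Type*} [NormedAddCommGroup E] [NormedSpace ℝ E]
    (L : E →L[ℝ] H10sol Ω) {T t : ℝ} (ht : t ∈ Ioo 0 T) {u : ℝ → E}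
    (hu : ContDiffOn ℝ 1 u (Icc 0 T)) :
    IsC1Path t (fun τ => L (u τ)) fun τ => L (derivWithin u (Icc 0 T) τ) where
  continuousOn := L.continuous.comp_continuousOn
    (hu.continuousOn.mono (Icc_subset_Icc_right ht.2.le))
  hasDerivAt τ hτ := by
    have hτ' : τ ∈ Ioo 0 T := ⟨hτ.1, hτ.2.trans ht.2⟩
    have h1 := ((hu.differentiableOn one_ne_zero) τ
      (Ioo_subset_Icc_self hτ')).hasDerivWithinAt.hasDerivAt (Icc_mem_nhds hτ'.1 hτ'.2)
    exact L.hasFDerivAt.comp_hasDerivAt τ h1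
  continuousOn_deriv := L.continuous.comp_continuousOn
    ((hu.continuousOn_derivWithin (uniqueDiffOn_Icc (ht.1.trans ht.2)) le_rfl).mono
      (Icc_subset_Icc_right ht.2.le))

theorem isC1Path_toH10sol {T t : ℝ} (ht : t ∈ Ioo 0 T) {vt : ℝ → H2sol Ω}
    (hvt : ContDiffOn ℝ 1 vt (Icc 0 T)) :
    IsC1Path t (fun τ => toH10sol (vt τ)) fun τ => toH10sol (derivWithin vt (Icc 0 T) τ) :=
  @isC1Path_clm_comp d Ω (H2sol Ω) _ (Submodule.normedSpace _) (toH10solCLM Ω) T t ht vt hvt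

section Regularity

variable {c s : ℝ} {r : ℝ≥0∞} {vt : ℝ → H2sol Ω}

/-- Positivity of `c` is essential: for `c = 0` the product `0 * ⊤ = 0` would be finite without any
information on the norm. -/
theorem lintegral_eLpNorm_ne_top {t : ℝ} (hc : 0 < c) (h : regIntegral c s r vt 0 t < ⊤) :
    ∫⁻ τ in Ioo 0 t,
      eLpNorm (val (toH10sol (vt τ))) r (volume.restrict (Ω : Set (Vec d))) ^ s ≠ ⊤ := by
  intro h'
  simp only [regIntegral, regMeasure] at h
  rw [lintegral_const_mul' _ _ ENNReal.ofReal_ne_top, h', ENNReal.mul_top] at h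
  · exact lt_irrefl _ h
  · simpa using hc

theorem toReal_regIntegral {a b : ℝ} (hc : 0 ≤ c) (hs : 0 < s)
    (hm : AEStronglyMeasurable (fun τ => toH10sol (vt τ)) (volume.restrict (Ioo a b)))
    (hK : ∫⁻ τ in Ioo a b,
      eLpNorm (val (toH10sol (vt τ))) r (volume.restrict (Ω : Set (Vec d))) ^ s ≠ ⊤) :
    (regIntegral c s r vt a b).toReal = ∫ τ in Ioo a b, c *
      (eLpNorm (val (toH10sol (vt τ))) r (volume.restrict (Ω : Set (Vec d)))).toReal ^ s := by
  have hm' := (aemeasurable_eLpNorm ((valCLM Ω).continuous.comp_aestronglyMeasurable hm)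
    r).pow_const s
  have hm2 : AEMeasurable (fun τ => regMeasure c s r (val (toH10sol (vt τ))))
      (volume.restrict (Ioo a b)) := hm'.const_mul (ENNReal.ofReal c)
  rw [regIntegral, ← integral_toReal hm2]
  · refine integral_congr_ae (Filter.Eventually.of_forall fun τ => ?_)
    simp only [regMeasure, ENNReal.toReal_mul, ENNReal.toReal_ofReal hc, ENNReal.toReal_rpow]
  · filter_upwards [ae_eLpNorm_ne_top hs hm hK] with τ hτ
    exact ENNReal.mul_lt_top ENNReal.ofReal_lt_top (ENNReal.rpow_lt_top_of_nonneg hs.le hτ)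

end Regularity

/-- Weak solutions with the energy inequality are dissipative solutions. -/
theorem IsWeakSolution.isDissipativeSolution {ν T C s : ℝ} {r : ℝ≥0∞} {f₁ : ℝ → HNeg1 Ω}
    {f₂ : ℝ → L2 Ω (Vec d)} {v₀ : L2sol Ω} {v : ℝ → H10sol Ω}
    (hw : IsWeakSolution ν T f₁ f₂ v₀ v)
    (he : EnergyInequality ν T f₁ f₂ v₀ v) (hT : 0 < T) (hν : 0 < ν)
    (hf₁ : MemLp f₁ 2 (timeMeasure T)) (hf₂ : MemLp f₂ 1 (timeMeasure T))
    (S : SolenoidalMollifier Ω) (hb : Bornology.IsBounded (Ω : Set (Vec d)))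
    (hC : IsProductConst Ω s r C) (hC0 : 0 < C) (hs : 2 ≤ s) (hr : 1 ≤ r) :
    IsDissipativeSolution (absorbConst C ν s) s r ν T f₁ f₂ v₀ v := by
  refine ⟨hw.state, ?_⟩
  have hs0 : 0 < s := by linarith
  have hc := absorbConst_pos (s := s) hC0 hν
  filter_upwards [hw.ae_relEnergy_exp_le he hT hν hf₁ hf₂ S hb hC hC0 hs hr,
    (ae_restrict_mem measurableSet_Ioo : ∀ᵐ t ∂timeMeasure T, t ∈ Ioo 0 T)]
    with t ht hmem vt hvt hreg
  have hp := isC1Path_toH10sol hmem hvt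
  have hK := lintegral_eLpNorm_ne_top hc hreg
  obtain ⟨hint, hle⟩ := ht _ _ _ hp hK fun τ => rfl
  have hexp : ∀ τ ∈ Icc 0 t, (regIntegral (absorbConst C ν s) s r vt τ t).toReal =
      ∫ σ in Ioo τ t, absorbConst C ν s *
        (eLpNorm (val (toH10sol (vt σ))) r (volume.restrict (Ω : Set (Vec d)))).toReal ^ s := by
    intro τ hτ
    have hsub : Ioo τ t ⊆ Ioo 0 t := Ioo_subset_Ioo_left hτ.1
    exact toReal_regIntegral hc.le hs0 (hp.aestronglyMeasurable.mono_set hsub)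
      (ne_top_of_le_ne_top hK (lintegral_mono_set hsub))
  have heq : ∀ τ ∈ Ioo 0 t, relSource ν (f₁ τ) (f₂ τ) (v τ) (toH10sol (vt τ))
      (toH10sol (derivWithin vt (Icc 0 T) τ)) * Real.exp (∫ σ in Ioo τ t, absorbConst C ν s *
        (eLpNorm (val (toH10sol (vt σ))) r (volume.restrict (Ω : Set (Vec d)))).toReal ^ s) =
      relIntegrand (absorbConst C ν s) s r ν T f₁ f₂ v vt t τ := by
    intro τ hτ
    rw [← hexp τ (Ioo_subset_Icc_self hτ)]
    rfl
  refine ⟨?_, hint.congr_fun heq measurableSet_Ioo, ?_⟩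
  · filter_upwards [ae_eLpNorm_ne_top hs0 hp.aestronglyMeasurable hK] with τ hτ
    refine integrable_convIntegrand _ ?_
    rw [prodNorm_comm]
    exact hC.prodNorm_ne_top _ hτ
  · rw [hexp 0 ⟨le_rfl, hmem.1.le⟩, ← setIntegral_congr_fun measurableSet_Ioo heq]
    exact hle

end NavierStokes

end

/-- Every weak solution of the Navier–Stokes equations with the energy inequality is a dissipative
solution. The condition on `s` and `r` forces `2 ≤ s < ∞` and `d < r ≤ ∞`; the constant `c` in
`K(ṽ) = c ‖ṽ‖_{L^r}^s` depends only on `d`, `Ω`, `ν`, `s` and `r`. -/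
theorem proposition3p1 (d : ℕ) (hd : 2 ≤ d) (Ω : TopologicalSpace.Opens (NavierStokes.Vec d))
    (hΩ : NavierStokes.IsLipschitzDomain Ω) (ν : ℝ) (hν : 0 < ν) (s : ℝ) (r : ℝ≥0∞)
    (hsr : 2 / ENNReal.ofReal s + (d : ℝ≥0∞) / r ≤ 1) :
    ∃ c : ℝ, 0 < c ∧
      ∀ (T : ℝ), 0 < T →
      ∀ (f₁ : ℝ → NavierStokes.HNeg1 Ω) (f₂ : ℝ → NavierStokes.L2 Ω (NavierStokes.Vec d)),
        MemLp f₁ 2 (NavierStokes.timeMeasure T) → MemLp f₂ 1 (NavierStokes.timeMeasure T) →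
      ∀ (v₀ : NavierStokes.L2sol Ω) (v : ℝ → NavierStokes.H10sol Ω),
        NavierStokes.IsWeakSolution ν T f₁ f₂ v₀ v →
        NavierStokes.EnergyInequality ν T f₁ f₂ v₀ v →
        NavierStokes.IsDissipativeSolution c s r ν T f₁ f₂ v₀ v := by
  obtain ⟨hs, hr0, -, hr⟩ := NavierStokes.exponents_of_le hd hsr
  -- The averages are bounded in `L^r` only for `r ≥ 1`; here `r > d ≥ 2` or `r = ∞`.
  have hr1 : 1 ≤ r := by
    by_cases h : r = ⊤
    · rw [h]
      exact le_top
    · have h1 : (1 : ℝ) ≤ r.toReal := by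
        have h2 : (2 : ℝ) ≤ d := by exact_mod_cast hd
        linarith [hr h]
      rw [← ENNReal.ofReal_toReal h]
      exact ENNReal.one_le_ofReal.2 h1
  obtain ⟨C, hC0, hC⟩ := NavierStokes.exists_isProductConst hd hsr hΩ.bounded
  obtain ⟨S⟩ := hΩ.nonempty_solenoidalMollifier
  exact ⟨NavierStokes.absorbConst C ν s, NavierStokes.absorbConst_pos hC0 hν,
    fun T hT f₁ f₂ hf₁ hf₂ v₀ v hw he =>
      hw.isDissipativeSolution he hT hν hf₁ hf₂ S hΩ.bounded hC hC0 hs hr1⟩
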